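/- Let $\Omega\subset\mathbb R^2$ be a bounded polygonal domain (open and connected) with Lipschitz boundary. Let $\partial\Omega=\partial\Omega_D\cup\partial\Omega_N$ be a partition with $\partial\Omega_D$ closed and nonempty, and assume that there is $c>0$ with $\mathcal H^1(\partial\Omega_D\cap \overline{B}(x,r))\ge c\,r$ for all $x\in\partial\Omega_D$ and $0<r\le 1$ (which holds, for example, if $\partial\Omega_D$ is a nonempty finite union of nondegenerate closed segments). Let $\alpha\le 0\le\beta$, and put $$\mu_1(t)=\cos t-\alpha\sin t,\quad \mu_2(t)=\cos t+\beta\sin t,\quad \Gamma_{12}=-\frac{\mu_1'}{\mu_2},\quad \Gamma_{21}=\frac{\mu_2'}{\mu_1}.$$ Let $\xi^-\in[-\frac\pi2,0]$ and $\xi^+\in[0,\frac\pi2]$. For $\Gamma\in\{\Gamma_{12},\Gamma_{21}\}$ let $\widehat\Gamma(t)=\Gamma(\xi^+)$ if $t\ge\xi^+$, $\widehat\Gamma(t)=\Gamma(\xi^-)$ if $t\le\xi^-$, and $\widehat\Gamma(t)=\Gamma(t)$ otherwise. Let $\hat B(t)=\mathrm{diag}(-\widehat{\Gamma_{21}}(t),\widehat{\Gamma_{12}}(t))$,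 and assume that $\xi^\pm$ are such that $\hat B$ is bounded on $\mathbb R$. Let $H^{1/2}(\partial\Omega_D;\mathbb R)$ be the space of restrictions to $\partial\Omega_D$ of traces of functions of $H^1(\Omega;\mathbb R)$, with the norm $\|\xi_D\|_{H^{1/2}}=\inf\{\|u\|_{H^1(\Omega)} : u=\xi_D \text{ on }\partial\Omega_D\}$. For $\xi_D\in H^{1/2}(\partial\Omega_D;\mathbb R)$ and $g\in L^2(\partial\Omega_N;\mathbb R)$ put $V_D=\{\zeta\in H^1(\Omega;\mathbb C):\Re\zeta=\xi_D,\ \Im\zeta=0\text{ on }\partial\Omega_D\}$ and $V_0=\{\zeta\in H^1(\Omega;\mathbb C):\zeta=0\text{ on }\partial\Omega_D\}$, in the sense of traces. For $\varepsilon>0$ consider the regularized nonlinear problem: find $\xi_\varepsilon\in V_D$ such that $$\int_\Omega \big(\hat B(\Re\xi_\varepsilon)+i\varepsilon I\big)\nabla\xi_\varepsilon\cdot\overline{\nabla\tilde\zeta}\,dx=\int_{\partial\Omega_N} g\,\overline{\tilde\zeta}\,ds\qquad\text{for all }\tilde\zeta\in V_0 .$$ Then for every $\varepsilon>0$ there is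 $\delta_0>0$, depending only on $\Omega,\partial\Omega_D,\alpha,\beta,\xi^\pm,\varepsilon$, such that for all $0<\delta\le\delta_0$, all $\xi_D\in H^{1/2}(\partial\Omega_D;\mathbb R)$ with $\|\xi_D\|_{H^{1/2}(\partial\Omega_D)}\le\delta$ and all $g\in L^2(\partial\Omega_N;\mathbb R)$ with $\|g\|_{L^2(\partial\Omega_N)}\le\delta$, this problem has exactly one solution $\xi_\varepsilon\in V_D$. -/

import Mathlib

open MeasureTheory Filter Topology
open scoped ContDiff Matrix

noncomputable section

namespace RhombiSlits

/-! ### Geometry -/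

abbrev Plane := EuclideanSpace ℝ (Fin 2)

/-- The boundary of `Ω` is, locally and in suitable orthonormal coordinates, the graph of a
Lipschitz function, with `Ω` lying on one side of the graph. -/
def HasLipschitzBoundary (Ω : Set Plane) : Prop :=
  ∀ p ∈ frontier Ω, ∃ (e : Plane ≃ₗᵢ[ℝ] Plane) (r : ℝ) (K : NNReal) (γ : ℝ → ℝ),
    0 < r ∧ LipschitzWith K γ ∧
      ∀ x ∈ Metric.ball p r, (x ∈ Ω ↔ γ (e x 0) < e x 1)

/-- Bounded polygonal domains with Lipschitz boundary. -/
structure IsPolygonalDomain (Ω : Set Plane) : Prop where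
  isOpen : IsOpen Ω
  isConnected : IsConnected Ω
  isBounded : Bornology.IsBounded Ω
  polygonal : ∃ S : Finset (Plane × Plane), frontier Ω = ⋃ s ∈ S, segment ℝ s.1 s.2
  lipschitz : HasLipschitzBoundary Ω

/-- Arc length on a subset of the plane. -/
abbrev arc (S : Set Plane) : Measure Plane :=
  (Measure.hausdorffMeasure 1 : Measure Plane).restrict S

/-- Admissible Dirichlet parts: nonempty closed parts of the boundary satisfying the lower
density bound `ℋ¹(D ∩ B(x, r)) ≥ c r`. Every nonempty finite union of nondegenerate closed
segments satisfies it. -/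
structure IsDirichletPart (Ω D : Set Plane) : Prop where
  subset : D ⊆ frontier Ω
  isClosed : IsClosed D
  nonempty : D.Nonempty
  density : ∃ c : ℝ, 0 < c ∧ ∀ x ∈ D, ∀ r : ℝ, 0 < r → r ≤ 1 →
    ENNReal.ofReal (c * r) ≤ arc D (Metric.closedBall x r)

/-! ### Sobolev space and traces -/

section Sobolev

variable (Ω : Set Plane) (𝕜 : Type) [RCLike 𝕜]

/-- `L²(Ω; 𝕜) × L²(Ω; 𝕜²)` with its Hilbert norm `(‖u‖² + ‖G‖²)^(1/2)`. -/
abbrev L2Pair : Type :=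
  WithLp 2 (Lp 𝕜 2 (volume.restrict Ω) × Lp (EuclideanSpace 𝕜 (Fin 2)) 2 (volume.restrict Ω))

variable {Ω 𝕜}

/-- `i`-th partial derivative of a differentiable function. -/
def pderiv {F : Type} [NormedAddCommGroup F] [NormedSpace ℝ F]
    (φ : Plane → F) (i : Fin 2) (x : Plane) : F :=
  fderiv ℝ φ x (EuclideanSpace.single i 1)

/-- `p.snd` is the weak gradient of `p.fst` in `Ω`. -/
def IsWeakGradientPair (p : L2Pair Ω 𝕜) : Prop :=
  ∀ φ : Plane → ℝ, ContDiff ℝ ∞ φ → HasCompactSupport φ → tsupport φ ⊆ Ω → ∀ i : Fin 2,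
    ∫ x in Ω, pderiv φ i x • p.fst x = - ∫ x in Ω, φ x • p.snd x i

theorem integrable_smul_aux {ψ : Plane → ℝ} (hψ : Continuous ψ) (hc : HasCompactSupport ψ)
    {f : Plane → 𝕜} (hf : MemLp f 2 (volume.restrict Ω)) :
    Integrable (fun x => ψ x • f x) (volume.restrict Ω) := by
  have h : MemLp ψ 2 (volume.restrict Ω) :=
    (hψ.memLp_of_hasCompactSupport (μ := (volume : Measure Plane)) hc).restrict Ω
  exact memLp_one_iff_integrable.mp (hf.smul h)

theorem continuous_pderiv {φ : Plane → ℝ} (h : ContDiff ℝ ∞ φ) (i : Fin 2) :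
    Continuous (pderiv φ i) :=
  (h.continuous_fderiv (by simp)).clm_apply continuous_const

theorem hasCompactSupport_pderiv {φ : Plane → ℝ} (h : HasCompactSupport φ) (i : Fin 2) :
    HasCompactSupport (pderiv φ i) :=
  h.fderiv_apply (𝕜 := ℝ) _

theorem memLp_coord (G : Lp (EuclideanSpace 𝕜 (Fin 2)) 2 (volume.restrict Ω)) (i : Fin 2) :
    MemLp (fun x => G x i) 2 (volume.restrict Ω) :=
  (EuclideanSpace.proj (𝕜 := 𝕜) i :
    EuclideanSpace 𝕜 (Fin 2) →L[𝕜] 𝕜).comp_memLp' (Lp.memLp G)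

variable (Ω 𝕜)

/-- The Sobolev space `H¹(Ω; 𝕜)`: a function of `L²(Ω; 𝕜)` together with its (unique) weak
gradient in `L²(Ω; 𝕜²)`; the norm is the usual one, `(‖u‖² + ‖∇u‖²)^(1/2)`. -/
def H1 : Submodule 𝕜 (L2Pair Ω 𝕜) where
  carrier := {p | IsWeakGradientPair p}
  zero_mem' := by
    intro φ _ _ _ i
    have h1 : ∫ x in Ω, pderiv φ i x • (0 : L2Pair Ω 𝕜).fst x = 0 := by
      refine integral_eq_zero_of_ae ?_
      filter_upwards [Lp.coeFn_zero 𝕜 2 (volume.restrict Ω)] with x hx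
      rw [WithLp.zero_fst, hx]
      simp
    have h2 : ∫ x in Ω, φ x • (0 : L2Pair Ω 𝕜).snd x i = 0 := by
      refine integral_eq_zero_of_ae ?_
      filter_upwards [Lp.coeFn_zero (EuclideanSpace 𝕜 (Fin 2)) 2 (volume.restrict Ω)] with x hx
      rw [WithLp.zero_snd, hx]
      simp
    rw [h1, h2, neg_zero]
  add_mem' := by
    intro p q hp hq φ h1 h2 h3 i
    have e1 : ∫ x in Ω, pderiv φ i x • (p + q).fst x
        = (∫ x in Ω, pderiv φ i x • p.fst x) + ∫ x in Ω, pderiv φ i x • q.fst x := by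
      rw [← integral_add
        (integrable_smul_aux (continuous_pderiv h1 i) (hasCompactSupport_pderiv h2 i)
          (Lp.memLp p.fst))
        (integrable_smul_aux (continuous_pderiv h1 i) (hasCompactSupport_pderiv h2 i)
          (Lp.memLp q.fst))]
      refine integral_congr_ae ?_
      filter_upwards [Lp.coeFn_add p.fst q.fst] with x hx
      rw [WithLp.add_fst, hx, Pi.add_apply, smul_add]
    have e2 : ∫ x in Ω, φ x • (p + q).snd x i
        = (∫ x in Ω, φ x • p.snd x i) + ∫ x in Ω, φ x • q.snd x i := by
      rw [← integral_add
        (integrable_smul_aux h1.continuous h2 (memLp_coord p.snd i))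
        (integrable_smul_aux h1.continuous h2 (memLp_coord q.snd i))]
      refine integral_congr_ae ?_
      filter_upwards [Lp.coeFn_add p.snd q.snd] with x hx
      rw [WithLp.add_snd, hx, Pi.add_apply, PiLp.add_apply, smul_add]
    rw [e1, e2, hp φ h1 h2 h3 i, hq φ h1 h2 h3 i, neg_add]
  smul_mem' := by
    intro c p hp φ h1 h2 h3 i
    have e1 : ∫ x in Ω, pderiv φ i x • (c • p).fst x
        = c * ∫ x in Ω, pderiv φ i x • p.fst x := by
      rw [← integral_const_mul]
      refine integral_congr_ae ?_
      filter_upwards [Lp.coeFn_smul c p.fst] with x hx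
      rw [WithLp.smul_fst, hx, Pi.smul_apply, smul_eq_mul, mul_smul_comm]
    have e2 : ∫ x in Ω, φ x • (c • p).snd x i = c * ∫ x in Ω, φ x • p.snd x i := by
      rw [← integral_const_mul]
      refine integral_congr_ae ?_
      filter_upwards [Lp.coeFn_smul c p.snd] with x hx
      rw [WithLp.smul_snd, hx, Pi.smul_apply, PiLp.smul_apply, smul_eq_mul, mul_smul_comm]
    rw [e1, e2, hp φ h1 h2 h3 i, mul_neg]

variable {Ω 𝕜}

/-- The `L²` function underlying an element of `H¹`. -/
def h1Fn (u : H1 Ω 𝕜) : Lp 𝕜 2 (volume.restrict Ω) := (u : L2Pair Ω 𝕜).fst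

/-- The weak gradient of an element of `H¹`. -/
def h1Grad (u : H1 Ω 𝕜) : Lp (EuclideanSpace 𝕜 (Fin 2)) 2 (volume.restrict Ω) :=
  (u : L2Pair Ω 𝕜).snd

/-- Classical gradient of a differentiable function. -/
def classicalGrad (φ : Plane → 𝕜) (x : Plane) : EuclideanSpace 𝕜 (Fin 2) :=
  WithLp.toLp 2 fun i => pderiv φ i x

/-- `f ∈ L²(∂Ω)` is the trace of `u ∈ H¹(Ω)`: there are functions, smooth on the whole plane,
which converge to `u` in `H¹(Ω)` and whose restrictions to `∂Ω` converge to `f` in `L²(∂Ω)`. -/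
def IsTrace (u : H1 Ω 𝕜) (f : Lp 𝕜 2 (arc (frontier Ω))) : Prop :=
  ∃ φ : ℕ → Plane → 𝕜, (∀ n, ContDiff ℝ ∞ (φ n)) ∧
    Tendsto (fun n => eLpNorm (fun x => φ n x - h1Fn u x) 2 (volume.restrict Ω)) atTop (𝓝 0) ∧
    Tendsto (fun n => eLpNorm (fun x => classicalGrad (φ n) x - h1Grad u x) 2
      (volume.restrict Ω)) atTop (𝓝 0) ∧
    Tendsto (fun n => eLpNorm (fun x => φ n x - f x) 2 (arc (frontier Ω))) atTop (𝓝 0)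

end Sobolev

/-- `u = ξ` on `D`, in the sense of traces. -/
def HasTraceOn {Ω : Set Plane} {𝕜 : Type} [RCLike 𝕜] (D : Set Plane) (u : H1 Ω 𝕜)
    (ξ : Plane → 𝕜) : Prop :=
  ∃ f : Lp 𝕜 2 (arc (frontier Ω)), IsTrace u f ∧ f =ᵐ[arc D] ξ

/-- `H^{1/2}(D; ℝ)`: the restrictions to `D` of traces of functions of `H¹(Ω; ℝ)`. -/
def HHalf (Ω D : Set Plane) : Set (Lp ℝ 2 (arc D)) :=
  {ξ | ∃ u : H1 Ω ℝ, HasTraceOn D u ξ}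

/-- The norm of `H^{1/2}(D; ℝ)`: the quotient norm
`inf {‖u‖_{H¹(Ω)} : u = ξ on D}`. -/
def hHalfNorm (Ω D : Set Plane) (ξ : Lp ℝ 2 (arc D)) : ℝ :=
  sInf {t | ∃ u : H1 Ω ℝ, HasTraceOn D u ξ ∧ t = ‖u‖}

/-- `V_D`: functions of `H¹(Ω; ℂ)` with real part `ξD` and imaginary part `0` on `D`. -/
def VD (Ω D : Set Plane) (ξD : Lp ℝ 2 (arc D)) : Set (H1 Ω ℂ) :=
  {ζ | HasTraceOn D ζ fun x => (ξD x : ℂ)}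

/-! ### Coefficients -/

def mu1 (α t : ℝ) : ℝ := Real.cos t - α * Real.sin t

def mu2 (β t : ℝ) : ℝ := Real.cos t + β * Real.sin t

def Gamma12 (α β t : ℝ) : ℝ := -(deriv (mu1 α) t / mu2 β t)

def Gamma21 (α β t : ℝ) : ℝ := deriv (mu2 β) t / mu1 α t

/-- Cut-off of `Γ` outside `(ξm, ξp)`. -/
def cutoff (ξm ξp : ℝ) (Γ : ℝ → ℝ) (t : ℝ) : ℝ :=
  if ξp ≤ t then Γ ξp else if t ≤ ξm then Γ ξm else Γ t

/-- The matrix `B̂(t) = diag(-Γ̂₂₁(t), Γ̂₁₂(t))`. -/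
def Bhat (α β ξm ξp t : ℝ) : Matrix (Fin 2) (Fin 2) ℝ :=
  !![-cutoff ξm ξp (Gamma21 α β) t, 0; 0, cutoff ξm ξp (Gamma12 α β) t]

/-! ### Weak formulation -/

/-- `a_ε(ξ; ζ, η) = ∫_Ω (B̂(ξ) + i ε I) ∇ζ · conj ∇η`. -/
def aForm {Ω : Set Plane} (α β ξm ξp ε : ℝ) (ξ : Plane → ℝ) (ζ η : H1 Ω ℂ) : ℂ :=
  ∫ x in Ω, (((Bhat α β ξm ξp (ξ x)).map Complex.ofReal
      + (Complex.I * (ε : ℂ)) • (1 : Matrix (Fin 2) (Fin 2) ℂ)) *ᵥ (h1Grad ζ x).ofLp)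
        ⬝ᵥ star (h1Grad η x).ofLp

/-- `∫_{∂Ω ∖ D} g conj f`, the linear form `l` evaluated at a function with trace `f`. -/
def lForm {Ω : Set Plane} (D : Set Plane) (g : Lp ℝ 2 (arc (frontier Ω \ D)))
    (f : Lp ℂ 2 (arc (frontier Ω))) : ℂ :=
  ∫ x, (g x : ℂ) * star (f x) ∂(arc (frontier Ω \ D))

/-- `ξ ∈ V_D` and `a_ε(Re ξ; ξ, η) = l(η)` for all `η ∈ V_0`, i.e. for all `η ∈ H¹(Ω; ℂ)`
whose trace `f` vanishes on `D`. -/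
def IsSolution {Ω : Set Plane} (D : Set Plane) (α β ξm ξp ε : ℝ) (ξD : Lp ℝ 2 (arc D))
    (g : Lp ℝ 2 (arc (frontier Ω \ D))) (ξ : H1 Ω ℂ) : Prop :=
  ξ ∈ VD Ω D ξD ∧
    ∀ (η : H1 Ω ℂ) (f : Lp ℂ 2 (arc (frontier Ω))), IsTrace η f → f =ᵐ[arc D] 0 →
      aForm α β ξm ξp ε (fun x => (h1Fn ξ x).re) ξ η = lForm D g f

end RhombiSlits

end

/-! Freeze the coefficient. For `u` in `L^{4k}(Ω)` let `S(u) ∈ V_D` solve the linear problem with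
coefficient `B̂(u) + iεI`. Since `B̂` is real, the imaginary part of the form is exactly `ε‖∇ζ‖²`,
whatever the signs of the entries of `B̂`. With the Friedrichs inequality the form is coercive on
`V₀`, Lax–Milgram yields `S(u)`, and the energy estimate gives `‖∇S(u)‖₂ ≤ Cδ`. Solutions of the
nonlinear problem correspond to fixed points of `u ↦ Re S(u)`, so it suffices that this map
contracts `L^{4k}` when `δ` is small (`exists_contraction`, `exists_unique_solution`).

For the contraction, a bounded quotient of the trigonometric functions in question has no pole, so
`B̂` is Lipschitz (`exists_lipschitz_Bhat`). If `m₁`, `m₂` are two frozen coefficients and `w = S₁ -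
S₂`, then `b_{m₁}(w, η) = ∫ (m₂ - m₁)∇S₂ · conj ∇η` for `η ∈ V₀`. As `∇S₂` is only known in `L²`,
the product `|u₁ - u₂||∇S₂|` is controlled only in `L^q` for some `q < 2`. One argues by duality:
`η` is the adjoint solution with right-hand side `|∇w|^{q-2}∇w`, and the estimate `‖∇η‖_p ≤ C‖F‖_p`
for the conjugate exponent `p > 2` is the Meyers estimate (`IsAdjointSolution.meyers`). With `q =
4k/(2k+1)` the Hölder relation `1/(4k) + 1/2 = 1/q` and the embedding `W^{1,q} ⊂ L^{4k}` fit
together and give `‖w‖_{4k} ≤ C‖∇S₂‖₂‖u₁ - u₂‖_{4k}`, whose factor is `O(δ)`.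

The Meyers estimate comes from a Caccioppoli inequality and the local Sobolev–Poincaré inequality
`‖v - c‖_{L²(Ω∩B_r)} ≤ C‖∇v‖_{L¹(Ω∩B_{Kr})}`, uniform up to the boundary and with `c = 0` near `D`
once `v` vanishes there. Together they form a reverse Hölder inequality, which `gehring` turns into
higher integrability. The Lipschitz boundary enters only through a uniform cone condition
(`exists_uniformCone`): integrating along two independent directions of a cone gives the step from
`L¹` to `L²` (`exists_local_sobolev`). The density of `D` provides the case `c = 0`. The global
Friedrichs, trace and Sobolev inequalities follow from the same local ones. All are proved for
smooth functions and passed to limits (`SmoothLimit`); functions with a trace are such limits by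
definition. -/

namespace RhombiSlits

/-! ### Integration in oblique coordinates -/

/-- The determinant of a pair of vectors. -/
def det2 (a b : Plane) : ℝ := a 0 * b 1 - a 1 * b 0

/-- Rotation by a right angle. -/
noncomputable def perp (e : Plane) : Plane := !₂[-e 1, e 0]

theorem lintegral_plane_eq_pi {f : Plane → ENNReal} (hf : Measurable f) :
    ∫⁻ x, f x = ∫⁻ y : Fin 2 → ℝ, f (WithLp.toLp 2 y) := by
  have h := (EuclideanSpace.volume_preserving_symm_measurableEquiv_toLp (Fin 2)).symm
  simpa using (h.lintegral_comp hf).symm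

/-- Linear change of variables with the matrix whose columns are `a` and `b`, followed by Tonelli.
-/
theorem lintegral_oblique {f : Plane → ENNReal} (hf : Measurable f) (a b : Plane)
    (hab : det2 a b ≠ 0) :
    ∫⁻ x, f x = ENNReal.ofReal |det2 a b| * ∫⁻ s : ℝ, ∫⁻ t : ℝ, f (s • a + t • b) := by
  set M : Matrix (Fin 2) (Fin 2) ℝ := !![a 0, b 0; a 1, b 1] with hM
  have hdet : M.det = det2 a b := by
    rw [hM, Matrix.det_fin_two_of, det2]; ring
  have hmap := Real.map_matrix_volume_pi_eq_smul_volume_pi (M := M) (by rw [hdet]; exact hab)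
  have hg : Measurable fun y : Fin 2 → ℝ => f (WithLp.toLp 2 y) :=
    hf.comp (WithLp.measurable_toLp 2 _)
  have h1 : ∫⁻ y : Fin 2 → ℝ, f (WithLp.toLp 2 (Matrix.toLin' M y))
      = ENNReal.ofReal |M.det⁻¹| * ∫⁻ y : Fin 2 → ℝ, f (WithLp.toLp 2 y) := by
    have hlin : Measurable fun y : Fin 2 → ℝ => Matrix.toLin' M y :=
      (LinearMap.continuous_of_finiteDimensional (Matrix.toLin' M)).measurable
    rw [← lintegral_map hg hlin, hmap, lintegral_smul_measure, smul_eq_mul]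
  have h2 : ∫⁻ y : Fin 2 → ℝ, f (WithLp.toLp 2 (Matrix.toLin' M y))
      = ∫⁻ s : ℝ, ∫⁻ t : ℝ, f (s • a + t • b) := by
    have hc : Continuous fun z : ℝ × ℝ => z.1 • a + z.2 • b := by fun_prop
    have hm := (volume_preserving_finTwoArrow ℝ).lintegral_comp (hf.comp hc.measurable)
    have hv : (volume : Measure (ℝ × ℝ)) = (volume : Measure ℝ).prod volume := rfl
    rw [hv, lintegral_prod _ (hf.comp hc.measurable).aemeasurable] at hm
    rw [← show _ = ∫⁻ s : ℝ, ∫⁻ t : ℝ, f (s • a + t • b) from hm]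
    refine lintegral_congr fun y => ?_
    congr 1
    ext i
    fin_cases i <;> simp [hM, Matrix.toLin'_apply, Matrix.mulVec, dotProduct, Fin.sum_univ_two,
      MeasurableEquiv.finTwoArrow] <;> ring
  rw [lintegral_plane_eq_pi hf, ← h2, h1, ← mul_assoc, ← ENNReal.ofReal_mul (abs_nonneg _),
    ← abs_mul, ← hdet, mul_inv_cancel₀ (by rw [hdet]; exact hab)]
  simp

theorem det2_swap (a b : Plane) : det2 b a = -det2 a b := by simp only [det2]; ring

/-- By translation invariance, a line integral in direction `a` forgets the `a`-coordinate of its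
base point. This is what lets a product of two line integrals factorise. -/
theorem lintegral_line_const {H : Plane → ENNReal} (a b : Plane) (s t : ℝ) :
    ∫⁻ τ : ℝ, H (s • a + t • b + τ • a) = ∫⁻ τ : ℝ, H (τ • a + t • b) := by
  rw [← lintegral_add_left_eq_self (fun τ : ℝ => H (τ • a + t • b)) s]
  refine lintegral_congr fun τ => ?_
  congr 1
  rw [add_smul]; abel

theorem lintegral_line_const' {H : Plane → ENNReal} (a b : Plane) (s t : ℝ) :
    ∫⁻ τ : ℝ, H (s • a + t • b + τ • b) = ∫⁻ τ : ℝ, H (s • a + τ • b) := by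
  rw [← lintegral_add_left_eq_self (fun τ : ℝ => H (s • a + τ • b)) t]
  refine lintegral_congr fun τ => ?_
  congr 1
  rw [add_smul]; abel

/-- A function dominated by its line integrals in two independent directions is square
integrable. -/
theorem lintegral_sq_le_of_lines {H f : Plane → ENNReal} (hH : Measurable H) (a b : Plane)
    (hab : det2 a b ≠ 0) (S : Set Plane) (hS : MeasurableSet S)
    (ha : ∀ y ∈ S, f y ≤ ∫⁻ t : ℝ, H (y + t • a)) (hb : ∀ y ∈ S, f y ≤ ∫⁻ t : ℝ, H (y + t • b)) :
    ∫⁻ y in S, f y ^ 2 ≤ (ENNReal.ofReal |det2 a b|)⁻¹ * (∫⁻ y, H y) ^ 2 := by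
  have hma : Measurable fun y => ∫⁻ t : ℝ, H (y + t • a) :=
    Measurable.lintegral_prod_right' (f := fun z : Plane × ℝ => H (z.1 + z.2 • a))
      (hH.comp (by fun_prop))
  have hmb : Measurable fun y => ∫⁻ t : ℝ, H (y + t • b) :=
    Measurable.lintegral_prod_right' (f := fun z : Plane × ℝ => H (z.1 + z.2 • b))
      (hH.comp (by fun_prop))
  have hmq : Measurable fun s : ℝ => ∫⁻ τ : ℝ, H (s • a + τ • b) :=
    Measurable.lintegral_prod_right' (f := fun z : ℝ × ℝ => H (z.1 • a + z.2 • b))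
      (hH.comp (by fun_prop))
  have hmp : Measurable fun t : ℝ => ∫⁻ τ : ℝ, H (τ • a + t • b) :=
    Measurable.lintegral_prod_right' (f := fun z : ℝ × ℝ => H (z.2 • a + z.1 • b))
      (hH.comp (by fun_prop))
  set d := ENNReal.ofReal |det2 a b| with hd
  have hd0 : d ≠ 0 := by
    rw [hd]; simpa using hab
  have hdt : d ≠ ⊤ := ENNReal.ofReal_ne_top
  have hq : d * ∫⁻ s : ℝ, ∫⁻ τ : ℝ, H (s • a + τ • b) = ∫⁻ y, H y := by
    rw [lintegral_oblique hH a b hab]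
  have hp : d * ∫⁻ t : ℝ, ∫⁻ τ : ℝ, H (τ • a + t • b) = ∫⁻ y, H y := by
    rw [lintegral_oblique hH b a (by rw [det2_swap]; simpa using hab), det2_swap, abs_neg]
    simp only [add_comm, hd]
  -- `f²` is at most the product of the two line integrals. In the coordinates `(s, t)` one factor
  -- depends on `t` only and the other on `s` only, so the double integral splits; each factor
  -- equals `d⁻¹ ∫ H`.
  calc ∫⁻ y in S, f y ^ 2
      ≤ ∫⁻ y in S, (∫⁻ t : ℝ, H (y + t • a)) * ∫⁻ t : ℝ, H (y + t • b) := by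
        refine setLIntegral_mono' hS fun y hy => ?_
        rw [sq]
        exact mul_le_mul' (ha y hy) (hb y hy)
    _ ≤ ∫⁻ y, (∫⁻ t : ℝ, H (y + t • a)) * ∫⁻ t : ℝ, H (y + t • b) := setLIntegral_le_lintegral _ _
    _ = d * ∫⁻ s : ℝ, ∫⁻ t : ℝ, (∫⁻ τ : ℝ, H (τ • a + t • b)) * ∫⁻ τ : ℝ, H (s • a + τ • b) := by
        refine (lintegral_oblique (hma.mul hmb) a b hab).trans ?_
        simp only [lintegral_line_const, lintegral_line_const', hd, Pi.mul_apply]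
    _ = d * ((∫⁻ t : ℝ, ∫⁻ τ : ℝ, H (τ • a + t • b)) * ∫⁻ s : ℝ, ∫⁻ τ : ℝ, H (s • a + τ • b)) := by
        congr 1
        rw [← lintegral_const_mul _ hmq]
        refine lintegral_congr fun s => ?_
        rw [lintegral_mul_const _ hmp]
    _ = d⁻¹ * (∫⁻ y, H y) ^ 2 := by
        nth_rewrite 1 [sq]
        nth_rewrite 1 [← hp]
        rw [← hq]
        rw [show ∀ A B : ENNReal, d⁻¹ * (d * A * (d * B)) = (d⁻¹ * d) * (d * (A * B)) by
          intros; ring, ENNReal.inv_mul_cancel hd0 hdt, one_mul]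

/-! ### The fundamental theorem of calculus along segments -/

variable {F : Type*} [NormedAddCommGroup F] [NormedSpace ℝ F] [CompleteSpace F]

theorem enorm_sub_le_lintegral_line {v : Plane → F} (hv : ContDiff ℝ 1 v) (y a : Plane) {h : ℝ}
    (hh : 0 ≤ h) :
    ‖v (y + h • a) - v y‖ₑ ≤ ∫⁻ t in Set.Ioc 0 h, ‖fderiv ℝ v (y + t • a)‖ₑ * ‖a‖ₑ := by
  have hd : ∀ t : ℝ, HasDerivAt (fun t : ℝ => v (y + t • a)) (fderiv ℝ v (y + t • a) a) t := by
    intro t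
    have h1 : HasFDerivAt v (fderiv ℝ v (y + t • a)) (y + t • a) :=
      (hv.differentiable (by norm_num) _).hasFDerivAt
    have h2 : HasDerivAt (fun t : ℝ => y + t • a) a t := by
      simpa using ((hasDerivAt_id t).smul_const a).const_add y
    exact h1.comp_hasDerivAt t h2
  have hc : Continuous fun t : ℝ => fderiv ℝ v (y + t • a) a :=
    ((hv.continuous_fderiv (by norm_num)).comp (by fun_prop)).clm_apply continuous_const
  have hi := intervalIntegral.integral_eq_sub_of_hasDerivAt (fun t _ => hd t)
    (hc.intervalIntegrable 0 h)
  simp only [zero_smul, add_zero] at hi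
  rw [← hi, intervalIntegral.integral_of_le hh]
  refine (enorm_integral_le_lintegral_enorm _).trans (lintegral_mono fun t => ?_)
  exact ContinuousLinearMap.le_opENorm _ _

end RhombiSlits

namespace RhombiSlits

/-! ### The uniform cone condition -/

/-- At every point of the closure there is a cone of directions, of aperture and height at least
`ρ`, along which `Ω` is entered from every nearby point. -/
def UniformCone (Ω : Set Plane) (ρ : ℝ) : Prop :=
  ∀ x ∈ closure Ω, ∃ e : Plane, ‖e‖ = 1 ∧ ∀ y ∈ closure Ω, dist y x < ρ →
    ∀ t : ℝ, 0 < t → t ≤ ρ → ∀ v : Plane, ‖v‖ < ρ → y + t • (e + v) ∈ Ω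

theorem abs_apply_le_norm (v : Plane) (i : Fin 2) : |v i| ≤ ‖v‖ := by
  simpa using PiLp.norm_apply_le v i

/-- Moving by `t(e + v)`, with `e` the vertical direction of the graph, raises the height by at
least `t(1 - ‖v‖)`, while the graph rises by at most `Kt‖v‖`. The point stays above the graph as
soon as `(1 + K)‖v‖ < 1`. -/
theorem exists_cone_of_mem_frontier {Ω : Set Plane} (hL : HasLipschitzBoundary Ω) {p : Plane}
    (hp : p ∈ frontier Ω) : ∃ ρ : ℝ, 0 < ρ ∧ ∃ e : Plane, ‖e‖ = 1 ∧ ∀ y ∈ Ω, dist y p < ρ →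
      ∀ t : ℝ, 0 < t → t ≤ ρ → ∀ v : Plane, ‖v‖ < ρ → y + t • (e + v) ∈ Ω := by
  obtain ⟨e, r, K, γ, hr, hγ, h⟩ := hL p hp
  have hK : (0 : ℝ) < 1 + K := by positivity
  refine ⟨min (min 1 (r / 4)) (1 / (1 + K)), by positivity, e.symm (EuclideanSpace.single 1 1),
    by simp, fun y hy hyp t ht htρ v hv => ?_⟩
  simp only [lt_min_iff, le_min_iff] at hyp htρ hv
  have hyr : y ∈ Metric.ball p r := by
    rw [Metric.mem_ball]; linarith [hyp.1.2]
  have hw : y + t • (e.symm (EuclideanSpace.single 1 1) + v) ∈ Metric.ball p r := by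
    rw [Metric.mem_ball, dist_eq_norm]
    have h1 : ‖t • (e.symm (EuclideanSpace.single 1 1) + v)‖ ≤ t * (1 + 1) := by
      rw [norm_smul, Real.norm_of_nonneg ht.le]
      gcongr
      refine (norm_add_le _ _).trans ?_
      have : ‖e.symm (EuclideanSpace.single (1 : Fin 2) (1 : ℝ))‖ = 1 := by simp
      linarith [hv.1.1]
    have h2 : ‖y - p‖ < r / 4 := by rw [← dist_eq_norm]; exact hyp.1.2
    calc ‖y + t • (e.symm (EuclideanSpace.single 1 1) + v) - p‖
        = ‖(y - p) + t • (e.symm (EuclideanSpace.single 1 1) + v)‖ := by congr 1; abel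
      _ ≤ ‖y - p‖ + ‖t • (e.symm (EuclideanSpace.single 1 1) + v)‖ := norm_add_le _ _
      _ < r := by linarith [htρ.1.2]
  rw [h _ hw]
  have hy' := (h y hyr).1 hy
  simp only [map_add, map_smul, LinearIsometryEquiv.apply_symm_apply, PiLp.add_apply,
    PiLp.smul_apply, smul_eq_mul]
  have e0 : (EuclideanSpace.single (1 : Fin 2) (1 : ℝ)) 0 = 0 := by simp
  have e1 : (EuclideanSpace.single (1 : Fin 2) (1 : ℝ)) 1 = 1 := by simp
  rw [e0, e1, zero_add]
  have hlip : γ (e y 0 + t * e v 0) ≤ γ (e y 0) + K * (t * ‖v‖) := by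
    have h1 := hγ.dist_le_mul (e y 0 + t * e v 0) (e y 0)
    rw [Real.dist_eq, Real.dist_eq] at h1
    have h2 : |e y 0 + t * e v 0 - e y 0| ≤ t * ‖v‖ := by
      rw [add_sub_cancel_left, abs_mul, abs_of_pos ht]
      gcongr
      simpa using abs_apply_le_norm (e v) 0
    have h3 := mul_le_mul_of_nonneg_left h2 K.2
    have h4 := le_abs_self (γ (e y 0 + t * e v 0) - γ (e y 0))
    have h5 : (K : ℝ) * |e y 0 + t * e v 0 - e y 0| ≤ K * (t * ‖v‖) := h3
    linarith
  have h6 : -‖v‖ ≤ e v 1 := by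
    have := abs_apply_le_norm (e v) 1
    rw [LinearIsometryEquiv.norm_map] at this
    linarith [neg_abs_le (e v 1)]
  have h7 : (1 + K) * ‖v‖ < 1 := by
    have := hv.2
    rw [lt_div_iff₀ hK] at this
    linarith
  nlinarith

/-- Compactness of the closure makes the local cones uniform, first for base points in `Ω`. Base
points in the closure are then reached by approximation, the openness of the aperture absorbing the
error. -/
theorem exists_uniformCone {Ω : Set Plane} (hΩ : IsPolygonalDomain Ω) :
    ∃ ρ : ℝ, 0 < ρ ∧ ρ ≤ 1 ∧ UniformCone Ω ρ := by
  have hcpt : IsCompact (closure Ω) := hΩ.isBounded.isCompact_closure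
  have key : ∃ ρ : ℝ, 0 < ρ ∧ ∀ x ∈ closure Ω, ∃ e : Plane, ‖e‖ = 1 ∧ ∀ y ∈ Ω, dist y x < ρ →
      ∀ t : ℝ, 0 < t → t ≤ ρ → ∀ v : Plane, ‖v‖ < ρ → y + t • (e + v) ∈ Ω := by
    refine hcpt.induction_on (p := fun S => ∃ ρ : ℝ, 0 < ρ ∧ ∀ x ∈ S, ∃ e : Plane, ‖e‖ = 1 ∧
      ∀ y ∈ Ω, dist y x < ρ → ∀ t : ℝ, 0 < t → t ≤ ρ → ∀ v : Plane, ‖v‖ < ρ →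
        y + t • (e + v) ∈ Ω) ⟨1, one_pos, by simp⟩ ?_ ?_ ?_
    · rintro s t hst ⟨ρ, hρ, h⟩
      exact ⟨ρ, hρ, fun x hx => h x (hst hx)⟩
    · rintro s t ⟨ρ, hρ, h⟩ ⟨ρ', hρ', h'⟩
      refine ⟨min ρ ρ', lt_min hρ hρ', ?_⟩
      rintro x (hx | hx)
      · obtain ⟨e, he, h⟩ := h x hx
        exact ⟨e, he, fun y hy hd t ht htr v hv => h y hy (hd.trans_le (min_le_left _ _)) t ht
          (htr.trans (min_le_left _ _)) v (hv.trans_le (min_le_left _ _))⟩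
      · obtain ⟨e, he, h⟩ := h' x hx
        exact ⟨e, he, fun y hy hd t ht htr v hv => h y hy (hd.trans_le (min_le_right _ _)) t ht
          (htr.trans (min_le_right _ _)) v (hv.trans_le (min_le_right _ _))⟩
    · intro p hp
      have hloc : ∃ ρ : ℝ, 0 < ρ ∧ ∃ e : Plane, ‖e‖ = 1 ∧ ∀ y ∈ Ω, dist y p < ρ →
          ∀ t : ℝ, 0 < t → t ≤ ρ → ∀ v : Plane, ‖v‖ < ρ → y + t • (e + v) ∈ Ω := by
        by_cases hpΩ : p ∈ Ω
        · obtain ⟨r, hr, hball⟩ := Metric.isOpen_iff.1 hΩ.isOpen p hpΩ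
          refine ⟨min 1 (r / 4), by positivity, EuclideanSpace.single 0 1, by simp,
            fun y hy hyp t ht htρ v hv => hball ?_⟩
          simp only [lt_min_iff, le_min_iff] at hyp htρ hv
          rw [Metric.mem_ball, dist_eq_norm]
          have h1 : ‖t • (EuclideanSpace.single (0 : Fin 2) (1 : ℝ) + v)‖ ≤ t * (1 + 1) := by
            rw [norm_smul, Real.norm_of_nonneg ht.le]
            gcongr
            refine (norm_add_le _ _).trans ?_
            have : ‖(EuclideanSpace.single (0 : Fin 2) (1 : ℝ))‖ = 1 := by simp
            linarith [hv.1]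
          have h2 : ‖y - p‖ < r / 4 := by rw [← dist_eq_norm]; exact hyp.2
          calc ‖y + t • (EuclideanSpace.single 0 1 + v) - p‖
              = ‖(y - p) + t • (EuclideanSpace.single 0 1 + v)‖ := by congr 1; abel
            _ ≤ ‖y - p‖ + ‖t • (EuclideanSpace.single 0 1 + v)‖ := norm_add_le _ _
            _ < r := by linarith [htρ.2]
        · exact exists_cone_of_mem_frontier hΩ.lipschitz ⟨hp, by rwa [hΩ.isOpen.interior_eq]⟩
      obtain ⟨ρ, hρ, e, he, h⟩ := hloc
      refine ⟨Metric.ball p (ρ / 2), mem_nhdsWithin_of_mem_nhds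
        (Metric.ball_mem_nhds p (by positivity)), ρ / 2, by positivity, fun x hx =>
          ⟨e, he, fun y hy hyx t ht htρ v hv => h y hy ?_ t ht (by linarith) v (by linarith)⟩⟩
      have := dist_triangle y x p
      rw [Metric.mem_ball] at hx
      linarith
  obtain ⟨ρ, hρ, h⟩ := key
  refine ⟨min 1 ρ, by positivity, min_le_left _ _, fun x hx => ?_⟩
  obtain ⟨e, he, h⟩ := h x hx
  refine ⟨e, he, fun y hy hyx t ht htρ v hv => ?_⟩
  have hyx' : dist y x < ρ := hyx.trans_le (min_le_right _ _)
  have hv' : ‖v‖ < ρ := hv.trans_le (min_le_right _ _)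
  -- Replacing `y` by `y' ∈ Ω` tilts the direction by `t⁻¹(y - y')`. The tolerance keeps the tilted
  -- `v` inside the aperture and `y'` near `x`.
  obtain ⟨y', hy'Ω, hy'⟩ := Metric.mem_closure_iff.1 hy
    (min (ρ - dist y x) (t * (ρ - ‖v‖))) (lt_min (by linarith) (mul_pos ht (by linarith)))
  rw [lt_min_iff] at hy'
  have := h y' hy'Ω (by linarith [dist_triangle y' y x, dist_comm y y']) t ht
    (htρ.trans (min_le_right _ _)) (v + t⁻¹ • (y - y')) ?_
  · convert this using 1
    rw [← add_assoc, smul_add t (e + v), smul_smul, mul_inv_cancel₀ ht.ne', one_smul]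
    abel
  · refine (norm_add_le _ _).trans_lt ?_
    rw [norm_smul, norm_inv, Real.norm_of_nonneg ht.le, ← dist_eq_norm]
    have : t⁻¹ * dist y y' < ρ - ‖v‖ := by
      rw [inv_mul_lt_iff₀ ht]; exact hy'.2
    linarith

/-! ### Arc length on the boundary and projections -/

theorem norm_perp (e : Plane) : ‖perp e‖ = ‖e‖ := by
  simp [perp, EuclideanSpace.norm_eq, Fin.sum_univ_two, add_comm]

theorem det2_perp {e : Plane} (he : ‖e‖ = 1) : det2 e (perp e) = 1 := by
  have := EuclideanSpace.norm_sq_eq e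
  rw [he, Fin.sum_univ_two] at this
  simp [det2, perp] at this ⊢
  linarith

theorem eq_inner_smul_add {e : Plane} (he : ‖e‖ = 1) (y : Plane) :
    y = inner ℝ e y • e + inner ℝ (perp e) y • perp e := by
  have := EuclideanSpace.norm_sq_eq e
  rw [he, Fin.sum_univ_two] at this
  simp at this
  ext i
  fin_cases i
  · simp [perp, PiLp.inner_apply, Fin.sum_univ_two]
    linear_combination (y 0) * this
  · simp [perp, PiLp.inner_apply, Fin.sum_univ_two]
    linear_combination (y 1) * this

/-- Neither of two nearby frontier points can lie in the cone issued from the other, since it would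
then belong to the open set `Ω`. So their separation along `e` is controlled by that along `perp e`:
the frontier is locally a Lipschitz graph over the `perp e` axis. -/
theorem UniformCone.dist_le_of_mem_frontier {Ω : Set Plane} {ρ : ℝ} (hρ : 0 < ρ) (hρ1 : ρ ≤ 1)
    (hΩ : IsOpen Ω) {x e : Plane} (he : ‖e‖ = 1)
    (hcone : ∀ y ∈ closure Ω, dist y x < ρ →
      ∀ t : ℝ, 0 < t → t ≤ ρ → ∀ v : Plane, ‖v‖ < ρ → y + t • (e + v) ∈ Ω)
    {y z : Plane} (hy : y ∈ frontier Ω) (hz : z ∈ frontier Ω) (hyx : dist y x < ρ / 2)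
    (hzx : dist z x < ρ / 2) :
    dist y z ≤ 2 / ρ * |inner ℝ (perp e) y - inner ℝ (perp e) z| := by
  have main : ∀ y z : Plane, y ∈ frontier Ω → z ∈ frontier Ω → dist y x < ρ / 2 →
      dist z x < ρ / 2 →
      ρ * (inner ℝ e z - inner ℝ e y) ≤ |inner ℝ (perp e) y - inner ℝ (perp e) z| := by
    intro y z hy hz hyx hzx
    by_contra! hlt
    set τ := inner ℝ e z - inner ℝ e y with hτ
    set σ := inner ℝ (perp e) z - inner ℝ (perp e) y with hσ
    have hστ : |σ| < ρ * τ := by rwa [hσ, abs_sub_comm]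
    have hτ0 : 0 < τ := by
      by_contra! h0
      nlinarith [abs_nonneg σ]
    have hzy : z = y + τ • (e + (σ / τ) • perp e) := by
      have h1 : z - y = τ • e + σ • perp e := by
        rw [eq_inner_smul_add he (z - y), inner_sub_right, inner_sub_right]
      rw [smul_add, smul_smul, mul_div_cancel₀ _ hτ0.ne', ← h1]
      abel
    have hτρ : τ ≤ ρ := by
      rw [hτ, ← inner_sub_right]
      refine (real_inner_le_norm _ _).trans ?_
      rw [he, one_mul, ← dist_eq_norm]
      linarith [dist_triangle z x y, dist_comm x y]
    have hzΩ : z ∈ Ω := by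
      rw [hzy]
      refine hcone y hy.1 (by linarith) τ hτ0 hτρ _ ?_
      rw [norm_smul, norm_perp, he, mul_one, Real.norm_eq_abs, abs_div, abs_of_pos hτ0,
        div_lt_iff₀ hτ0]
      exact hστ
    exact hz.2 (by rwa [hΩ.interior_eq])
  have h1 := main y z hy hz hyx hzx
  have h2 := main z y hz hy hzx hyx
  rw [abs_sub_comm] at h2
  set A := |inner ℝ (perp e) y - inner ℝ (perp e) z| with hA
  have h3 : ρ * |inner ℝ e y - inner ℝ e z| ≤ A := by
    rcases abs_cases (inner ℝ e y - inner ℝ e z) with h | h <;> rw [h.1] <;> linarith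
  have h4 : dist y z ≤ |inner ℝ e y - inner ℝ e z| + A := by
    rw [dist_eq_norm, eq_inner_smul_add he (y - z), inner_sub_right, inner_sub_right]
    refine (norm_add_le _ _).trans ?_
    rw [norm_smul, norm_smul, norm_perp, he, mul_one, mul_one, Real.norm_eq_abs,
      Real.norm_eq_abs]
  have hA0 : 0 ≤ A := abs_nonneg _
  rw [div_mul_eq_mul_div, le_div_iff₀ hρ]
  nlinarith

/-- An antilipschitz projection expands Hausdorff measure under preimages by at most its constant,
and one-dimensional Hausdorff measure on the line is Lebesgue measure. -/
theorem map_arc_le {S : Set Plane} {π : Plane → ℝ} (hπ : Measurable π)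
    {L : NNReal} (h : ∀ y ∈ S, ∀ z ∈ S, dist y z ≤ L * |π y - π z|) :
    (arc S).map π ≤ (L : ENNReal) • volume := by
  refine Measure.le_iff.2 fun A hA => ?_
  have hanti : AntilipschitzWith L fun y : S => π y := by
    refine AntilipschitzWith.of_le_mul_dist fun y z => ?_
    rw [Real.dist_eq]
    exact h y y.2 z z.2
  have h1 := hanti.hausdorffMeasure_preimage_le zero_le_one A
  rw [hausdorffMeasure_real, ENNReal.rpow_one] at h1
  rw [Measure.map_apply hπ hA, Measure.restrict_apply (hπ hA), Measure.smul_apply, smul_eq_mul]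
  refine le_trans (le_of_eq ?_) h1
  rw [← (isometry_subtype_coe (s := S)).hausdorffMeasure_image (Or.inl zero_le_one)]
  congr 1
  ext y
  simp [and_comm]

theorem UniformCone.map_arc_le {Ω : Set Plane} {ρ : ℝ} (hρ : 0 < ρ) (hρ1 : ρ ≤ 1)
    (hΩ : IsOpen Ω) {x e : Plane} (he : ‖e‖ = 1)
    (hcone : ∀ y ∈ closure Ω, dist y x < ρ →
      ∀ t : ℝ, 0 < t → t ≤ ρ → ∀ v : Plane, ‖v‖ < ρ → y + t • (e + v) ∈ Ω) :
    (arc (frontier Ω ∩ Metric.ball x (ρ / 2))).map (fun y => inner ℝ (perp e) y)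
      ≤ ENNReal.ofReal (2 / ρ) • volume := by
  refine RhombiSlits.map_arc_le (L := (2 / ρ).toNNReal)
    (by fun_prop) ?_
  rintro y ⟨hy, hyx⟩ z ⟨hz, hzx⟩
  rw [Real.coe_toNNReal _ (by positivity)]
  exact UniformCone.dist_le_of_mem_frontier hρ hρ1 hΩ he hcone hy hz hyx hzx

end RhombiSlits

namespace RhombiSlits

/-! ### Poincaré inequalities in `L¹` -/

theorem lintegral_comp_smul_add {G : Plane → ENNReal} (hG : Measurable G) {a : ℝ} (ha : 0 < a)
    (b : Plane) : ∫⁻ y, G (a • y + b) = ENNReal.ofReal ((a ^ 2)⁻¹) * ∫⁻ y, G y := by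
  have h1 : ∫⁻ y, G (a • y + b) = ∫⁻ y, G (y + b) ∂(Measure.map (a • ·) volume) := by
    rw [lintegral_map (f := fun y => G (y + b)) (hG.comp (measurable_add_const b))
      (measurable_const_smul a)]
  rw [h1, Measure.map_addHaar_smul _ ha.ne', lintegral_smul_measure, smul_eq_mul,
    lintegral_add_right_eq_self G b]
  simp

theorem lintegral_setLIntegral_comp_add_smul_le {G : Plane → ENNReal} (hG : Measurable G)
    (e : Plane) (S : Set Plane) (h : ℝ) :
    ∫⁻ y in S, ∫⁻ t in Set.Ioc 0 h, G (y + t • e) ≤ ENNReal.ofReal h * ∫⁻ y, G y := by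
  have hm : Measurable fun z : Plane × ℝ => G (z.1 + z.2 • e) := hG.comp (by fun_prop)
  rw [lintegral_lintegral_swap hm.aemeasurable]
  calc ∫⁻ t in Set.Ioc 0 h, ∫⁻ y in S, G (y + t • e)
      ≤ ∫⁻ t in Set.Ioc (0 : ℝ) h, ∫⁻ y, G y := by
        refine lintegral_mono fun t => (setLIntegral_le_lintegral _ _).trans ?_
        rw [lintegral_add_right_eq_self G]
    _ = ENNReal.ofReal h * ∫⁻ y, G y := by
        rw [lintegral_const, Measure.restrict_apply_univ, Real.volume_Ioc, sub_zero, mul_comm]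

variable {F : Type*} [NormedAddCommGroup F] [NormedSpace ℝ F] [CompleteSpace F]

/-- Going only half way from `y` to `y'` keeps the substitution `y ↦ (1 - t)y + ty'` harmless: its
Jacobian `(1 - t)²` is at least `1/4`. Convexity of the ball keeps the segment inside. -/
theorem lintegral_lintegral_midpoint_le {v : Plane → F} (hv : ContDiff ℝ 1 v) (z : Plane) {r : ℝ}
    (hr : 0 < r) :
    ∫⁻ y' in Metric.ball z r, ∫⁻ y in Metric.ball z r, ‖v (y + (1 / 2 : ℝ) • (y' - y)) - v y‖ₑ
      ≤ ENNReal.ofReal (4 * r) * volume (Metric.ball z r) *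
        ∫⁻ y in Metric.ball z r, ‖fderiv ℝ v y‖ₑ := by
  set B := Metric.ball z r with hB
  set G : Plane → ENNReal := B.indicator fun y => ‖fderiv ℝ v y‖ₑ with hG
  have hBm : MeasurableSet B := measurableSet_ball
  have hGm : Measurable G :=
    ((hv.continuous_fderiv (by norm_num)).enorm.measurable).indicator hBm
  have hGi : ∫⁻ y, G y = ∫⁻ y in B, ‖fderiv ℝ v y‖ₑ := lintegral_indicator hBm _
  have h1 : ∀ y' ∈ B, ∫⁻ y in B, ‖v (y + (1 / 2 : ℝ) • (y' - y)) - v y‖ₑ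
      ≤ ENNReal.ofReal (4 * r) * ∫⁻ y, G y := by
    intro y' hy'
    have hm : Measurable fun p : Plane × ℝ => G ((1 - p.2) • p.1 + p.2 • y') :=
      hGm.comp (by fun_prop)
    calc ∫⁻ y in B, ‖v (y + (1 / 2 : ℝ) • (y' - y)) - v y‖ₑ
        ≤ ∫⁻ y in B, ∫⁻ t in Set.Ioc (0 : ℝ) (1 / 2),
            G ((1 - t) • y + t • y') * ENNReal.ofReal (2 * r) := by
          refine setLIntegral_mono' hBm fun y hy => ?_
          refine (enorm_sub_le_lintegral_line hv y (y' - y) (by norm_num)).trans ?_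
          refine setLIntegral_mono' measurableSet_Ioc fun t ht => ?_
          have hpt : y + t • (y' - y) = (1 - t) • y + t • y' := by
            rw [smul_sub, sub_smul, one_smul]; abel
          have hmem : (1 - t) • y + t • y' ∈ B :=
            (convex_ball z r) hy hy' (by linarith [ht.2]) ht.1.le (by ring)
          rw [hpt, hG, Set.indicator_of_mem hmem]
          gcongr
          rw [← ofReal_norm, ← dist_eq_norm]
          refine ENNReal.ofReal_le_ofReal ?_
          rw [hB, Metric.mem_ball] at hy hy'
          linarith [dist_triangle_right y' y z]
      _ = ∫⁻ t in Set.Ioc (0 : ℝ) (1 / 2), ∫⁻ y in B,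
            G ((1 - t) • y + t • y') * ENNReal.ofReal (2 * r) :=
          lintegral_lintegral_swap (hm.mul_const _).aemeasurable
      _ ≤ ∫⁻ t in Set.Ioc (0 : ℝ) (1 / 2), (ENNReal.ofReal 4 * ∫⁻ y, G y) *
            ENNReal.ofReal (2 * r) := by
          refine setLIntegral_mono' measurableSet_Ioc fun t ht => ?_
          rw [lintegral_mul_const' _ _ ENNReal.ofReal_ne_top]
          gcongr
          refine (setLIntegral_le_lintegral _ _).trans ?_
          have h1t : (1 / 2 : ℝ) ≤ 1 - t := by linarith [ht.2]
          rw [lintegral_comp_smul_add hGm (by linarith)]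
          gcongr
          rw [inv_le_comm₀ (by positivity) (by norm_num)]
          nlinarith
      _ = ENNReal.ofReal (4 * r) * ∫⁻ y, G y := by
          rw [lintegral_const, Measure.restrict_apply_univ, Real.volume_Ioc]
          rw [mul_right_comm (ENNReal.ofReal 4), mul_right_comm (_ * _),
            ← ENNReal.ofReal_mul (by norm_num), ← ENNReal.ofReal_mul (by positivity)]
          congr 2; ring
  calc _ ≤ ∫⁻ _ in B, ENNReal.ofReal (4 * r) * ∫⁻ y, G y := setLIntegral_mono' hBm h1
    _ = _ := by
      rw [lintegral_const, Measure.restrict_apply_univ, hGi]; ring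

/-- The difference `v y - v y'` is split at the midpoint. The two halves are exchanged by swapping
`y` and `y'`, so the midpoint estimate is used twice, whence `8r = 2 · 4r`. -/
theorem lintegral_sub_average_ball_le {v : Plane → F} (hv : ContDiff ℝ 1 v) (z : Plane) {r : ℝ}
    (hr : 0 < r) :
    ∫⁻ y in Metric.ball z r, ‖v y - ⨍ y' in Metric.ball z r, v y'‖ₑ
      ≤ ENNReal.ofReal (8 * r) * ∫⁻ y in Metric.ball z r, ‖fderiv ℝ v y‖ₑ := by
  set B := Metric.ball z r with hB
  have hBm : MeasurableSet B := measurableSet_ball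
  have hB0 : volume B ≠ 0 := (Metric.measure_ball_pos volume z hr).ne'
  have hBt : volume B ≠ ⊤ := measure_ball_lt_top.ne
  have hint : IntegrableOn v B :=
    (hv.continuous.continuousOn.integrableOn_compact (isCompact_closedBall z r)).mono_set
      Metric.ball_subset_closedBall
  have hcont := hv.continuous
  have hav : ∀ y, ‖v y - ⨍ y' in B, v y'‖ₑ ≤ (volume B)⁻¹ * ∫⁻ y' in B, ‖v y - v y'‖ₑ := by
    intro y
    have h1 : v y - ⨍ y' in B, v y' = ⨍ y' in B, (v y - v y') := by
      have : IsFiniteMeasure (volume.restrict B) := ⟨by simpa using hBt.lt_top⟩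
      rw [setAverage_eq, setAverage_eq, integral_sub (integrable_const _) hint, smul_sub,
        setIntegral_const, smul_smul, inv_mul_cancel₀, one_smul]
      exact (ENNReal.toReal_pos hB0 hBt).ne'
    rw [h1, setAverage_eq, enorm_smul]
    gcongr
    · rw [measureReal_def, enorm_inv (ENNReal.toReal_pos hB0 hBt).ne', Real.enorm_eq_ofReal ENNReal.toReal_nonneg, ENNReal.ofReal_toReal hBt]
    · exact enorm_integral_le_lintegral_enorm _
  have hmid : Measurable fun p : Plane × Plane => ‖v (p.2 + (1 / 2 : ℝ) • (p.1 - p.2)) - v p.2‖ₑ :=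
    Continuous.measurable (by fun_prop)
  have hdbl : ∫⁻ y in B, ∫⁻ y' in B, ‖v y - v y'‖ₑ ≤
      2 * ∫⁻ y' in B, ∫⁻ y in B, ‖v (y + (1 / 2 : ℝ) • (y' - y)) - v y‖ₑ := by
    calc ∫⁻ y in B, ∫⁻ y' in B, ‖v y - v y'‖ₑ
        ≤ ∫⁻ y in B, ∫⁻ y' in B, (‖v (y' + (1 / 2 : ℝ) • (y - y')) - v y'‖ₑ +
            ‖v (y + (1 / 2 : ℝ) • (y' - y)) - v y‖ₑ) := by
          refine lintegral_mono fun y => lintegral_mono fun y' => ?_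
          have hm : y' + (1 / 2 : ℝ) • (y - y') = y + (1 / 2 : ℝ) • (y' - y) := by
            ext i; simp; ring
          rw [hm, show v y - v y' = (v (y + (1 / 2 : ℝ) • (y' - y)) - v y') -
            (v (y + (1 / 2 : ℝ) • (y' - y)) - v y) by abel]
          exact enorm_sub_le
      _ = (∫⁻ y in B, ∫⁻ y' in B, ‖v (y' + (1 / 2 : ℝ) • (y - y')) - v y'‖ₑ) +
            ∫⁻ y in B, ∫⁻ y' in B, ‖v (y + (1 / 2 : ℝ) • (y' - y)) - v y‖ₑ := by
          rw [← lintegral_add_left (Measurable.lintegral_prod_right' hmid)]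
          refine lintegral_congr fun y => ?_
          rw [lintegral_add_left]
          exact Continuous.measurable (by fun_prop)
      _ = _ := by
          rw [two_mul]
          congr 1
          exact lintegral_lintegral_swap
            (f := fun y y' => ‖v (y + (1 / 2 : ℝ) • (y' - y)) - v y‖ₑ)
            (Continuous.measurable (by fun_prop)).aemeasurable
  have hmeas : Measurable fun y => ∫⁻ y' in B, ‖v y - v y'‖ₑ :=
    Measurable.lintegral_prod_right' (f := fun p : Plane × Plane => ‖v p.1 - v p.2‖ₑ)
      (Continuous.measurable (by fun_prop))
  calc ∫⁻ y in B, ‖v y - ⨍ y' in B, v y'‖ₑ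
      ≤ ∫⁻ y in B, (volume B)⁻¹ * ∫⁻ y' in B, ‖v y - v y'‖ₑ := lintegral_mono hav
    _ = (volume B)⁻¹ * ∫⁻ y in B, ∫⁻ y' in B, ‖v y - v y'‖ₑ := lintegral_const_mul _ hmeas
    _ ≤ (volume B)⁻¹ * (2 * (ENNReal.ofReal (4 * r) * volume B *
          ∫⁻ y in B, ‖fderiv ℝ v y‖ₑ)) := by
        gcongr
        exact hdbl.trans (by gcongr; exact lintegral_lintegral_midpoint_le hv z hr)
    _ = ((volume B)⁻¹ * volume B) * (2 * ENNReal.ofReal (4 * r) *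
          ∫⁻ y in B, ‖fderiv ℝ v y‖ₑ) := by ring
    _ = _ := by
        rw [ENNReal.inv_mul_cancel hB0 hBt, one_mul]
        congr 1
        rw [show (2 : ENNReal) = ENNReal.ofReal 2 by simp, ← ENNReal.ofReal_mul (by norm_num)]
        congr 1; ring

/-- `L¹` Poincaré inequality on small balls centred in the closure of `Ω`, with the mean value
over a ball contained in `Ω`. -/
theorem lintegral_sub_average_le_of_cone {Ω : Set Plane} {ρ : ℝ} (hρ : 0 < ρ) (hρ1 : ρ ≤ 1)
    (hΩ : IsOpen Ω) {x e : Plane} (hx : x ∈ closure Ω) (he : ‖e‖ = 1)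
    (hcone : ∀ y ∈ closure Ω, dist y x < ρ →
      ∀ t : ℝ, 0 < t → t ≤ ρ → ∀ v : Plane, ‖v‖ < ρ → y + t • (e + v) ∈ Ω)
    {r : ℝ} (hr : 0 < r) (hrρ : r ≤ ρ ^ 2 / 2) :
    Metric.ball (x + (2 * r / ρ) • e) r ⊆ Ω ∩ Metric.ball x ((1 + 2 / ρ) * r) ∧
    ∀ v : Plane → F, ContDiff ℝ 1 v →
      ∫⁻ y in Ω ∩ Metric.ball x r, ‖v y - ⨍ y' in Metric.ball (x + (2 * r / ρ) • e) r, v y'‖ₑ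
        ≤ ENNReal.ofReal ((8 + 2 / ρ) * r) *
          ∫⁻ y in Ω ∩ Metric.ball x ((1 + 2 / ρ) * r), ‖fderiv ℝ v y‖ₑ := by
  -- The shift satisfies `h ρ = 2r > r`, so the ball of radius `r` about `x + h e` lies in the cone
  -- at `x`; the bound on `r` ensures `h ≤ ρ`.
  set h : ℝ := 2 * r / ρ with hh
  have hh0 : 0 < h := by positivity
  have hhρ : h ≤ ρ := by rw [hh, div_le_iff₀ hρ]; nlinarith
  have hK : (1 + 2 / ρ) * r = r + h := by rw [hh]; ring
  rw [hK]
  set z := x + h • e with hz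
  have hsub : Metric.ball z r ⊆ Ω ∩ Metric.ball x (r + h) := by
    intro y hy
    rw [Metric.mem_ball, dist_eq_norm] at hy
    constructor
    · have := hcone x hx (by simpa using hρ) h hh0 hhρ (h⁻¹ • (y - z)) ?_
      · rw [smul_add, smul_smul, mul_inv_cancel₀ hh0.ne', one_smul] at this
        convert this using 1
        rw [hz]; abel
      · rw [norm_smul, norm_inv, Real.norm_of_nonneg hh0.le, inv_mul_lt_iff₀ hh0]
        have : h * ρ = 2 * r := by rw [hh]; field_simp
        linarith
    · rw [Metric.mem_ball, dist_eq_norm]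
      calc ‖y - x‖ = ‖(y - z) + h • e‖ := by rw [hz]; congr 1; abel
        _ ≤ ‖y - z‖ + ‖h • e‖ := norm_add_le _ _
        _ < r + h := by rw [norm_smul, he, mul_one, Real.norm_of_nonneg hh0.le]; linarith
  refine ⟨hsub, fun v hv => ?_⟩
  set c := ⨍ y' in Metric.ball z r, v y' with hc
  set U := Ω ∩ Metric.ball x (r + h) with hU
  have hUm : MeasurableSet U := hΩ.measurableSet.inter measurableSet_ball
  have hSm : MeasurableSet (Ω ∩ Metric.ball x r) := hΩ.measurableSet.inter measurableSet_ball
  set G : Plane → ENNReal := U.indicator fun y => ‖fderiv ℝ v y‖ₑ with hG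
  have hGm : Measurable G :=
    ((hv.continuous_fderiv (by norm_num)).enorm.measurable).indicator hUm
  have hGi : ∫⁻ y, G y = ∫⁻ y in U, ‖fderiv ℝ v y‖ₑ := lintegral_indicator hUm _
  have hcont := hv.continuous
  -- A point near `x` is compared with its translate by `h e` along the cone direction. The
  -- translate lies in the inner ball, where the inequality on balls applies.
  have hs : ∫⁻ y in Ω ∩ Metric.ball x r, ‖v (y + h • e) - v y‖ₑ
      ≤ ENNReal.ofReal h * ∫⁻ y, G y := by
    refine le_trans ?_ (lintegral_setLIntegral_comp_add_smul_le hGm e (Ω ∩ Metric.ball x r) h)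
    refine setLIntegral_mono' hSm fun y hy => ?_
    refine (enorm_sub_le_lintegral_line hv y e hh0.le).trans ?_
    refine setLIntegral_mono' measurableSet_Ioc fun t ht => ?_
    have hyr := hy.2
    rw [Metric.mem_ball] at hyr
    have hmem : y + t • e ∈ U := by
      constructor
      · have := hcone y (subset_closure hy.1) (by nlinarith) t ht.1 (ht.2.trans hhρ) 0
          (by simpa using hρ)
        simpa using this
      · rw [Metric.mem_ball, dist_eq_norm]
        calc ‖y + t • e - x‖ = ‖(y - x) + t • e‖ := by congr 1; abel
          _ ≤ ‖y - x‖ + ‖t • e‖ := norm_add_le _ _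
          _ < r + h := by
            rw [norm_smul, he, mul_one, Real.norm_of_nonneg ht.1.le, ← dist_eq_norm]
            linarith [ht.2]
    rw [hG, Set.indicator_of_mem hmem, ← ofReal_norm e, he]
    simp
  have hb : ∫⁻ y in Ω ∩ Metric.ball x r, ‖v (y + h • e) - c‖ₑ
      ≤ ∫⁻ y in Metric.ball z r, ‖v y - c‖ₑ := by
    rw [← lintegral_indicator hSm, ← lintegral_indicator measurableSet_ball,
      ← lintegral_add_right_eq_self ((Metric.ball z r).indicator _) (h • e)]
    refine lintegral_mono fun y => ?_
    by_cases hy : y ∈ Ω ∩ Metric.ball x r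
    · rw [Set.indicator_of_mem hy, Set.indicator_of_mem]
      rw [Metric.mem_ball, hz, dist_add_right]
      exact hy.2
    · rw [Set.indicator_of_notMem hy]; exact zero_le
  calc ∫⁻ y in Ω ∩ Metric.ball x r, ‖v y - c‖ₑ
      ≤ ∫⁻ y in Ω ∩ Metric.ball x r, (‖v (y + h • e) - v y‖ₑ + ‖v (y + h • e) - c‖ₑ) := by
        refine lintegral_mono fun y => ?_
        rw [show v y - c = (v (y + h • e) - c) - (v (y + h • e) - v y) by abel]
        exact enorm_sub_le.trans (add_comm _ _).le
    _ = (∫⁻ y in Ω ∩ Metric.ball x r, ‖v (y + h • e) - v y‖ₑ) +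
          ∫⁻ y in Ω ∩ Metric.ball x r, ‖v (y + h • e) - c‖ₑ :=
        lintegral_add_left (Continuous.measurable (by fun_prop)) _
    _ ≤ ENNReal.ofReal h * (∫⁻ y in U, ‖fderiv ℝ v y‖ₑ) +
          ENNReal.ofReal (8 * r) * ∫⁻ y in U, ‖fderiv ℝ v y‖ₑ := by
        gcongr
        · exact hs.trans_eq (by rw [hGi])
        · refine hb.trans ((lintegral_sub_average_ball_le hv z hr).trans ?_)
          gcongr
    _ = _ := by
        rw [← add_mul, ← ENNReal.ofReal_add hh0.le (by positivity)]
        congr 2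
        rw [hh]; ring

/-- Sobolev and trace inequalities on small balls centred in the closure of `Ω`. -/
theorem exists_local_sobolev {Ω : Set Plane} {ρ : ℝ} (hρ : 0 < ρ) (hρ1 : ρ ≤ 1)
    (hΩ : IsOpen Ω) (hU : UniformCone Ω ρ) (F : Type*) [NormedAddCommGroup F] [NormedSpace ℝ F]
    [CompleteSpace F] :
    ∃ K C : ℝ, 1 ≤ K ∧ 0 < C ∧ ∀ x ∈ closure Ω, ∀ r : ℝ, 0 < r → r ≤ ρ ^ 2 / 6 →
      ∃ z : Plane, Metric.ball z r ⊆ Ω ∩ Metric.ball x (K * r) ∧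
        ∀ v : Plane → F, ContDiff ℝ 1 v → ∃ c : F,
          ‖c‖ₑ ≤ (volume (Metric.ball x r))⁻¹ * (∫⁻ y in Ω ∩ Metric.ball x (K * r), ‖v y‖ₑ) ∧
          ∫⁻ y in Ω ∩ Metric.ball x r, ‖v y - c‖ₑ ^ 2
            ≤ ENNReal.ofReal C * (∫⁻ y in Ω ∩ Metric.ball x (K * r), ‖fderiv ℝ v y‖ₑ) ^ 2 ∧
          ∫⁻ y in frontier Ω ∩ Metric.ball x r, ‖v y - c‖ₑ ∂(Measure.hausdorffMeasure 1)
            ≤ ENNReal.ofReal C * ∫⁻ y in Ω ∩ Metric.ball x (K * r), ‖fderiv ℝ v y‖ₑ := by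
  set C₁ : ℝ := (8 + 2 / ρ) * 3 + 2 with hC₁
  have hC₁0 : 0 < C₁ := by positivity
  refine ⟨(1 + 2 / ρ) * 3, 2 / ρ * C₁ ^ 2 + 2 / ρ * C₁, ?_, by positivity, ?_⟩
  · have : 0 < 2 / ρ := by positivity
    linarith
  intro x hx r hr hrρ
  obtain ⟨e, he, hcone⟩ := hU x hx
  have hrρ' : r < ρ / 2 := by nlinarith
  -- Radius `3r`: segments `t • a` with `t ≤ r` and `‖a‖ ≤ 2`, issued from the ball of radius `r`,
  -- stay in the ball of radius `3r`.
  obtain ⟨hsub, hL1⟩ := lintegral_sub_average_le_of_cone (F := F) hρ hρ1 hΩ hx he hcone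
    (r := 3 * r) (by positivity) (by linarith)
  rw [← mul_assoc (1 + 2 / ρ)] at hsub hL1
  set K := (1 + 2 / ρ) * 3 with hK
  set z := x + (2 * (3 * r) / ρ) • e with hz
  refine ⟨z, (Metric.ball_subset_ball (by linarith)).trans hsub, fun v hv => ?_⟩
  set c := ⨍ y' in Metric.ball z (3 * r), v y' with hc
  have h3K : (3 : ℝ) ≤ K := by
    have : 0 < 2 / ρ := by positivity
    linarith
  set U := Ω ∩ Metric.ball x (3 * r) with hUdef
  have hUm : MeasurableSet U := hΩ.measurableSet.inter measurableSet_ball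
  have hUK : U ⊆ Ω ∩ Metric.ball x (K * r) :=
    Set.inter_subset_inter_right _ (Metric.ball_subset_ball (by nlinarith))
  set I := ∫⁻ y in Ω ∩ Metric.ball x (K * r), ‖fderiv ℝ v y‖ₑ with hI
  -- Averaging `v y - c = (v(y + ta) - c) - (v(y + ta) - v y)` over `t ∈ (0, r]` bounds `‖v y - c‖`
  -- by a line integral of `H`; the factor `2` accounts for `‖a‖ ≤ 2`. The weight `r⁻¹` is
  -- compensated by the factor `r` of the `L¹` Poincaré inequality, so `∫ H` is bounded by the
  -- gradient integral uniformly in `r`.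
  set H : Plane → ENNReal := U.indicator fun y =>
    ENNReal.ofReal r⁻¹ * ‖v y - c‖ₑ + 2 * ‖fderiv ℝ v y‖ₑ with hH
  have hcont := hv.continuous
  have hcont' := hv.continuous_fderiv (by norm_num)
  have hm1 : Measurable fun y => ‖v y - c‖ₑ := Continuous.measurable (by fun_prop)
  have hm2 : Measurable fun y => ‖fderiv ℝ v y‖ₑ := hcont'.enorm.measurable
  have hHm : Measurable H := ((hm1.const_mul _).add (hm2.const_mul _)).indicator hUm
  have hHI : ∫⁻ y, H y ≤ ENNReal.ofReal C₁ * I := by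
    rw [hH, lintegral_indicator hUm, lintegral_add_left (hm1.const_mul _),
      lintegral_const_mul _ hm1, lintegral_const_mul _ hm2]
    calc ENNReal.ofReal r⁻¹ * (∫⁻ y in U, ‖v y - c‖ₑ) + 2 * ∫⁻ y in U, ‖fderiv ℝ v y‖ₑ
        ≤ ENNReal.ofReal r⁻¹ * (ENNReal.ofReal ((8 + 2 / ρ) * (3 * r)) * I) + 2 * I := by
          gcongr
          · exact hL1 v hv
          · exact lintegral_mono_set hUK
      _ = ENNReal.ofReal C₁ * I := by
          rw [← mul_assoc, ← ENNReal.ofReal_mul (by positivity),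
            show (2 : ENNReal) = ENNReal.ofReal 2 by simp, ← add_mul,
            ← ENNReal.ofReal_add (by positivity) (by norm_num)]
          congr 2
          rw [hC₁]; field_simp
  have hray : ∀ a : Plane, ‖a‖ ≤ 2 → (∃ w : Plane, ‖w‖ < ρ ∧ a = e + w) →
      ∀ y ∈ closure Ω ∩ Metric.ball x r, ‖v y - c‖ₑ ≤ ∫⁻ t : ℝ, H (y + t • a) := by
    rintro a ha ⟨w, hw, rfl⟩ y ⟨hyΩ, hyx⟩
    rw [Metric.mem_ball] at hyx
    have hmem : ∀ t ∈ Set.Ioc (0 : ℝ) r, y + t • (e + w) ∈ U := by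
      intro t ht
      refine ⟨hcone y hyΩ (by linarith) t ht.1 (by linarith [ht.2]) w hw, ?_⟩
      rw [Metric.mem_ball, dist_eq_norm]
      calc ‖y + t • (e + w) - x‖ = ‖(y - x) + t • (e + w)‖ := by congr 1; abel
        _ ≤ ‖y - x‖ + ‖t • (e + w)‖ := norm_add_le _ _
        _ < 3 * r := by
          rw [norm_smul, Real.norm_of_nonneg ht.1.le, ← dist_eq_norm]
          nlinarith [ht.1, ht.2, norm_nonneg (e + w)]
    have hHe : ∀ t ∈ Set.Ioc (0 : ℝ) r, H (y + t • (e + w)) =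
        ENNReal.ofReal r⁻¹ * ‖v (y + t • (e + w)) - c‖ₑ + 2 * ‖fderiv ℝ v (y + t • (e + w))‖ₑ :=
      fun t ht => by rw [hH, Set.indicator_of_mem (hmem t ht)]
    have hptw : ∀ t ∈ Set.Ioc (0 : ℝ) r, ‖v y - c‖ₑ ≤ ‖v (y + t • (e + w)) - c‖ₑ +
        ∫⁻ τ in Set.Ioc 0 r, 2 * ‖fderiv ℝ v (y + τ • (e + w))‖ₑ := by
      intro t ht
      rw [show v y - c = (v (y + t • (e + w)) - c) - (v (y + t • (e + w)) - v y) by abel]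
      refine enorm_sub_le.trans ?_
      gcongr
      refine (enorm_sub_le_lintegral_line hv y (e + w) ht.1.le).trans ?_
      refine (lintegral_mono_set (Set.Ioc_subset_Ioc_right ht.2)).trans ?_
      refine lintegral_mono fun τ => ?_
      rw [mul_comm]
      gcongr
      rw [← ofReal_norm]
      exact (ENNReal.ofReal_le_ofReal ha).trans_eq (by simp)
    have hmt : Measurable fun t : ℝ => ‖v (y + t • (e + w)) - c‖ₑ :=
      Continuous.measurable (by fun_prop)
    have hr0 : ENNReal.ofReal r⁻¹ * ENNReal.ofReal r = 1 := by
      rw [← ENNReal.ofReal_mul (by positivity), inv_mul_cancel₀ hr.ne', ENNReal.ofReal_one]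
    calc ‖v y - c‖ₑ = ENNReal.ofReal r⁻¹ * ∫⁻ _ in Set.Ioc (0 : ℝ) r, ‖v y - c‖ₑ := by
          rw [lintegral_const, Measure.restrict_apply_univ, Real.volume_Ioc, sub_zero,
            mul_left_comm, hr0, mul_one]
      _ ≤ ENNReal.ofReal r⁻¹ * ∫⁻ t in Set.Ioc (0 : ℝ) r, (‖v (y + t • (e + w)) - c‖ₑ +
            ∫⁻ τ in Set.Ioc 0 r, 2 * ‖fderiv ℝ v (y + τ • (e + w))‖ₑ) := by
          gcongr 1
          exact setLIntegral_mono' measurableSet_Ioc hptw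
      _ = (∫⁻ t in Set.Ioc (0 : ℝ) r, ENNReal.ofReal r⁻¹ * ‖v (y + t • (e + w)) - c‖ₑ) +
            ∫⁻ τ in Set.Ioc 0 r, 2 * ‖fderiv ℝ v (y + τ • (e + w))‖ₑ := by
          rw [lintegral_add_left hmt, lintegral_const, Measure.restrict_apply_univ,
            Real.volume_Ioc, sub_zero, mul_add, lintegral_const_mul _ hmt, mul_left_comm, hr0,
            mul_one]
      _ = ∫⁻ t in Set.Ioc (0 : ℝ) r, H (y + t • (e + w)) := by
          rw [← lintegral_add_left (hmt.const_mul _)]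
          exact setLIntegral_congr_fun measurableSet_Ioc fun t ht => (hHe t ht).symm
      _ ≤ ∫⁻ t : ℝ, H (y + t • (e + w)) := setLIntegral_le_lintegral _ _
  have hra : ∀ y ∈ closure Ω ∩ Metric.ball x r, ‖v y - c‖ₑ ≤ ∫⁻ t : ℝ, H (y + t • e) :=
    hray e (by rw [he]; norm_num) ⟨0, by simpa using hρ, by simp⟩
  -- The second direction is `e` tilted by `ρ/2`: still inside the aperture, and independent of `e`
  -- with determinant `ρ/2`, uniformly in `x`.
  have hnw : ‖(ρ / 2) • perp e‖ = ρ / 2 := by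
    rw [norm_smul, norm_perp, he, mul_one, Real.norm_of_nonneg (by positivity)]
  have hrb : ∀ y ∈ closure Ω ∩ Metric.ball x r,
      ‖v y - c‖ₑ ≤ ∫⁻ t : ℝ, H (y + t • (e + (ρ / 2) • perp e)) := by
    refine hray _ ((norm_add_le _ _).trans ?_) ⟨_, ?_, rfl⟩
    · rw [hnw, he]; linarith
    · rw [hnw]; linarith
  have hdet : det2 e (e + (ρ / 2) • perp e) = ρ / 2 := by
    have := det2_perp he
    simp only [det2, PiLp.add_apply, PiLp.smul_apply, smul_eq_mul] at this ⊢
    linear_combination (ρ / 2) * this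
  refine ⟨c, ?_, ?_, ?_⟩
  · rw [hc, setAverage_eq, enorm_smul]
    have hBt : volume (Metric.ball z (3 * r)) ≠ ⊤ := measure_ball_lt_top.ne
    have hB0 : volume (Metric.ball z (3 * r)) ≠ 0 :=
      (Metric.measure_ball_pos volume z (by positivity)).ne'
    gcongr
    · rw [measureReal_def, enorm_inv (ENNReal.toReal_pos hB0 hBt).ne',
        Real.enorm_eq_ofReal ENNReal.toReal_nonneg, ENNReal.ofReal_toReal hBt, ENNReal.inv_le_inv,
        Measure.addHaar_ball_center volume x, Measure.addHaar_ball_center volume z]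
      exact measure_mono (Metric.ball_subset_ball (by linarith))
    · exact (enorm_integral_le_lintegral_enorm _).trans (lintegral_mono_set hsub)
  · have := lintegral_sq_le_of_lines (f := fun y => ‖v y - c‖ₑ) hHm e (e + (ρ / 2) • perp e)
      (by rw [hdet]; positivity) (Ω ∩ Metric.ball x r)
      (hΩ.measurableSet.inter measurableSet_ball)
      (fun y hy => hra y ⟨subset_closure hy.1, hy.2⟩)
      (fun y hy => hrb y ⟨subset_closure hy.1, hy.2⟩)
    refine this.trans ?_
    rw [hdet, abs_of_pos (by positivity), ← ENNReal.ofReal_inv_of_pos (by positivity), inv_div]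
    calc ENNReal.ofReal (2 / ρ) * (∫⁻ y, H y) ^ 2
        ≤ ENNReal.ofReal (2 / ρ) * (ENNReal.ofReal C₁ * I) ^ 2 := by gcongr
      _ = ENNReal.ofReal (2 / ρ * C₁ ^ 2) * I ^ 2 := by
          rw [mul_pow, ← mul_assoc, ← ENNReal.ofReal_pow hC₁0.le,
            ← ENNReal.ofReal_mul (by positivity)]
      _ ≤ _ := by
          gcongr
          exact le_add_of_nonneg_right (by positivity)
  -- On the boundary the single direction `e` suffices: the ray integral depends only on the `perp
  -- e` coordinate, and arc length projected onto that coordinate has density at most `2/ρ`.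
  · set p : ℝ → ENNReal := fun s => ∫⁻ t : ℝ, H (s • perp e + t • e) with hp
    have hpm : Measurable p :=
      Measurable.lintegral_prod_right' (f := fun z : ℝ × ℝ => H (z.1 • perp e + z.2 • e))
        (hHm.comp (by fun_prop))
    have hpy : ∀ y : Plane, ∫⁻ t : ℝ, H (y + t • e) = p (inner ℝ (perp e) y) := by
      intro y
      rw [hp]
      nth_rewrite 1 [eq_inner_smul_add he y]
      rw [add_comm (inner ℝ e y • e)]
      exact lintegral_line_const' (perp e) e _ _
    have hπ : Measurable fun y : Plane => inner ℝ (perp e) y := by fun_prop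
    have hSm : MeasurableSet (frontier Ω ∩ Metric.ball x r) :=
      isClosed_frontier.measurableSet.inter measurableSet_ball
    calc ∫⁻ y in frontier Ω ∩ Metric.ball x r, ‖v y - c‖ₑ ∂(Measure.hausdorffMeasure 1)
        ≤ ∫⁻ y in frontier Ω ∩ Metric.ball x r, p (inner ℝ (perp e) y)
            ∂(Measure.hausdorffMeasure 1) := by
          refine setLIntegral_mono' hSm fun y hy => ?_
          rw [← hpy]
          exact hra y ⟨frontier_subset_closure hy.1, hy.2⟩
      _ ≤ ∫⁻ y in frontier Ω ∩ Metric.ball x (ρ / 2), p (inner ℝ (perp e) y)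
            ∂(Measure.hausdorffMeasure 1) :=
          lintegral_mono_set (Set.inter_subset_inter_right _ (Metric.ball_subset_ball hrρ'.le))
      _ = ∫⁻ s, p s ∂((arc (frontier Ω ∩ Metric.ball x (ρ / 2))).map
            fun y => inner ℝ (perp e) y) := (lintegral_map hpm hπ).symm
      _ ≤ ∫⁻ s, p s ∂(ENNReal.ofReal (2 / ρ) • volume) :=
          lintegral_mono' (UniformCone.map_arc_le hρ hρ1 hΩ he hcone) le_rfl
      _ = ENNReal.ofReal (2 / ρ) * ∫⁻ y, H y := by
          rw [lintegral_smul_measure, smul_eq_mul, lintegral_oblique hHm (perp e) e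
            (by rw [det2_swap, det2_perp he]; norm_num), det2_swap, det2_perp he]
          simp [hp]
      _ ≤ ENNReal.ofReal (2 / ρ) * (ENNReal.ofReal C₁ * I) := by gcongr
      _ = ENNReal.ofReal (2 / ρ * C₁) * I := by
          rw [← mul_assoc, ← ENNReal.ofReal_mul (by positivity)]
      _ ≤ _ := by
          gcongr
          exact le_add_of_nonneg_left (by positivity)

end RhombiSlits

namespace RhombiSlits

/-! ### Higher integrability from a reverse Hölder inequality -/

theorem volume_closedBall_mul (x : Plane) {k : ℝ} (hk : 0 ≤ k) (r : ℝ) :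
    volume (Metric.closedBall x (k * r))
      = ENNReal.ofReal (k ^ 2) * volume (Metric.closedBall x r) := by
  rw [EuclideanSpace.volume_closedBall, EuclideanSpace.volume_closedBall,
    ENNReal.ofReal_mul hk, mul_pow, ENNReal.ofReal_pow hk, mul_assoc]
  rfl

/-- By Lebesgue differentiation, at almost every point with `g > L` small balls have mean square
above `L²`, while balls of radius at least `r₀` do not. A radius exceeding half the supremum of the
good radii is good, and its double and all larger radii are not. -/
theorem ae_exists_stopping_radius {g : Plane → ENNReal} (hg : Measurable g)
    (hg2 : ∫⁻ x, g x ^ 2 ≠ ⊤) {L : ENNReal} {r₀ : ℝ}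
    (hbig : ∀ x r, r₀ ≤ r → ∫⁻ y in Metric.closedBall x r, g y ^ 2 <
      L ^ 2 * volume (Metric.closedBall x r)) :
    ∀ᵐ x, L < g x → ∃ r, 0 < r ∧ r < r₀ ∧
      L ^ 2 * volume (Metric.closedBall x r) ≤ ∫⁻ y in Metric.closedBall x r, g y ^ 2 ∧
      ∀ r', 2 * r ≤ r' → ∫⁻ y in Metric.closedBall x r', g y ^ 2 ≤
        L ^ 2 * volume (Metric.closedBall x r') := by
  have hd := VitaliFamily.ae_tendsto_lintegral_div (Besicovitch.vitaliFamily (volume : Measure Plane))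
    (hg.pow_const 2).aemeasurable hg2
  filter_upwards [hd] with x hx hLx
  have hx' := hx.comp (Besicovitch.tendsto_filterAt (volume : Measure Plane) x)
  have hlt : L ^ 2 < g x ^ 2 := ENNReal.pow_lt_pow_left (by norm_num) hLx
  have hev := (hx'.eventually (lt_mem_nhds hlt)).and self_mem_nhdsWithin
  obtain ⟨r₁, hr₁, hr₁0⟩ := hev.exists
  change 0 < r₁ at hr₁0
  have hvol : ∀ r : ℝ, 0 < r → volume (Metric.closedBall x r) ≠ 0 := fun r hr =>
    (Metric.measure_closedBall_pos volume x hr).ne'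
  have hvolt : ∀ r : ℝ, volume (Metric.closedBall x r) ≠ ⊤ := fun r =>
    measure_closedBall_lt_top.ne
  set S : Set ℝ := {r | 0 < r ∧
    L ^ 2 * volume (Metric.closedBall x r) ≤ ∫⁻ y in Metric.closedBall x r, g y ^ 2} with hS
  have hr₁S : r₁ ∈ S := by
    refine ⟨hr₁0, ?_⟩
    exact (ENNReal.le_div_iff_mul_le (Or.inl (hvol _ hr₁0)) (Or.inl (hvolt _))).1 hr₁.le
  have hSr₀ : ∀ r ∈ S, r < r₀ := by
    intro r hr
    by_contra! h
    exact absurd (hbig x r h) (not_lt.2 hr.2)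
  have hbdd : BddAbove S := ⟨r₀, fun r hr => (hSr₀ r hr).le⟩
  have hsup : 0 < sSup S := hr₁0.trans_le (le_csSup hbdd hr₁S)
  obtain ⟨r, hrS, hr⟩ := exists_lt_of_lt_csSup ⟨r₁, hr₁S⟩ (half_lt_self hsup)
  refine ⟨r, hrS.1, hSr₀ r hrS, hrS.2, fun r' hr' => ?_⟩
  by_contra! h
  have : r' ∈ S := ⟨by linarith [hrS.1], h.le⟩
  linarith [le_csSup hbdd this]

/-- The real arithmetic of the absorption. The constant `c` is chosen so that the parts of `X` and
`Y` below the level `cL` contribute at most `6Ack⁴ · L²m = L²m/2`. -/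
theorem stopping_ball_arith {A k c L m X Y a b : ℝ} (hA : 1 ≤ A) (hk : 1 ≤ k)
    (hc : c = 1 / (12 * A * k ^ 4)) (hL : 0 < L) (hm : 0 < m) (hX0 : 0 ≤ X)
    (hX : X ≤ c * L * (k ^ 2 * m) + a) (hX' : X ≤ 5 * k ^ 2 * L * m)
    (hY : Y ≤ (c * L) ^ 2 * (k ^ 2 * m) + b) (h : L ^ 2 * m ≤ A * (m⁻¹ * X ^ 2 + Y)) :
    L ^ 2 * m ≤ 2 * A * (5 * k ^ 2 * L * a + b) := by
  have hk4 : 1 ≤ k ^ 4 := one_le_pow₀ hk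
  have hk24 : k ^ 2 ≤ k ^ 4 := pow_le_pow_right₀ hk (by norm_num)
  have hcA : c * (12 * A * k ^ 4) = 1 := by rw [hc]; field_simp
  have hc0 : 0 < c := by rw [hc]; positivity
  have hc1 : c ≤ 1 := by
    rw [hc, div_le_one (by positivity)]; nlinarith
  have h1 : m⁻¹ * X ^ 2 ≤ 5 * k ^ 2 * L * X := by
    rw [inv_mul_le_iff₀ hm, sq]
    nlinarith
  have h2 : 5 * k ^ 2 * L * X ≤ 5 * k ^ 2 * L * (c * L * (k ^ 2 * m) + a) := by gcongr
  have hc2 : c ^ 2 ≤ c := by nlinarith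
  have h3 : (c * L) ^ 2 * (k ^ 2 * m) ≤ c * L ^ 2 * (k ^ 4 * m) := by
    rw [mul_pow]; gcongr
  have h4 : L ^ 2 * m ≤ A * (5 * k ^ 2 * L * (c * L * (k ^ 2 * m) + a) +
      (c * L ^ 2 * (k ^ 4 * m) + b)) := by
    refine h.trans (mul_le_mul_of_nonneg_left ?_ (by linarith))
    linarith
  have h5 : A * (5 * k ^ 2 * L * (c * L * (k ^ 2 * m) + a) + (c * L ^ 2 * (k ^ 4 * m) + b))
      = (c * (12 * A * k ^ 4)) * (L ^ 2 * m) / 2 + A * (5 * k ^ 2 * L * a + b) := by ring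
  rw [h5, hcA] at h4
  linarith

theorem setLIntegral_le_add_superlevel {f : Plane → ENNReal} {S : Set Plane}
    (c : ENNReal) :
    ∫⁻ x in S, f x ≤ c * volume S + ∫⁻ x in S, {x | c < f x}.indicator f x := by
  calc ∫⁻ x in S, f x ≤ ∫⁻ x in S, (c + {x | c < f x}.indicator f x) := by
        refine lintegral_mono fun x => ?_
        by_cases h : c < f x
        · rw [Set.indicator_of_mem (show x ∈ {x | c < f x} from h)]
          exact le_add_self
        · exact (not_lt.1 h).trans le_self_add
    _ = _ := by
        rw [lintegral_add_left measurable_const, lintegral_const, Measure.restrict_apply_univ]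

/-- On a stopping ball the reverse Hölder inequality bounds `L²` times the area by integrals of `g`
and `h²`; their parts below the level `cL` are absorbed, which leaves superlevel sets only. -/
theorem stopping_ball_bound {A k c L : ℝ} (hA : 1 ≤ A) (hk : 1 ≤ k)
    (hc : c = 1 / (12 * A * k ^ 4)) (hL : 0 < L) {g h : Plane → ENNReal} (hg : Measurable g)
    {x : Plane} {r : ℝ} (hr : 0 < r)
    (hRH : ∫⁻ y in Metric.closedBall x r, g y ^ 2 ≤ ENNReal.ofReal A *
      ((volume (Metric.closedBall x r))⁻¹ * (∫⁻ y in Metric.closedBall x (k * r), g y) ^ 2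
        + ∫⁻ y in Metric.closedBall x (k * r), h y ^ 2))
    (h1 : ENNReal.ofReal L ^ 2 * volume (Metric.closedBall x r)
      ≤ ∫⁻ y in Metric.closedBall x r, g y ^ 2)
    (h2 : ∫⁻ y in Metric.closedBall x (k * (5 * r)), g y ^ 2
      ≤ ENNReal.ofReal L ^ 2 * volume (Metric.closedBall x (k * (5 * r)))) :
    ENNReal.ofReal L ^ 2 * volume (Metric.closedBall x r) ≤ ENNReal.ofReal (2 * A) *
      (ENNReal.ofReal (5 * k ^ 2 * L) * (∫⁻ y in Metric.closedBall x (k * r),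
          {y | ENNReal.ofReal (c * L) < g y}.indicator g y)
        + ∫⁻ y in Metric.closedBall x (k * r),
          {y | ENNReal.ofReal (c * L) < h y}.indicator (fun y => h y ^ 2) y) := by
  have hc0 : 0 < c := by rw [hc]; positivity
  set m := volume (Metric.closedBall x r) with hm
  have hm0 : m ≠ 0 := (Metric.measure_closedBall_pos volume x hr).ne'
  have hmt : m ≠ ⊤ := measure_closedBall_lt_top.ne
  have hmk : volume (Metric.closedBall x (k * r)) = ENNReal.ofReal (k ^ 2) * m :=
    volume_closedBall_mul x (by linarith) r
  set X := ∫⁻ y in Metric.closedBall x (k * r), g y with hX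
  set Y := ∫⁻ y in Metric.closedBall x (k * r), h y ^ 2 with hY
  set a := ∫⁻ y in Metric.closedBall x (k * r),
    {y | ENNReal.ofReal (c * L) < g y}.indicator g y with ha
  set b := ∫⁻ y in Metric.closedBall x (k * r),
    {y | ENNReal.ofReal (c * L) < h y}.indicator (fun y => h y ^ 2) y with hb
  have hXa : X ≤ ENNReal.ofReal (c * L) * (ENNReal.ofReal (k ^ 2) * m) + a := by
    rw [← hmk]; exact setLIntegral_le_add_superlevel _
  have hYb : Y ≤ ENNReal.ofReal ((c * L) ^ 2) * (ENNReal.ofReal (k ^ 2) * m) + b := by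
    rw [← hmk]
    refine (setLIntegral_le_add_superlevel (ENNReal.ofReal ((c * L) ^ 2))).trans ?_
    have hset : {y | ENNReal.ofReal ((c * L) ^ 2) < h y ^ 2} = {y | ENNReal.ofReal (c * L) < h y} := by
      ext y
      change ENNReal.ofReal ((c * L) ^ 2) < h y ^ 2 ↔ ENNReal.ofReal (c * L) < h y
      rw [ENNReal.ofReal_pow (by positivity)]
      exact ⟨fun h => lt_of_not_ge fun hle => absurd h (not_lt.2 (pow_le_pow_left' hle 2)),
        fun h => ENNReal.pow_lt_pow_left (by norm_num) h⟩
    rw [hset]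
  -- Cauchy–Schwarz with the stopping bound on the larger ball. It linearises the quadratic term:
  -- `X²` becomes a multiple of `L X`.
  have hXX : X ≤ ENNReal.ofReal (5 * k ^ 2 * L) * m := by
    have hsub : Metric.closedBall x (k * r) ⊆ Metric.closedBall x (k * (5 * r)) :=
      Metric.closedBall_subset_closedBall (by nlinarith)
    have hCS := ENNReal.lintegral_mul_le_Lp_mul_Lq (volume.restrict (Metric.closedBall x (k * r)))
      (Real.HolderConjugate.two_two) hg.aemeasurable (measurable_const (a := (1 : ENNReal))).aemeasurable
    have h5 : ∫⁻ y in Metric.closedBall x (k * r), g y ^ 2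
        ≤ ENNReal.ofReal L ^ 2 * (ENNReal.ofReal ((5 * k) ^ 2) * m) := by
      refine (lintegral_mono_set hsub).trans (h2.trans_eq ?_)
      rw [show k * (5 * r) = (5 * k) * r by ring, volume_closedBall_mul x (by linarith) r]
    simp only [Pi.mul_apply, mul_one, ENNReal.one_rpow, lintegral_const,
      Measure.restrict_apply_univ, one_mul, hmk] at hCS
    refine hCS.trans ?_
    calc _ ≤ (ENNReal.ofReal L ^ 2 * (ENNReal.ofReal ((5 * k) ^ 2) * m)) ^ (1 / 2 : ℝ) *
          (ENNReal.ofReal (k ^ 2) * m) ^ (1 / 2 : ℝ) := by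
          gcongr
          refine le_trans (le_of_eq ?_) h5
          simp
      _ = ((ENNReal.ofReal (5 * k ^ 2 * L) * m) ^ 2) ^ (1 / 2 : ℝ) := by
          rw [← ENNReal.mul_rpow_of_nonneg _ _ (by norm_num)]
          congr 1
          rw [mul_pow (ENNReal.ofReal _), ← ENNReal.ofReal_pow (by positivity),
            ← ENNReal.ofReal_pow (by positivity)]
          rw [show ∀ p q s : ENNReal, p * (q * m) * (s * m) = (p * q * s) * m ^ 2 by intros; ring,
            ← ENNReal.ofReal_mul (by positivity), ← ENNReal.ofReal_mul (by positivity)]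
          congr 2; ring
      _ = _ := by
          rw [← ENNReal.rpow_natCast, ← ENNReal.rpow_mul]; norm_num
  have hXt : X ≠ ⊤ := (hXX.trans_lt (ENNReal.mul_lt_top ENNReal.ofReal_lt_top hmt.lt_top)).ne
  have haX : a ≤ X := lintegral_mono fun y => Set.indicator_le_self _ _ y
  have hat : a ≠ ⊤ := (haX.trans_lt hXt.lt_top).ne
  by_cases hbt : b = ⊤
  · rw [hbt]
    simp [ENNReal.mul_top, show 0 < A by linarith]
  have hYt : Y ≠ ⊤ := (hYb.trans_lt (ENNReal.add_lt_top.2 ⟨ENNReal.mul_lt_top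
    ENNReal.ofReal_lt_top (ENNReal.mul_lt_top ENNReal.ofReal_lt_top hmt.lt_top),
      Ne.lt_top hbt⟩)).ne
  have key := h1.trans hRH
  clear_value m X Y a b
  lift m to NNReal using hmt
  lift X to NNReal using hXt
  lift Y to NNReal using hYt
  lift a to NNReal using hat
  lift b to NNReal using hbt
  have hm0' : (0 : ℝ) < m := by
    have : m ≠ 0 := by simpa using hm0
    positivity
  have e : ∀ q : NNReal, (q : ENNReal) = ENNReal.ofReal (q : ℝ) := fun q => by simp
  simp only [e] at hXa hYb hXX key ⊢
  rw [← ENNReal.ofReal_inv_of_pos hm0'] at key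
  rw [← ENNReal.ofReal_pow hL.le] at key ⊢
  have hk2 : 0 ≤ k ^ 2 := by positivity
  have hcL : 0 ≤ c * L := by positivity
  rw [← ENNReal.ofReal_mul hk2, ← ENNReal.ofReal_mul hcL,
    ← ENNReal.ofReal_add (by positivity) (by positivity),
    ENNReal.ofReal_le_ofReal_iff (by positivity)] at hXa
  rw [← ENNReal.ofReal_mul hk2, ← ENNReal.ofReal_mul (by positivity),
    ← ENNReal.ofReal_add (by positivity) (by positivity),
    ENNReal.ofReal_le_ofReal_iff (by positivity)] at hYb
  rw [← ENNReal.ofReal_mul (by positivity), ENNReal.ofReal_le_ofReal_iff (by positivity)] at hXX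
  rw [← ENNReal.ofReal_pow (by positivity), ← ENNReal.ofReal_mul (by positivity),
    ← ENNReal.ofReal_mul (by positivity), ← ENNReal.ofReal_add (by positivity) (by positivity),
    ← ENNReal.ofReal_mul (by positivity), ENNReal.ofReal_le_ofReal_iff (by positivity)] at key
  rw [← ENNReal.ofReal_mul (by positivity), ← ENNReal.ofReal_mul (by positivity),
    ← ENNReal.ofReal_add (by positivity) (by positivity), ← ENNReal.ofReal_mul (by positivity)]
  exact ENNReal.ofReal_le_ofReal
    (stopping_ball_arith hA hk hc hL hm0' X.2 hXa hXX hYb key)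

/-- The Vitali lemma extracts disjoint balls `B(b, k·rad b)` whose five-fold enlargements cover
almost all of `{g > L}`. On an enlargement the stopping property gives `∫ g² ≤ 25k²L²|B(b, rad b)|`.
By `stopping_ball_bound` this is controlled by superlevel integrals over the disjoint balls, and
these can be summed. -/
theorem superlevel_lintegral_sq_le {A k c L r₀ : ℝ} (hA : 1 ≤ A) (hk : 1 ≤ k)
    (hc : c = 1 / (12 * A * k ^ 4)) (hL : 0 < L) {g h : Plane → ENNReal} (hg : Measurable g)
    (hg2 : ∫⁻ x, g x ^ 2 ≠ ⊤) {E : Set Plane} (hE : ∀ x ∉ E, g x = 0)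
    (hRH : ∀ x ∈ E, ∀ r, 0 < r → r < r₀ →
      ∫⁻ y in Metric.closedBall x r, g y ^ 2 ≤ ENNReal.ofReal A *
      ((volume (Metric.closedBall x r))⁻¹ * (∫⁻ y in Metric.closedBall x (k * r), g y) ^ 2
        + ∫⁻ y in Metric.closedBall x (k * r), h y ^ 2))
    (hbig : ∀ x r, r₀ ≤ r → ∫⁻ y in Metric.closedBall x r, g y ^ 2 <
      ENNReal.ofReal L ^ 2 * volume (Metric.closedBall x r)) :
    ∫⁻ x, {x | ENNReal.ofReal L < g x}.indicator (fun x => g x ^ 2) x ≤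
      ENNReal.ofReal (50 * A * k ^ 2) * (ENNReal.ofReal (5 * k ^ 2 * L) *
          (∫⁻ x, {x | ENNReal.ofReal (c * L) < g x}.indicator g x)
        + ∫⁻ x, {x | ENNReal.ofReal (c * L) < h x}.indicator (fun x => h x ^ 2) x) := by
  have hst := ae_exists_stopping_radius hg hg2 (L := ENNReal.ofReal L) hbig
  set T : Set Plane := {x | ENNReal.ofReal L < g x ∧ ∃ r, 0 < r ∧ r < r₀ ∧
      ENNReal.ofReal L ^ 2 * volume (Metric.closedBall x r)
        ≤ ∫⁻ y in Metric.closedBall x r, g y ^ 2 ∧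
      ∀ r', 2 * r ≤ r' → ∫⁻ y in Metric.closedBall x r', g y ^ 2 ≤
        ENNReal.ofReal L ^ 2 * volume (Metric.closedBall x r')} with hT
  have hTE : ∀ x ∈ T, x ∈ E := by
    intro x hx
    by_contra hxE
    have := hx.1
    rw [hE x hxE] at this
    exact absurd this not_lt_zero
  have hrad : ∀ x, ∃ r, x ∈ T → (0 < r ∧ r < r₀ ∧
      ENNReal.ofReal L ^ 2 * volume (Metric.closedBall x r)
        ≤ ∫⁻ y in Metric.closedBall x r, g y ^ 2 ∧
      ∀ r', 2 * r ≤ r' → ∫⁻ y in Metric.closedBall x r', g y ^ 2 ≤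
        ENNReal.ofReal L ^ 2 * volume (Metric.closedBall x r')) := by
    intro x
    by_cases hx : x ∈ T
    · obtain ⟨r, hr⟩ := hx.2
      exact ⟨r, fun _ => hr⟩
    · exact ⟨0, fun h => absurd h hx⟩
  choose rad hrad using hrad
  obtain ⟨u, huT, hdisj, hcov⟩ := Vitali.exists_disjoint_subfamily_covering_enlargement_closedBall
    T id (fun x => k * rad x) (k * r₀)
    (fun x hx => mul_le_mul_of_nonneg_left (hrad x hx).2.1.le (by linarith)) 5 (by norm_num)
  have hucount : u.Countable := by
    refine hdisj.countable_of_nonempty_interior fun x hx => ?_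
    refine ⟨x, Metric.ball_subset_interior_closedBall (Metric.mem_ball_self ?_)⟩
    have := (hrad x (huT hx)).1
    positivity
  have hcover : ∀ᵐ x, x ∈ {x | ENNReal.ofReal L < g x} →
      x ∈ ⋃ b ∈ u, Metric.closedBall b (k * (5 * rad b)) := by
    filter_upwards [hst] with x hx hxL
    have hxT : x ∈ T := ⟨hxL, hx hxL⟩
    obtain ⟨b, hb, hsub⟩ := hcov x hxT
    refine Set.mem_biUnion hb ?_
    rw [show k * (5 * rad b) = 5 * (k * rad b) by ring]
    refine hsub (Metric.mem_closedBall_self ?_)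
    have := (hrad x hxT).1
    positivity
  have hball : ∀ b ∈ u, ENNReal.ofReal L ^ 2 * volume (Metric.closedBall b (rad b))
      ≤ ENNReal.ofReal (2 * A) *
      (ENNReal.ofReal (5 * k ^ 2 * L) * (∫⁻ y in Metric.closedBall b (k * rad b),
          {y | ENNReal.ofReal (c * L) < g y}.indicator g y)
        + ∫⁻ y in Metric.closedBall b (k * rad b),
          {y | ENNReal.ofReal (c * L) < h y}.indicator (fun y => h y ^ 2) y) := by
    intro b hb
    obtain ⟨h0, h1, h2, h3⟩ := hrad b (huT hb)
    exact stopping_ball_bound hA hk hc hL hg h0 (hRH b (hTE b (huT hb)) _ h0 h1) h2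
      (h3 _ (by nlinarith))
  have : Countable u := hucount.to_subtype
  have hsum : ∀ f : Plane → ENNReal,
      ∑' b : u, ∫⁻ y in Metric.closedBall (b : Plane) (k * rad b), f y ≤ ∫⁻ y, f y := by
    intro f
    rw [← lintegral_iUnion (fun b => measurableSet_closedBall)]
    · exact setLIntegral_le_lintegral _ _
    · intro b b' hbb
      exact hdisj b.2 b'.2 fun h => hbb (Subtype.ext h)
  calc ∫⁻ x, {x | ENNReal.ofReal L < g x}.indicator (fun x => g x ^ 2) x
      ≤ ∫⁻ x, (⋃ b ∈ u, Metric.closedBall b (k * (5 * rad b))).indicator (fun x => g x ^ 2) x := by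
        refine lintegral_mono_ae ?_
        filter_upwards [hcover] with x hx
        by_cases hxL : x ∈ {x | ENNReal.ofReal L < g x}
        · rw [Set.indicator_of_mem hxL, Set.indicator_of_mem (hx hxL)]
        · rw [Set.indicator_of_notMem hxL]; exact zero_le
    _ ≤ ∑' b : u, ∫⁻ y in Metric.closedBall (b : Plane) (k * (5 * rad b)), g y ^ 2 := by
        rw [lintegral_indicator (MeasurableSet.biUnion hucount
          fun b _ => measurableSet_closedBall), Set.biUnion_eq_iUnion]
        exact lintegral_iUnion_le _ _
    _ ≤ ∑' b : u, ENNReal.ofReal (25 * k ^ 2) * (ENNReal.ofReal (2 * A) *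
        (ENNReal.ofReal (5 * k ^ 2 * L) * (∫⁻ y in Metric.closedBall (b : Plane) (k * rad b),
          {y | ENNReal.ofReal (c * L) < g y}.indicator g y)
        + ∫⁻ y in Metric.closedBall (b : Plane) (k * rad b),
          {y | ENNReal.ofReal (c * L) < h y}.indicator (fun y => h y ^ 2) y)) := by
        refine ENNReal.tsum_le_tsum fun b => ?_
        obtain ⟨h0, h1, h2, h3⟩ := hrad b (huT b.2)
        refine (h3 _ (by nlinarith)).trans ?_
        rw [show k * (5 * rad b) = (5 * k) * rad b by ring,
          volume_closedBall_mul _ (by positivity), mul_left_comm,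
          show (5 * k) ^ 2 = 25 * k ^ 2 by ring]
        exact mul_le_mul_right (hball b b.2) _
    _ ≤ _ := by
        simp only [← mul_assoc]
        rw [ENNReal.tsum_mul_left, ENNReal.tsum_add, ENNReal.tsum_mul_left,
          ← ENNReal.ofReal_mul (by positivity), show 25 * k ^ 2 * (2 * A) = 50 * A * k ^ 2 by ring]
        gcongr
        · exact hsum _
        · exact hsum _

end RhombiSlits

/-! ### Layer-cake integration of the level set inequality and Gehring's lemma. -/

namespace RhombiSlits

theorem lintegral_Ioo_rpow {q y : ℝ} (hq : -1 < q) (hy : 0 ≤ y) :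
    ∫⁻ t in Set.Ioo 0 y, ENNReal.ofReal (t ^ q) = ENNReal.ofReal (y ^ (q + 1) / (q + 1)) := by
  rw [setLIntegral_congr Ioo_ae_eq_Ioc]
  have hi : IntervalIntegrable (fun t : ℝ => t ^ q) volume 0 y :=
    intervalIntegral.intervalIntegrable_rpow' hq
  rw [← ofReal_integral_eq_lintegral_ofReal
    ((intervalIntegrable_iff_integrableOn_Ioc_of_le hy).1 hi)
    ((ae_restrict_iff' measurableSet_Ioc).2 (ae_of_all _ fun t ht => Real.rpow_nonneg ht.1.le q)),
    ← intervalIntegral.integral_of_le hy, integral_rpow (Or.inl hq),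
    Real.zero_rpow (by linarith), sub_zero]

/-- The condition `c t < y` with `t < N` confines `t` to `(0, min (y/c) N)`, where the power
integrates explicitly. -/
theorem lintegral_layer_le {q a N c y : ℝ} (hq : -1 < q) (ha : 0 ≤ a) (hc : 0 < c) (hy : 0 ≤ y)
    (hN : 0 ≤ N) :
    ∫⁻ t in Set.Ioo a N, {t : ℝ | c * t < y}.indicator (fun t => ENNReal.ofReal (t ^ q)) t
      ≤ ENNReal.ofReal ((min (y / c) N) ^ (q + 1) / (q + 1)) := by
  have hmin : 0 ≤ min (y / c) N := le_min (by positivity) hN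
  rw [← lintegral_Ioo_rpow hq hmin, ← lintegral_indicator measurableSet_Ioo,
    ← lintegral_indicator measurableSet_Ioo]
  refine lintegral_mono fun t => ?_
  by_cases ht : t ∈ Set.Ioo a N
  · rw [Set.indicator_of_mem ht]
    by_cases hty : c * t < y
    · rw [Set.indicator_of_mem (show t ∈ {t : ℝ | c * t < y} from hty), Set.indicator_of_mem]
      exact ⟨ha.trans_lt ht.1, lt_min (by rw [lt_div_iff₀ hc]; linarith) ht.2⟩
    · rw [Set.indicator_of_notMem (show t ∉ {t : ℝ | c * t < y} from hty)]
      exact zero_le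
  · rw [Set.indicator_of_notMem ht]; exact zero_le

theorem le_lintegral_layer {q a N y : ℝ} (hq : -1 < q) (ha : 0 ≤ a) (hy : 0 ≤ y)
    (hN : 0 ≤ N) :
    ENNReal.ofReal ((min y N) ^ (q + 1) / (q + 1)) ≤ ENNReal.ofReal (a ^ (q + 1) / (q + 1)) +
      ∫⁻ t in Set.Ioo a N, {t : ℝ | t < y}.indicator (fun t => ENNReal.ofReal (t ^ q)) t := by
  rw [← lintegral_Ioo_rpow hq (le_min hy hN), ← lintegral_Ioo_rpow hq ha,
    setLIntegral_congr (Ioo_ae_eq_Ioc (a := (0 : ℝ)) (b := a)),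
    ← lintegral_indicator measurableSet_Ioo,
    ← lintegral_indicator measurableSet_Ioc, ← lintegral_indicator measurableSet_Ioo,
    ← lintegral_add_left ((by fun_prop : Measurable fun t : ℝ =>
      ENNReal.ofReal (t ^ q)).indicator measurableSet_Ioc)]
  refine lintegral_mono fun t => ?_
  by_cases ht : t ∈ Set.Ioo 0 (min y N)
  · rw [Set.indicator_of_mem ht]
    by_cases hta : t ≤ a
    · rw [Set.indicator_of_mem (show t ∈ Set.Ioc 0 a from ⟨ht.1, hta⟩)]
      exact le_self_add
    · have h1 : t ∈ Set.Ioo a N := ⟨not_le.1 hta, ht.2.trans_le (min_le_right _ _)⟩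
      have h2 : t ∈ {t : ℝ | t < y} := ht.2.trans_le (min_le_left _ _)
      rw [Set.indicator_of_mem h1, Set.indicator_of_mem h2]
      exact le_add_self
  · rw [Set.indicator_of_notMem ht]; exact zero_le

/-- Tonelli for superlevel sets. -/
theorem lintegral_superlevel_swap {f : Plane → ENNReal} {y : Plane → ℝ} (hf : Measurable f)
    (hy : Measurable y) (c : ℝ) {w : ℝ → ENNReal} (hw : Measurable w) (a N : ℝ) :
    ∫⁻ t in Set.Ioo a N, w t * ∫⁻ x, {x | c * t < y x}.indicator f x
      = ∫⁻ x, f x * ∫⁻ t in Set.Ioo a N, {t : ℝ | c * t < y x}.indicator w t := by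
  have hset : MeasurableSet {z : ℝ × Plane | c * z.1 < y z.2} :=
    measurableSet_lt (by fun_prop) (by fun_prop)
  have hm : Measurable fun z : ℝ × Plane =>
      {z : ℝ × Plane | c * z.1 < y z.2}.indicator (fun z => w z.1 * f z.2) z :=
    Measurable.indicator (by fun_prop) hset
  have h1 : ∀ t, w t * ∫⁻ x, {x | c * t < y x}.indicator f x
      = ∫⁻ x, {z : ℝ × Plane | c * z.1 < y z.2}.indicator (fun z => w z.1 * f z.2) (t, x) := by
    intro t
    rw [← lintegral_const_mul _ (hf.indicator (measurableSet_lt measurable_const hy))]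
    refine lintegral_congr fun x => ?_
    by_cases h : c * t < y x
    · rw [Set.indicator_of_mem (show x ∈ {x | c * t < y x} from h),
        Set.indicator_of_mem (show (t, x) ∈ {z : ℝ × Plane | c * z.1 < y z.2} from h)]
    · rw [Set.indicator_of_notMem (show x ∉ {x | c * t < y x} from h),
        Set.indicator_of_notMem (show (t, x) ∉ {z : ℝ × Plane | c * z.1 < y z.2} from h), mul_zero]
  simp only [h1]
  rw [lintegral_lintegral_swap hm.aemeasurable]
  refine lintegral_congr fun x => ?_
  rw [← lintegral_const_mul _ (hw.indicator (measurableSet_lt (by fun_prop) measurable_const))]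
  refine lintegral_congr fun t => ?_
  by_cases h : c * t < y x
  · rw [Set.indicator_of_mem (show t ∈ {t | c * t < y x} from h),
      Set.indicator_of_mem (show (t, x) ∈ {z : ℝ × Plane | c * z.1 < y z.2} from h), mul_comm]
  · rw [Set.indicator_of_notMem (show t ∉ {t | c * t < y x} from h),
      Set.indicator_of_notMem (show (t, x) ∉ {z : ℝ × Plane | c * z.1 < y z.2} from h), mul_zero]

/-- The level set inequality is multiplied by `t^{Q-1}` and integrated over `(a, N)`. The term in
`g` on the right is again the left-hand side, with a factor of order `Q`, so for small `Q` it is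
absorbed. -/
theorem lintegral_truncated_le {C₁ C₂ c Q a N : ℝ} (hC₁ : 0 ≤ C₁) (hC₂ : 0 ≤ C₂) (hc : 0 < c)
    (hc1 : c ≤ 1) (hQ : 0 < Q) (hQ1 : Q ≤ 1) (hsmall : Q * C₁ * (c ^ 2)⁻¹ ≤ 1 / 2) (ha : 0 ≤ a)
    (hN : 0 ≤ N)
    {g h : Plane → ℝ} (hg : Measurable g) (hh : Measurable h) (hg0 : ∀ x, 0 ≤ g x)
    (hh0 : ∀ x, 0 ≤ h x) (hg2 : ∫⁻ x, ENNReal.ofReal (g x) ^ 2 ≠ ⊤)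
    (hlev : ∀ t, a < t → ∫⁻ x, {x | t < g x}.indicator (fun x => ENNReal.ofReal (g x) ^ 2) x ≤
      ENNReal.ofReal (C₁ * t) * (∫⁻ x, {x | c * t < g x}.indicator (fun x => ENNReal.ofReal (g x)) x)
      + ENNReal.ofReal C₂ *
        ∫⁻ x, {x | c * t < h x}.indicator (fun x => ENNReal.ofReal (h x) ^ 2) x) :
    ∫⁻ x, ENNReal.ofReal (g x) ^ 2 * ENNReal.ofReal ((min (g x) N) ^ Q) ≤
      2 * (ENNReal.ofReal (a ^ Q) * (∫⁻ x, ENNReal.ofReal (g x) ^ 2) +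
        ENNReal.ofReal (C₂ * c⁻¹) * ∫⁻ x, ENNReal.ofReal (h x ^ (2 + Q))) := by
  set G : Plane → ENNReal := fun x => ENNReal.ofReal (g x) with hG
  have hGm : Measurable G := by fun_prop
  have hHm : Measurable fun x => ENNReal.ofReal (h x) := by fun_prop
  set I := ∫⁻ x, G x ^ 2 * ENNReal.ofReal ((min (g x) N) ^ Q) with hI
  have hT0 : ∀ x, 0 ≤ min (g x) N := fun x => le_min (hg0 x) hN
  -- The truncation at `N` serves this finiteness, without which the absorption would be
  -- illegitimate.
  have hIt : I ≠ ⊤ := by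
    refine (lt_of_le_of_lt (b := ∫⁻ x, G x ^ 2 * ENNReal.ofReal (N ^ Q)) ?_ ?_).ne
    · refine lintegral_mono fun x => ?_
      gcongr
      · exact hT0 x
      · exact min_le_right _ _
    · rw [lintegral_mul_const _ (hGm.pow_const 2)]
      exact ENNReal.mul_lt_top hg2.lt_top ENNReal.ofReal_lt_top
  set w₁ : ℝ → ENNReal := fun t => ENNReal.ofReal (t ^ (Q - 1)) with hw₁
  set w₂ : ℝ → ENNReal := fun t => ENNReal.ofReal (t ^ Q) with hw₂
  have hw₁m : Measurable w₁ := by fun_prop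
  have hw₂m : Measurable w₂ := by fun_prop
  have hQ0 : Q - 1 + 1 = Q := by ring
  have hlow : ENNReal.ofReal Q⁻¹ * I ≤ ENNReal.ofReal (a ^ Q / Q) * (∫⁻ x, G x ^ 2) +
      ∫⁻ t in Set.Ioo a N, w₁ t * ∫⁻ x, {x | 1 * t < g x}.indicator (fun x => G x ^ 2) x := by
    rw [lintegral_superlevel_swap (hGm.pow_const 2) hg 1 hw₁m, hI,
      ← lintegral_const_mul _ (by fun_prop), ← lintegral_const_mul _ (by fun_prop),
      ← lintegral_add_left (by fun_prop)]
    refine lintegral_mono fun x => ?_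
    have := le_lintegral_layer (q := Q - 1) (a := a) (N := N) (y := g x) (by linarith) ha (hg0 x) hN
    rw [hQ0] at this
    calc ENNReal.ofReal Q⁻¹ * (G x ^ 2 * ENNReal.ofReal (min (g x) N ^ Q))
        = G x ^ 2 * ENNReal.ofReal (min (g x) N ^ Q / Q) := by
          rw [mul_left_comm, ← ENNReal.ofReal_mul (by positivity)]
          congr 2; ring
      _ ≤ G x ^ 2 * (ENNReal.ofReal (a ^ Q / Q) + ∫⁻ t in Set.Ioo a N,
            {t : ℝ | t < g x}.indicator (fun t => ENNReal.ofReal (t ^ (Q - 1))) t) := by gcongr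
      _ = _ := by
          rw [mul_add, mul_comm (G x ^ 2)]
          simp only [one_mul, hw₁]
  have hup : ∫⁻ t in Set.Ioo a N, w₁ t * ∫⁻ x, {x | 1 * t < g x}.indicator (fun x => G x ^ 2) x
      ≤ ENNReal.ofReal (C₁ * (c ^ 2)⁻¹) * I
        + ENNReal.ofReal (C₂ * (c⁻¹ / Q)) * ∫⁻ x, ENNReal.ofReal (h x ^ (2 + Q)) := by
    calc ∫⁻ t in Set.Ioo a N, w₁ t * ∫⁻ x, {x | 1 * t < g x}.indicator (fun x => G x ^ 2) x
        ≤ ∫⁻ t in Set.Ioo a N, (ENNReal.ofReal C₁ *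
            (w₂ t * ∫⁻ x, {x | c * t < g x}.indicator G x) + ENNReal.ofReal C₂ *
            (w₁ t * ∫⁻ x, {x | c * t < h x}.indicator (fun x => ENNReal.ofReal (h x) ^ 2) x)) := by
          refine setLIntegral_mono' measurableSet_Ioo fun t ht => ?_
          have ht0 : 0 < t := ha.trans_lt ht.1
          have h1 := hlev t ht.1
          simp only [one_mul]
          calc _ ≤ w₁ t * _ := mul_le_mul_right h1 _
            _ = _ := by
              have : w₁ t * ENNReal.ofReal (C₁ * t) = ENNReal.ofReal C₁ * w₂ t := by
                rw [hw₁, hw₂]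
                simp only
                rw [← ENNReal.ofReal_mul (by positivity), ← ENNReal.ofReal_mul hC₁]
                congr 1
                rw [mul_left_comm, ← Real.rpow_add_one ht0.ne', hQ0]
              rw [mul_add, ← mul_assoc, this]
              ring
      _ = ENNReal.ofReal C₁ * (∫⁻ x, G x * ∫⁻ t in Set.Ioo a N, {t | c * t < g x}.indicator w₂ t) +
          ENNReal.ofReal C₂ * ∫⁻ x, ENNReal.ofReal (h x) ^ 2 *
            ∫⁻ t in Set.Ioo a N, {t | c * t < h x}.indicator w₁ t := by
          rw [← lintegral_superlevel_swap hGm hg c hw₂m,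
            ← lintegral_superlevel_swap (hHm.pow_const 2) hh c hw₁m,
            ← lintegral_const_mul' _ _ ENNReal.ofReal_ne_top,
            ← lintegral_const_mul' _ _ ENNReal.ofReal_ne_top, ← lintegral_add_left]
          refine Measurable.const_mul (hw₂m.mul ?_) _
          refine Measurable.lintegral_prod_right'
            (f := fun z : ℝ × Plane => {x | c * z.1 < g x}.indicator G z.2) ?_
          have : (fun z : ℝ × Plane => {x | c * z.1 < g x}.indicator G z.2)
              = {z : ℝ × Plane | c * z.1 < g z.2}.indicator fun z => G z.2 := by
            ext z; rfl
          rw [this]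
          exact Measurable.indicator (by fun_prop) (measurableSet_lt (by fun_prop) (by fun_prop))
      _ ≤ ENNReal.ofReal C₁ * (∫⁻ x, ENNReal.ofReal ((c ^ 2)⁻¹) *
            (G x ^ 2 * ENNReal.ofReal ((min (g x) N) ^ Q))) +
          ENNReal.ofReal C₂ * ∫⁻ x, ENNReal.ofReal (c⁻¹ / Q) * ENNReal.ofReal (h x ^ (2 + Q)) := by
          refine add_le_add (mul_le_mul_right (lintegral_mono fun x => ?_) _)
            (mul_le_mul_right (lintegral_mono fun x => ?_) _)
          · refine (mul_le_mul_right (lintegral_layer_le (by linarith) ha hc (hg0 x) hN) _).trans ?_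
            rw [hG]
            simp only
            rw [← ENNReal.ofReal_pow (hg0 x), ← ENNReal.ofReal_mul (hg0 x),
              ← ENNReal.ofReal_mul (by have := hg0 x; positivity),
              ← ENNReal.ofReal_mul (by positivity)]
            refine ENNReal.ofReal_le_ofReal ?_
            set T := min (g x) N with hT
            have hTg : T ≤ g x := min_le_left _ _
            have h1 : min (g x / c) N ≤ T / c := by
              rw [hT, ← min_div_div_right hc.le]
              refine min_le_min le_rfl ?_
              rw [le_div_iff₀ hc]; nlinarith
            have h2 : (T / c) ^ (Q + 1) ≤ (c ^ 2)⁻¹ * (T ^ Q * T) := by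
              rw [Real.div_rpow (hT0 x) hc.le, Real.rpow_add_one' (hT0 x) (by linarith),
                div_eq_mul_inv, mul_comm]
              have hTn : 0 ≤ T ^ Q * T := mul_nonneg (Real.rpow_nonneg (hT0 x) _) (hT0 x)
              refine mul_le_mul_of_nonneg_right ?_ hTn
              refine inv_anti₀ (by positivity) ?_
              rw [← Real.rpow_natCast]
              exact Real.rpow_le_rpow_of_exponent_ge hc hc1 (by push_cast; linarith)
            have h3 : min (g x / c) N ^ (Q + 1) / (Q + 1) ≤ (c ^ 2)⁻¹ * (T ^ Q * T) := by
              refine (div_le_self (Real.rpow_nonneg (le_min (div_nonneg (hg0 x) hc.le) hN) _)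
                (by linarith)).trans (le_trans ?_ h2)
              exact Real.rpow_le_rpow (le_min (div_nonneg (hg0 x) hc.le) hN) h1 (by linarith)
            calc g x * (min (g x / c) N ^ (Q + 1) / (Q + 1))
                ≤ g x * ((c ^ 2)⁻¹ * (T ^ Q * T)) := mul_le_mul_of_nonneg_left h3 (hg0 x)
              _ ≤ g x * ((c ^ 2)⁻¹ * (T ^ Q * g x)) := by
                  have := hg0 x
                  have hTn : 0 ≤ T ^ Q := Real.rpow_nonneg (hT0 x) _
                  gcongr
              _ = _ := by ring
          · refine (mul_le_mul_right (lintegral_layer_le (by linarith) ha hc (hh0 x) hN) _).trans ?_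
            rw [← ENNReal.ofReal_pow (hh0 x), ← ENNReal.ofReal_mul (by have := hh0 x; positivity),
              ← ENNReal.ofReal_mul (by positivity)]
            refine ENNReal.ofReal_le_ofReal ?_
            rw [hQ0]
            have hhx := hh0 x
            have h1 : min (h x / c) N ^ Q ≤ c⁻¹ * h x ^ Q := by
              refine (Real.rpow_le_rpow (le_min (by positivity) hN) (min_le_left _ _) hQ.le).trans ?_
              rw [Real.div_rpow hhx hc.le, div_eq_mul_inv, mul_comm]
              refine mul_le_mul_of_nonneg_right ?_ (by positivity)
              refine inv_anti₀ hc ?_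
              simpa using Real.rpow_le_rpow_of_exponent_ge hc hc1 hQ1
            calc h x ^ 2 * (min (h x / c) N ^ Q / Q) ≤ h x ^ 2 * (c⁻¹ * h x ^ Q / Q) := by gcongr
              _ = c⁻¹ / Q * h x ^ (2 + Q) := by
                rw [Real.rpow_add' hhx (by linarith)]
                norm_num
                ring
      _ = _ := by
          rw [lintegral_const_mul _ (by fun_prop), lintegral_const_mul _ (by fun_prop),
            ← mul_assoc, ← mul_assoc, ← ENNReal.ofReal_mul hC₁, ← ENNReal.ofReal_mul hC₂, hI]
  set J₁ := ∫⁻ x, G x ^ 2 with hJ₁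
  set J₂ := ∫⁻ x, ENNReal.ofReal (h x ^ (2 + Q)) with hJ₂
  have hfin := hlow.trans (add_le_add_right hup _)
  have hmul : I ≤ ENNReal.ofReal (a ^ Q) * J₁ + (ENNReal.ofReal (1 / 2) * I +
      ENNReal.ofReal (C₂ * c⁻¹) * J₂) := by
    have h1 := mul_le_mul_right hfin (ENNReal.ofReal Q)
    rw [← mul_assoc, ← ENNReal.ofReal_mul hQ.le, mul_inv_cancel₀ hQ.ne', ENNReal.ofReal_one,
      one_mul] at h1
    refine h1.trans ?_
    rw [mul_add, mul_add, ← mul_assoc, ← mul_assoc, ← mul_assoc, ← ENNReal.ofReal_mul hQ.le,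
      ← ENNReal.ofReal_mul hQ.le, ← ENNReal.ofReal_mul hQ.le]
    rw [mul_div_cancel₀ _ hQ.ne', show Q * (C₂ * (c⁻¹ / Q)) = C₂ * c⁻¹ by field_simp]
    gcongr
    linarith
  have hhalf : I = ENNReal.ofReal (1 / 2) * I + ENNReal.ofReal (1 / 2) * I := by
    rw [← add_mul, ← ENNReal.ofReal_add (by norm_num) (by norm_num)]; norm_num
  have h2 : ENNReal.ofReal (1 / 2) * I ≤ ENNReal.ofReal (a ^ Q) * J₁ +
      ENNReal.ofReal (C₂ * c⁻¹) * J₂ := by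
    have ht : ENNReal.ofReal (1 / 2) * I ≠ ⊤ := ENNReal.mul_ne_top ENNReal.ofReal_ne_top hIt
    rw [add_left_comm] at hmul
    nth_rewrite 1 [hhalf] at hmul
    exact (ENNReal.add_le_add_iff_left ht).1 hmul
  calc I = 2 * (ENNReal.ofReal (1 / 2) * I) := by rw [two_mul]; exact hhalf
    _ ≤ _ := by gcongr

/-- A reverse Hölder inequality on all small balls centred in the support of `g` improves the
integrability of `g`. -/
theorem gehring {A k r₀ : ℝ} (hA : 1 ≤ A) (hk : 1 ≤ k) (hr₀ : 0 < r₀) :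
    ∃ Q₀ : ℝ, 0 < Q₀ ∧ ∀ Q : ℝ, 0 < Q → Q ≤ Q₀ → ∃ C : ℝ, 0 < C ∧
      ∀ (E : Set Plane) (g h : Plane → ℝ), Measurable g → Measurable h → (∀ x, 0 ≤ g x) →
        (∀ x, 0 ≤ h x) → (∀ x ∉ E, g x = 0) → ∫⁻ x, ENNReal.ofReal (g x) ^ 2 ≠ ⊤ →
        (∀ x ∈ E, ∀ r, 0 < r → r < r₀ →
          ∫⁻ y in Metric.closedBall x r, ENNReal.ofReal (g y) ^ 2 ≤ ENNReal.ofReal A *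
          ((volume (Metric.closedBall x r))⁻¹ *
              (∫⁻ y in Metric.closedBall x (k * r), ENNReal.ofReal (g y)) ^ 2
            + ∫⁻ y in Metric.closedBall x (k * r), ENNReal.ofReal (h y) ^ 2)) →
        ∫⁻ x, ENNReal.ofReal (g x ^ (2 + Q)) ≤ ENNReal.ofReal C *
          ((∫⁻ x, ENNReal.ofReal (g x) ^ 2) ^ (1 + Q / 2) +
            ∫⁻ x, ENNReal.ofReal (h x ^ (2 + Q))) := by
  set c : ℝ := 1 / (12 * A * k ^ 4) with hc
  have hc0 : 0 < c := by rw [hc]; positivity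
  have hk4 : 1 ≤ k ^ 4 := one_le_pow₀ hk
  have hc1 : c ≤ 1 := by rw [hc, div_le_one (by positivity)]; nlinarith
  set C₂ : ℝ := 50 * A * k ^ 2 with hC₂
  set C₁ : ℝ := C₂ * (5 * k ^ 2) with hC₁
  have hC₂0 : 0 < C₂ := by positivity
  have hC₁0 : 0 < C₁ := by positivity
  refine ⟨min 1 (1 / (2 * (C₁ * (c ^ 2)⁻¹))), by positivity, fun Q hQ hQ₀ => ?_⟩
  have hQ1 : Q ≤ 1 := hQ₀.trans (min_le_left _ _)
  have hsmall : Q * C₁ * (c ^ 2)⁻¹ ≤ 1 / 2 := by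
    have := hQ₀.trans (min_le_right _ _)
    rw [le_div_iff₀ (by positivity)] at this
    linarith
  set v₀ : ℝ := (volume (Metric.closedBall (0 : Plane) r₀)).toReal with hv₀
  have hvt : volume (Metric.closedBall (0 : Plane) r₀) ≠ ⊤ := measure_closedBall_lt_top.ne
  have hv0 : 0 < v₀ :=
    ENNReal.toReal_pos (Metric.measure_closedBall_pos volume 0 hr₀).ne' hvt
  refine ⟨2 * (v₀⁻¹ ^ (Q / 2) + C₂ * c⁻¹), by positivity, ?_⟩
  intro E g h hg hh hg0 hh0 hE hg2 hRH
  set J := ∫⁻ x, ENNReal.ofReal (g x) ^ 2 with hJ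
  -- The threshold level: for `t > a`, a ball of radius at least `r₀` has area at least `v₀`, hence
  -- mean square below `t²`. This is what the stopping argument requires.
  set a : ℝ := Real.sqrt (J.toReal / v₀) with ha
  have ha0 : 0 ≤ a := Real.sqrt_nonneg _
  have hlev : ∀ t, a < t → ∫⁻ x, {x | t < g x}.indicator (fun x => ENNReal.ofReal (g x) ^ 2) x ≤
      ENNReal.ofReal (C₁ * t) * (∫⁻ x, {x | c * t < g x}.indicator (fun x => ENNReal.ofReal (g x)) x)
      + ENNReal.ofReal C₂ *
        ∫⁻ x, {x | c * t < h x}.indicator (fun x => ENNReal.ofReal (h x) ^ 2) x := by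
    intro t hat
    have ht0 : 0 < t := ha0.trans_lt hat
    have hbig : ∀ (x : Plane) (r : ℝ), r₀ ≤ r →
        ∫⁻ y in Metric.closedBall x r, ENNReal.ofReal (g y) ^ 2 <
        ENNReal.ofReal t ^ 2 * volume (Metric.closedBall x r) := by
      intro x r hr
      refine (setLIntegral_le_lintegral _ _).trans_lt ?_
      refine lt_of_lt_of_le (b := ENNReal.ofReal t ^ 2 * ENNReal.ofReal v₀) ?_ ?_
      · rw [← hJ, ← ENNReal.ofReal_toReal hg2, ← ENNReal.ofReal_pow ht0.le,
          ← ENNReal.ofReal_mul (by positivity), ENNReal.ofReal_lt_ofReal_iff (by positivity),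
          ← div_lt_iff₀ hv0]
        exact (Real.sqrt_lt' ht0).1 hat
      · gcongr
        rw [hv₀, ENNReal.ofReal_toReal hvt, ← Measure.addHaar_closedBall_center volume x]
        exact measure_mono (Metric.closedBall_subset_closedBall hr)
    have := superlevel_lintegral_sq_le (A := A) (k := k) (c := c) (L := t) (r₀ := r₀) hA hk hc ht0
      (g := fun x => ENNReal.ofReal (g x)) (h := fun x => ENNReal.ofReal (h x))
      (by fun_prop) hg2 (E := E) (fun x hx => by simp [hE x hx]) hRH hbig
    have e1 : ∀ (s : ℝ) (f : Plane → ℝ), (∀ x, 0 ≤ f x) → 0 ≤ s →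
        {x | ENNReal.ofReal s < ENNReal.ofReal (f x)} = {x | s < f x} := by
      intro s f hf hs
      ext x
      exact ENNReal.ofReal_lt_ofReal_iff_of_nonneg hs
    rw [e1 t g hg0 ht0.le, e1 (c * t) g hg0 (by positivity), e1 (c * t) h hh0 (by positivity),
      mul_add, ← mul_assoc, ← ENNReal.ofReal_mul (by positivity), ← mul_assoc, ← hC₁] at this
    exact this
  have htr : ∀ N : ℕ, ∫⁻ x, ENNReal.ofReal (g x) ^ 2 * ENNReal.ofReal ((min (g x) N) ^ Q) ≤
      2 * (ENNReal.ofReal (a ^ Q) * J +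
        ENNReal.ofReal (C₂ * c⁻¹) * ∫⁻ x, ENNReal.ofReal (h x ^ (2 + Q))) := fun N =>
    lintegral_truncated_le hC₁0.le hC₂0.le hc0 hc1 hQ hQ1 hsmall ha0 N.cast_nonneg hg hh hg0 hh0
      hg2 hlev
  -- The truncated bound does not depend on `N`, so monotone convergence removes the truncation.
  have hlim : Tendsto (fun N : ℕ => ∫⁻ x, ENNReal.ofReal (g x) ^ 2 *
      ENNReal.ofReal ((min (g x) N) ^ Q)) atTop
      (𝓝 (∫⁻ x, ENNReal.ofReal (g x) ^ 2 * ENNReal.ofReal ((g x) ^ Q))) := by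
    refine lintegral_tendsto_of_tendsto_of_monotone (fun N => by fun_prop) ?_ ?_
    · refine ae_of_all _ fun x N M hNM => ?_
      have := hg0 x
      have hNM' : (N : ℝ) ≤ M := by exact_mod_cast hNM
      dsimp only
      gcongr
    · refine ae_of_all _ fun x => tendsto_const_nhds.congr' ?_
      filter_upwards [eventually_ge_atTop ⌈g x⌉₊] with N hN
      rw [min_eq_left (Nat.ceil_le.1 hN)]
  have h1 := le_of_tendsto' hlim htr
  have hgp : ∀ x, ENNReal.ofReal (g x ^ (2 + Q)) =
      ENNReal.ofReal (g x) ^ 2 * ENNReal.ofReal ((g x) ^ Q) := by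
    intro x
    rw [← ENNReal.ofReal_pow (hg0 x), ← ENNReal.ofReal_mul (by have := hg0 x; positivity),
      Real.rpow_add' (hg0 x) (by linarith)]
    norm_num
  simp only [hgp]
  refine h1.trans ?_
  have haJ : ENNReal.ofReal (a ^ Q) * J = ENNReal.ofReal (v₀⁻¹ ^ (Q / 2)) * J ^ (1 + Q / 2) := by
    rw [← ENNReal.ofReal_toReal hg2, ENNReal.ofReal_rpow_of_nonneg ENNReal.toReal_nonneg
      (by positivity), ← ENNReal.ofReal_mul (by positivity), ← ENNReal.ofReal_mul (by positivity)]
    congr 1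
    rw [ha, Real.sqrt_eq_rpow, ← Real.rpow_mul (by positivity),
      show 1 / 2 * Q = Q / 2 by ring, div_eq_mul_inv,
      Real.mul_rpow ENNReal.toReal_nonneg (by positivity),
      Real.rpow_add' ENNReal.toReal_nonneg (by positivity), Real.rpow_one]
    ring
  have hS : ENNReal.ofReal (2 * (v₀⁻¹ ^ (Q / 2) + C₂ * c⁻¹))
      = 2 * ENNReal.ofReal (v₀⁻¹ ^ (Q / 2) + C₂ * c⁻¹) := by
    rw [ENNReal.ofReal_mul (by norm_num), ENNReal.ofReal_ofNat]
  rw [haJ, hS, mul_assoc 2]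
  refine mul_le_mul_right ?_ _
  rw [mul_add]
  gcongr
  · exact le_add_of_nonneg_right (by positivity)
  · exact le_add_of_nonneg_left (by positivity)

end RhombiSlits

namespace RhombiSlits

/-! ### Global inequalities for smooth functions -/

theorem ennreal_add_sq_le (a b : ENNReal) : (a + b) ^ 2 ≤ 2 * a ^ 2 + 2 * b ^ 2 := by
  have h := ENNReal.rpow_add_le_mul_rpow_add_rpow a b (p := 2) (by norm_num)
  norm_num at h
  rwa [mul_add] at h

section
variable {F : Type*} [NormedAddCommGroup F]

theorem lintegral_enorm_sq_le {X : Type*} [MeasurableSpace X] {μ : Measure X} (v : X → F) (c : F) :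
    ∫⁻ y, ‖v y‖ₑ ^ 2 ∂μ ≤ 2 * (∫⁻ y, ‖v y - c‖ₑ ^ 2 ∂μ) + 2 * ‖c‖ₑ ^ 2 * μ Set.univ := by
  calc ∫⁻ y, ‖v y‖ₑ ^ 2 ∂μ ≤ ∫⁻ y, (2 * ‖v y - c‖ₑ ^ 2 + 2 * ‖c‖ₑ ^ 2) ∂μ := by
        refine lintegral_mono fun y => ?_
        refine le_trans ?_ (ennreal_add_sq_le _ _)
        gcongr
        exact (congrArg enorm (sub_add_cancel (v y) c).symm).le.trans (enorm_add_le _ _)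
    _ = _ := by
        rw [lintegral_add_right _ measurable_const, lintegral_const,
          lintegral_const_mul' _ _ (by norm_num)]

theorem enorm_sq_mul_measure_le {X : Type*} [MeasurableSpace X] {μ : Measure X}
    (v : X → F) (hv : AEStronglyMeasurable v μ) (c : F) :
    ‖c‖ₑ ^ 2 * μ Set.univ ≤ 2 * (∫⁻ y, ‖v y - c‖ₑ ^ 2 ∂μ) + 2 * ∫⁻ y, ‖v y‖ₑ ^ 2 ∂μ := by
  calc ‖c‖ₑ ^ 2 * μ Set.univ = ∫⁻ _, ‖c‖ₑ ^ 2 ∂μ := (lintegral_const _).symm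
    _ ≤ ∫⁻ y, (2 * ‖v y - c‖ₑ ^ 2 + 2 * ‖v y‖ₑ ^ 2) ∂μ := by
        refine lintegral_mono fun y => ?_
        refine le_trans ?_ (ennreal_add_sq_le _ _)
        gcongr
        rw [enorm_sub_rev]
        exact (congrArg enorm (sub_add_cancel c (v y)).symm).le.trans (enorm_add_le _ _)
    _ = _ := by
        rw [lintegral_add_right' _ ((hv.enorm.pow_const 2).const_mul 2),
          lintegral_const_mul' _ _ (by norm_num), lintegral_const_mul' _ _ (by norm_num)]

theorem enorm_mul_measure_le {X : Type*} [MeasurableSpace X] {μ : Measure X}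
    (v : X → F) (hv : AEStronglyMeasurable v μ) (c : F) :
    ‖c‖ₑ * μ Set.univ ≤ (∫⁻ y, ‖v y - c‖ₑ ∂μ) + ∫⁻ y, ‖v y‖ₑ ∂μ := by
  rw [← lintegral_const, ← lintegral_add_right' _ hv.enorm]
  refine lintegral_mono fun y => ?_
  rw [enorm_sub_rev]
  exact (congrArg enorm (sub_add_cancel c (v y)).symm).le.trans (enorm_add_le _ _)

end

/-- Locally, arc length is dominated by Lebesgue measure on a bounded interval through the
projection onto `perp e`; compactness concludes. -/
theorem measure_frontier_lt_top {Ω : Set Plane} (hΩ : IsPolygonalDomain Ω) :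
    (Measure.hausdorffMeasure 1 : Measure Plane) (frontier Ω) < ⊤ := by
  obtain ⟨ρ, hρ, hρ1, hU⟩ := exists_uniformCone hΩ
  have hcpt : IsCompact (frontier Ω) :=
    hΩ.isBounded.isCompact_closure.of_isClosed_subset isClosed_frontier frontier_subset_closure
  refine hcpt.measure_lt_top_of_nhdsWithin fun x hx => ?_
  obtain ⟨e, he, hcone⟩ := hU x (frontier_subset_closure hx)
  refine ⟨frontier Ω ∩ Metric.ball x (ρ / 2), inter_mem_nhdsWithin _
    (Metric.ball_mem_nhds x (by positivity)), ?_⟩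
  have hmap := UniformCone.map_arc_le hρ hρ1 hΩ.isOpen he hcone
  set π : Plane → ℝ := fun y => inner ℝ (perp e) y with hπ
  have hπm : Measurable π := by fun_prop
  set J := Metric.closedBall (π x) (ρ / 2) with hJ
  have hSm : MeasurableSet (frontier Ω ∩ Metric.ball x (ρ / 2)) :=
    isClosed_frontier.measurableSet.inter measurableSet_ball
  have hsub : frontier Ω ∩ Metric.ball x (ρ / 2) ⊆ π ⁻¹' J := by
    rintro y ⟨-, hy⟩
    rw [Set.mem_preimage, hJ, Metric.mem_closedBall, Real.dist_eq, hπ]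
    simp only
    rw [← inner_sub_right]
    refine (abs_real_inner_le_norm _ _).trans ?_
    rw [norm_perp, he, one_mul, ← dist_eq_norm]
    exact (Metric.mem_ball.1 hy).le
  have h1 := hmap J
  rw [Measure.map_apply hπm measurableSet_closedBall,
    Measure.restrict_apply (hπm measurableSet_closedBall), Set.inter_eq_right.2 hsub] at h1
  refine h1.trans_lt ?_
  rw [Measure.smul_apply, smul_eq_mul]
  exact ENNReal.mul_lt_top ENNReal.ofReal_lt_top measure_closedBall_lt_top

/-- Local inequalities, at all small scales: oscillation bound at arbitrary points, and bound of the
function itself near `D`. -/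
theorem exists_local_poincare {Ω D : Set Plane} (hΩ : IsPolygonalDomain Ω)
    (hD : IsDirichletPart Ω D) :
    ∃ (K R : ℝ) (C : NNReal), 1 ≤ K ∧ 0 < R ∧ ∀ x ∈ closure Ω, ∀ r : ℝ, 0 < r → r ≤ R →
      ∀ v : Plane → ℂ, ContDiff ℝ 1 v →
        (∃ c : ℂ, ∫⁻ y in Ω ∩ Metric.ball x r, ‖v y - c‖ₑ ^ 2
            ≤ C * (∫⁻ y in Ω ∩ Metric.ball x (K * r), ‖fderiv ℝ v y‖ₑ) ^ 2) ∧
        ((D ∩ Metric.closedBall x r).Nonempty → ∫⁻ y in Ω ∩ Metric.ball x r, ‖v y‖ₑ ^ 2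
            ≤ C * ((∫⁻ y in Ω ∩ Metric.ball x (K * r), ‖fderiv ℝ v y‖ₑ)
              + ∫⁻ y in D ∩ Metric.ball x (K * r), ‖v y‖ₑ ∂(Measure.hausdorffMeasure 1)) ^ 2) := by
  obtain ⟨ρ, hρ, hρ1, hU⟩ := exists_uniformCone hΩ
  obtain ⟨K, C, hK, hC, h⟩ := exists_local_sobolev hρ hρ1 hΩ.isOpen hU ℂ
  obtain ⟨c₀, hc₀, hdens⟩ := hD.density
  set V : ENNReal := volume (Metric.ball (0 : Plane) 1) with hV
  have hVt : V ≠ ⊤ := measure_ball_lt_top.ne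
  set C' : ENNReal := 2 * ENNReal.ofReal C +
    2 * (ENNReal.ofReal c₀⁻¹ * (ENNReal.ofReal C + 1)) ^ 2 * V with hC'
  have hC't : C' ≠ ⊤ := by
    rw [hC']; finiteness
  have hCC' : ENNReal.ofReal C ≤ C' := by
    rw [hC', two_mul, add_assoc]; exact le_self_add
  refine ⟨K * 3, ρ ^ 2 / 18, C'.toNNReal, by linarith, by positivity, ?_⟩
  intro x hx r hr hrρ v hv
  rw [ENNReal.coe_toNNReal hC't]
  -- Radius `3r` leaves room for the ball of radius `r` about a point of `D` which itself lies only
  -- within distance `r` of `x`.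
  obtain ⟨z, -, hz⟩ := h x hx (3 * r) (by positivity) (by linarith)
  obtain ⟨c, -, hc1, hc2⟩ := hz v hv
  rw [← mul_assoc] at hc1 hc2
  set I := ∫⁻ y in Ω ∩ Metric.ball x (K * 3 * r), ‖fderiv ℝ v y‖ₑ with hI
  have hsm : ∫⁻ y in Ω ∩ Metric.ball x r, ‖v y - c‖ₑ ^ 2 ≤ ENNReal.ofReal C * I ^ 2 :=
    (lintegral_mono_set (Set.inter_subset_inter_right _
      (Metric.ball_subset_ball (by linarith)))).trans hc1
  refine ⟨⟨c, hsm.trans (by gcongr)⟩, ?_⟩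
  rintro ⟨y₀, hy₀D, hy₀x⟩
  set J := ∫⁻ y in D ∩ Metric.ball x (K * 3 * r), ‖v y‖ₑ ∂(Measure.hausdorffMeasure 1) with hJ
  have hDm : MeasurableSet D := hD.isClosed.measurableSet
  have hmeas : ENNReal.ofReal (c₀ * r) ≤
      (Measure.hausdorffMeasure 1 : Measure Plane) (D ∩ Metric.ball x (3 * r)) := by
    refine (hdens y₀ hy₀D r hr (by nlinarith)).trans ?_
    rw [Measure.restrict_apply measurableSet_closedBall, Set.inter_comm]
    refine measure_mono (Set.inter_subset_inter_right _ fun y hy => ?_)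
    rw [Metric.mem_closedBall] at hy hy₀x
    rw [Metric.mem_ball]
    linarith [dist_triangle y y₀ x]
  -- The boundary oscillation bound compares `c` with the values of `v` on a part of `D` of length
  -- at least `c₀r`. It controls `‖c‖r`, and `(‖c‖r)²` is the scale of `∫ ‖c‖²` over a ball of
  -- radius `r`.
  have hc3 : ENNReal.ofReal (c₀ * r) * ‖c‖ₑ ≤ (ENNReal.ofReal C + 1) * (I + J) := by
    have h1 := enorm_mul_measure_le (μ := arc (D ∩ Metric.ball x (3 * r))) v
      hv.continuous.aestronglyMeasurable c
    rw [Measure.restrict_apply_univ] at h1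
    calc ENNReal.ofReal (c₀ * r) * ‖c‖ₑ ≤ ‖c‖ₑ *
          (Measure.hausdorffMeasure 1 : Measure Plane) (D ∩ Metric.ball x (3 * r)) := by
          rw [mul_comm]; gcongr
      _ ≤ _ := h1
      _ ≤ ENNReal.ofReal C * I + J := by
          refine add_le_add (le_trans ?_ hc2) ?_
          · exact lintegral_mono_set (Set.inter_subset_inter_left _ hD.subset)
          · exact lintegral_mono_set (Set.inter_subset_inter_right _
              (Metric.ball_subset_ball (by nlinarith)))
      _ ≤ ENNReal.ofReal C * I + J + (ENNReal.ofReal C * J + I) := le_self_add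
      _ = _ := by ring
  have hc4 : ‖c‖ₑ * ENNReal.ofReal r ≤ ENNReal.ofReal c₀⁻¹ * (ENNReal.ofReal C + 1) * (I + J) := by
    calc ‖c‖ₑ * ENNReal.ofReal r = ENNReal.ofReal c₀⁻¹ * (ENNReal.ofReal (c₀ * r) * ‖c‖ₑ) := by
          rw [← mul_assoc, ← ENNReal.ofReal_mul (by positivity), mul_comm]
          congr 2; field_simp
      _ ≤ _ := by
          rw [mul_assoc]; gcongr
  have hvol : volume (Ω ∩ Metric.ball x r) ≤ ENNReal.ofReal r ^ 2 * V := by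
    refine (measure_mono Set.inter_subset_right).trans_eq ?_
    rw [Measure.addHaar_ball volume x hr.le]
    simp [hV, ENNReal.ofReal_pow hr.le]
  calc ∫⁻ y in Ω ∩ Metric.ball x r, ‖v y‖ₑ ^ 2
      ≤ 2 * (∫⁻ y in Ω ∩ Metric.ball x r, ‖v y - c‖ₑ ^ 2) +
          2 * ‖c‖ₑ ^ 2 * volume (Ω ∩ Metric.ball x r) := by
        have := lintegral_enorm_sq_le (μ := volume.restrict (Ω ∩ Metric.ball x r)) v c
        rwa [Measure.restrict_apply_univ] at this
    _ ≤ 2 * (ENNReal.ofReal C * I ^ 2) + 2 * ‖c‖ₑ ^ 2 * (ENNReal.ofReal r ^ 2 * V) := by gcongr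
    _ = 2 * ENNReal.ofReal C * I ^ 2 + 2 * (‖c‖ₑ * ENNReal.ofReal r) ^ 2 * V := by ring
    _ ≤ 2 * ENNReal.ofReal C * (I + J) ^ 2 + 2 * (ENNReal.ofReal c₀⁻¹ *
          (ENNReal.ofReal C + 1) * (I + J)) ^ 2 * V := by
        gcongr
        exact le_self_add
    _ = C' * (I + J) ^ 2 := by rw [hC']; ring

/-- The Friedrichs inequality. -/
theorem exists_friedrichs {Ω D : Set Plane} (hΩ : IsPolygonalDomain Ω)
    (hD : IsDirichletPart Ω D) :
    ∃ C : NNReal, ∀ v : Plane → ℂ, ContDiff ℝ 1 v →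
      ∫⁻ y in Ω, ‖v y‖ₑ ^ 2 ≤ C * ((∫⁻ y in Ω, ‖fderiv ℝ v y‖ₑ) + ∫⁻ y, ‖v y‖ₑ ∂arc D) ^ 2 := by
  obtain ⟨K, R, C, hK, hR, h⟩ := exists_local_poincare hΩ hD
  set N : (Plane → ℂ) → ENNReal := fun v => (∫⁻ y in Ω, ‖fderiv ℝ v y‖ₑ) + ∫⁻ y, ‖v y‖ₑ ∂arc D
    with hN
  -- The points near which the inequality holds. Instead of a compactness argument by contradiction,
  -- connectedness of `Ω` propagates the estimate from `D`: this set is open, contains its limit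
  -- points from `Ω`, and contains `D`.
  set S : Set Plane := {x | ∃ r : ℝ, 0 < r ∧ ∃ C : NNReal, ∀ v : Plane → ℂ, ContDiff ℝ 1 v →
    ∫⁻ y in Ω ∩ Metric.ball x r, ‖v y‖ₑ ^ 2 ≤ C * N v ^ 2} with hS
  have hIN : ∀ (v : Plane → ℂ) (x : Plane) (r : ℝ),
      ∫⁻ y in Ω ∩ Metric.ball x r, ‖fderiv ℝ v y‖ₑ ≤ N v := fun v x r =>
    (lintegral_mono_set Set.inter_subset_left).trans le_self_add
  have hSopen : IsOpen S := by
    refine Metric.isOpen_iff.2 ?_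
    rintro x ⟨r, hr, C, hC⟩
    refine ⟨r / 2, by positivity, fun y hy => ⟨r / 2, by positivity, C, fun v hv => ?_⟩⟩
    refine (lintegral_mono_set (Set.inter_subset_inter_right _ fun z hz => ?_)).trans (hC v hv)
    rw [Metric.mem_ball] at hy hz ⊢
    linarith [dist_triangle z y x]
  have hclosed : ∀ x ∈ closure Ω, x ∈ closure (S ∩ Ω) → x ∈ S := by
    intro x hx hxS
    -- A small ball about `y` lies both in the good neighbourhood of `y` and in the ball of the
    -- fixed radius `R` about `x`. There `v` and `v - c` are both controlled, which bounds `c` and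
    -- hence `v` on the larger ball.
    obtain ⟨y, ⟨⟨r, hr, C₁, hC₁⟩, hyΩ⟩, hyx⟩ := Metric.mem_closure_iff.1 hxS R hR
    obtain ⟨s, hs, hsub⟩ := Metric.isOpen_iff.1
      ((hΩ.isOpen.inter Metric.isOpen_ball).inter Metric.isOpen_ball) y
      (show y ∈ (Ω ∩ Metric.ball x R) ∩ Metric.ball y r from
        ⟨⟨hyΩ, by rwa [Metric.mem_ball, dist_comm]⟩, Metric.mem_ball_self hr⟩)
    set m := volume (Metric.ball y s) with hm
    have hm0 : m ≠ 0 := (Metric.measure_ball_pos volume y hs).ne'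
    have hmt : m ≠ ⊤ := measure_ball_lt_top.ne
    have hBt : volume (Metric.ball x R) ≠ ⊤ := measure_ball_lt_top.ne
    set C₂ : ENNReal := 2 * C + 2 * (m⁻¹ * (2 * C + 2 * C₁)) * volume (Metric.ball x R) with hC₂
    have hC₂t : C₂ ≠ ⊤ := by
      have : m⁻¹ ≠ ⊤ := ENNReal.inv_ne_top.2 hm0
      rw [hC₂]; finiteness
    refine ⟨R, hR, C₂.toNNReal, fun v hv => ?_⟩
    rw [ENNReal.coe_toNNReal hC₂t]
    obtain ⟨⟨c, hc⟩, -⟩ := h x hx R hR le_rfl v hv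
    have hc' : ∫⁻ y in Ω ∩ Metric.ball x R, ‖v y - c‖ₑ ^ 2 ≤ C * N v ^ 2 :=
      hc.trans (by gcongr; exact hIN _ _ _)
    have hcm : ‖c‖ₑ ^ 2 ≤ m⁻¹ * (2 * C + 2 * C₁) * N v ^ 2 := by
      have h1 := enorm_sq_mul_measure_le (μ := volume.restrict (Metric.ball y s)) v
        hv.continuous.aestronglyMeasurable c
      rw [Measure.restrict_apply_univ, ← hm] at h1
      have h2 : ‖c‖ₑ ^ 2 * m ≤ (2 * C + 2 * C₁) * N v ^ 2 := by
        refine h1.trans ?_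
        calc _ ≤ 2 * (C * N v ^ 2) + 2 * (C₁ * N v ^ 2) := by
              gcongr 2 * ?_ + 2 * ?_
              · exact (lintegral_mono_set (hsub.trans Set.inter_subset_left)).trans hc'
              · exact (lintegral_mono_set (show Metric.ball y s ⊆ Ω ∩ Metric.ball y r from
                  fun z hz => ⟨(hsub hz).1.1, (hsub hz).2⟩)).trans (hC₁ v hv)
          _ = _ := by ring
      calc ‖c‖ₑ ^ 2 = m⁻¹ * (‖c‖ₑ ^ 2 * m) := by
            rw [mul_left_comm, ENNReal.inv_mul_cancel hm0 hmt, mul_one]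
        _ ≤ _ := by rw [mul_assoc]; gcongr
    calc ∫⁻ y in Ω ∩ Metric.ball x R, ‖v y‖ₑ ^ 2
        ≤ 2 * (∫⁻ y in Ω ∩ Metric.ball x R, ‖v y - c‖ₑ ^ 2) +
          2 * ‖c‖ₑ ^ 2 * volume (Ω ∩ Metric.ball x R) := by
          have := lintegral_enorm_sq_le (μ := volume.restrict (Ω ∩ Metric.ball x R)) v c
          rwa [Measure.restrict_apply_univ] at this
      _ ≤ 2 * (C * N v ^ 2) + 2 * (m⁻¹ * (2 * C + 2 * C₁) * N v ^ 2) * volume (Metric.ball x R) := by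
          gcongr
          exact Set.inter_subset_right
      _ = _ := by rw [hC₂]; ring
  have hne : (Ω ∩ S).Nonempty := by
    obtain ⟨x₀, hx₀⟩ := hD.nonempty
    have hx₀c : x₀ ∈ closure Ω := frontier_subset_closure (hD.subset hx₀)
    have hx₀S : x₀ ∈ S := by
      refine ⟨R, hR, C, fun v hv => ?_⟩
      refine ((h x₀ hx₀c R hR le_rfl v hv).2 ⟨x₀, hx₀, Metric.mem_closedBall_self hR.le⟩).trans ?_
      gcongr
      exact add_le_add (lintegral_mono_set Set.inter_subset_left)
        (lintegral_mono_set Set.inter_subset_left)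
    obtain ⟨y, hyS, hyΩ⟩ := mem_closure_iff.1 hx₀c S hSopen hx₀S
    exact ⟨y, hyΩ, hyS⟩
  have hΩS : Ω ⊆ S := by
    refine hΩ.isConnected.isPreconnected.subset_of_closure_inter_subset hSopen hne ?_
    rintro x ⟨hxS, hxΩ⟩
    exact hclosed x (subset_closure hxΩ) (hΩ.isOpen.closure_inter ⟨hxS, hxΩ⟩)
  have hcS : closure Ω ⊆ S := fun x hx => hclosed x hx (by rwa [Set.inter_eq_right.2 hΩS])
  have hfin : ∃ C : NNReal, ∀ v : Plane → ℂ, ContDiff ℝ 1 v →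
      ∫⁻ y in Ω ∩ closure Ω, ‖v y‖ₑ ^ 2 ≤ C * N v ^ 2 := by
    refine hΩ.isBounded.isCompact_closure.induction_on (p := fun T => ∃ C : NNReal,
      ∀ v : Plane → ℂ, ContDiff ℝ 1 v → ∫⁻ y in Ω ∩ T, ‖v y‖ₑ ^ 2 ≤ C * N v ^ 2) ?_ ?_ ?_ ?_
    · exact ⟨0, fun v _ => by simp⟩
    · rintro s t hst ⟨C, hC⟩
      exact ⟨C, fun v hv => (lintegral_mono_set (Set.inter_subset_inter_right _ hst)).trans
        (hC v hv)⟩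
    · rintro s t ⟨C, hC⟩ ⟨C', hC'⟩
      refine ⟨C + C', fun v hv => ?_⟩
      rw [Set.inter_union_distrib_left, ENNReal.coe_add, add_mul]
      exact (lintegral_union_le _ _ _).trans (add_le_add (hC v hv) (hC' v hv))
    · intro x hx
      obtain ⟨r, hr, C, hC⟩ := hcS hx
      exact ⟨Metric.ball x r, mem_nhdsWithin_of_mem_nhds (Metric.ball_mem_nhds x hr), C, hC⟩
  obtain ⟨C, hC⟩ := hfin
  refine ⟨C, fun v hv => ?_⟩
  have := hC v hv
  rwa [Set.inter_eq_left.2 subset_closure] at this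

/-- `W^{1,1}(Ω)` embeds into `L²(Ω)` and has traces in `L¹(∂Ω)`. -/
theorem exists_sobolev_trace {Ω : Set Plane} (hΩ : IsPolygonalDomain Ω) :
    ∃ C : NNReal, ∀ v : Plane → ℝ, ContDiff ℝ 1 v →
      ∫⁻ y in Ω, ‖v y‖ₑ ^ 2 ≤ C * ((∫⁻ y in Ω, ‖fderiv ℝ v y‖ₑ) + ∫⁻ y in Ω, ‖v y‖ₑ) ^ 2 ∧
      ∫⁻ y, ‖v y‖ₑ ∂arc (frontier Ω)
        ≤ C * ((∫⁻ y in Ω, ‖fderiv ℝ v y‖ₑ) + ∫⁻ y in Ω, ‖v y‖ₑ) := by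
  obtain ⟨ρ, hρ, hρ1, hU⟩ := exists_uniformCone hΩ
  obtain ⟨K, C, hK, hC, h⟩ := exists_local_sobolev hρ hρ1 hΩ.isOpen hU ℝ
  set N : (Plane → ℝ) → ENNReal := fun v => (∫⁻ y in Ω, ‖fderiv ℝ v y‖ₑ) + ∫⁻ y in Ω, ‖v y‖ₑ with hN
  set M := (Measure.hausdorffMeasure 1 : Measure Plane) (frontier Ω) with hM
  have hMt : M ≠ ⊤ := (measure_frontier_lt_top hΩ).ne
  have hfin : ∃ C : NNReal, ∀ v : Plane → ℝ, ContDiff ℝ 1 v →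
      ∫⁻ y in Ω ∩ closure Ω, ‖v y‖ₑ ^ 2 ≤ C * N v ^ 2 ∧
      ∫⁻ y in frontier Ω ∩ closure Ω, ‖v y‖ₑ ∂(Measure.hausdorffMeasure 1) ≤ C * N v := by
    refine hΩ.isBounded.isCompact_closure.induction_on (p := fun T => ∃ C : NNReal,
      ∀ v : Plane → ℝ, ContDiff ℝ 1 v → ∫⁻ y in Ω ∩ T, ‖v y‖ₑ ^ 2 ≤ C * N v ^ 2 ∧
        ∫⁻ y in frontier Ω ∩ T, ‖v y‖ₑ ∂(Measure.hausdorffMeasure 1) ≤ C * N v) ?_ ?_ ?_ ?_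
    · exact ⟨0, fun v _ => by simp⟩
    · rintro s t hst ⟨C, hC⟩
      exact ⟨C, fun v hv => ⟨(lintegral_mono_set (Set.inter_subset_inter_right _ hst)).trans
        (hC v hv).1, (lintegral_mono_set (Set.inter_subset_inter_right _ hst)).trans
        (hC v hv).2⟩⟩
    · rintro s t ⟨C, hC⟩ ⟨C', hC'⟩
      refine ⟨C + C', fun v hv => ?_⟩
      rw [Set.inter_union_distrib_left, Set.inter_union_distrib_left, ENNReal.coe_add, add_mul,
        add_mul]
      exact ⟨(lintegral_union_le _ _ _).trans (add_le_add (hC v hv).1 (hC' v hv).1),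
        (lintegral_union_le _ _ _).trans (add_le_add (hC v hv).2 (hC' v hv).2)⟩
    · intro x hx
      set r := ρ ^ 2 / 6 with hr
      have hr0 : 0 < r := by positivity
      obtain ⟨z, -, hz⟩ := h x hx r hr0 le_rfl
      set m := volume (Metric.ball x r) with hm
      have hm0 : m ≠ 0 := (Metric.measure_ball_pos volume x hr0).ne'
      have hmt : m ≠ ⊤ := measure_ball_lt_top.ne
      have hmi : m⁻¹ ≠ ⊤ := ENNReal.inv_ne_top.2 hm0
      set C₂ : ENNReal := (2 * ENNReal.ofReal C + 2 * m⁻¹ ^ 2 * m) +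
        (ENNReal.ofReal C + m⁻¹ * M) with hC₂
      have hC₂t : C₂ ≠ ⊤ := by rw [hC₂]; finiteness
      refine ⟨Metric.ball x r, mem_nhdsWithin_of_mem_nhds (Metric.ball_mem_nhds x hr0),
        C₂.toNNReal, fun v hv => ?_⟩
      rw [ENNReal.coe_toNNReal hC₂t]
      obtain ⟨c, hc, hc1, hc2⟩ := hz v hv
      have hI : ∫⁻ y in Ω ∩ Metric.ball x (K * r), ‖fderiv ℝ v y‖ₑ ≤ N v :=
        (lintegral_mono_set Set.inter_subset_left).trans le_self_add
      -- Without a Dirichlet condition, the constant is controlled by the mean of `‖v‖`, hence by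
      -- its `L¹` norm.
      have hc' : ‖c‖ₑ ≤ m⁻¹ * N v := by
        refine hc.trans ?_
        gcongr
        exact (lintegral_mono_set Set.inter_subset_left).trans le_add_self
      constructor
      · calc ∫⁻ y in Ω ∩ Metric.ball x r, ‖v y‖ₑ ^ 2
            ≤ 2 * (∫⁻ y in Ω ∩ Metric.ball x r, ‖v y - c‖ₑ ^ 2) +
              2 * ‖c‖ₑ ^ 2 * volume (Ω ∩ Metric.ball x r) := by
              have := lintegral_enorm_sq_le (μ := volume.restrict (Ω ∩ Metric.ball x r)) v c
              rwa [Measure.restrict_apply_univ] at this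
          _ ≤ 2 * (ENNReal.ofReal C * N v ^ 2) + 2 * (m⁻¹ * N v) ^ 2 * m := by
              gcongr
              · exact hc1.trans (by gcongr)
              · exact measure_mono Set.inter_subset_right
          _ = (2 * ENNReal.ofReal C + 2 * m⁻¹ ^ 2 * m) * N v ^ 2 := by ring
          _ ≤ _ := by
              gcongr
              rw [hC₂]; exact le_self_add
      · calc ∫⁻ y in frontier Ω ∩ Metric.ball x r, ‖v y‖ₑ ∂(Measure.hausdorffMeasure 1)
            ≤ ∫⁻ y in frontier Ω ∩ Metric.ball x r, (‖v y - c‖ₑ + ‖c‖ₑ)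
                ∂(Measure.hausdorffMeasure 1) := by
              refine lintegral_mono fun y => ?_
              exact (congrArg enorm (sub_add_cancel (v y) c).symm).le.trans (enorm_add_le _ _)
          _ = (∫⁻ y in frontier Ω ∩ Metric.ball x r, ‖v y - c‖ₑ ∂(Measure.hausdorffMeasure 1)) +
              ‖c‖ₑ * (Measure.hausdorffMeasure 1 : Measure Plane)
                (frontier Ω ∩ Metric.ball x r) := by
              rw [lintegral_add_right _ measurable_const, lintegral_const,
                Measure.restrict_apply_univ]
          _ ≤ ENNReal.ofReal C * N v + m⁻¹ * N v * M := by
              gcongr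
              · exact hc2.trans (by gcongr)
              · exact measure_mono Set.inter_subset_left
          _ = (ENNReal.ofReal C + m⁻¹ * M) * N v := by ring
          _ ≤ _ := by
              gcongr
              rw [hC₂]; exact le_add_self
  obtain ⟨C, hC⟩ := hfin
  refine ⟨C, fun v hv => ?_⟩
  have := hC v hv
  rwa [Set.inter_eq_left.2 subset_closure, Set.inter_eq_left.2 frontier_subset_closure] at this

end RhombiSlits

/-! ### Powers of smooth functions: the `L²` trace inequality and the Sobolev inequality. -/

namespace RhombiSlits

/-- Even powers are used because `‖φ‖²` stays differentiable at the zeros of `φ`; this is why the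
Sobolev exponents have the form `4k`. -/
theorem contDiff_norm_pow_even {φ : Plane → ℂ} (hφ : ContDiff ℝ 1 φ) (j : ℕ) :
    ContDiff ℝ 1 fun x => ‖φ x‖ ^ (2 * j) := by
  simp only [pow_mul]
  exact (hφ.norm_sq ℝ).pow j

theorem enorm_fderiv_norm_pow_even_le {φ : Plane → ℂ} (hφ : ContDiff ℝ 1 φ) (j : ℕ) (x : Plane) :
    ‖fderiv ℝ (fun x => ‖φ x‖ ^ (2 * (j + 1))) x‖ₑ
      ≤ (2 * (j + 1) : ℕ) * (‖fderiv ℝ φ x‖ₑ * ‖φ x‖ₑ ^ (2 * j + 1)) := by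
  have hd : HasFDerivAt φ (fderiv ℝ φ x) x := (hφ.differentiable (by norm_num) x).hasFDerivAt
  have h1 := (hd.norm_sq).pow (j + 1)
  have he : (fun x => ‖φ x‖ ^ (2 * (j + 1))) = fun x => (‖φ x‖ ^ 2) ^ (j + 1) := by
    ext y; rw [pow_mul]
  have h2 := h1.fderiv
  have hreal : ‖fderiv ℝ (fun x => ‖φ x‖ ^ (2 * (j + 1))) x‖
      ≤ (2 * (j + 1) : ℕ) * (‖fderiv ℝ φ x‖ * ‖φ x‖ ^ (2 * j + 1)) := by
    rw [he]
    refine (congrArg norm h2).le.trans ?_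
    have h3 : ‖(innerSL ℝ (φ x)).comp (fderiv ℝ φ x)‖ ≤ ‖φ x‖ * ‖fderiv ℝ φ x‖ := by
      refine (ContinuousLinearMap.opNorm_comp_le _ _).trans ?_
      rw [innerSL_apply_norm]
    have h4 : ‖(j + 1) • (‖φ x‖ ^ 2) ^ (j + 1 - 1)‖ = ((j : ℝ) + 1) * (‖φ x‖ ^ 2) ^ j := by
      rw [Nat.add_sub_cancel, nsmul_eq_mul, Real.norm_of_nonneg (by positivity)]
      push_cast
      ring
    have h5 : ‖2 • (innerSL ℝ (φ x)).comp (fderiv ℝ φ x)‖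
        ≤ 2 * (‖φ x‖ * ‖fderiv ℝ φ x‖) := by
      refine norm_nsmul_le.trans ?_
      push_cast
      linarith
    rw [norm_smul, h4]
    push_cast
    calc _ ≤ ((j : ℝ) + 1) * (‖φ x‖ ^ 2) ^ j * (2 * (‖φ x‖ * ‖fderiv ℝ φ x‖)) := by gcongr
      _ = _ := by rw [← pow_mul]; ring
  rw [← ofReal_norm, ← ofReal_norm, ← ofReal_norm, ← ENNReal.ofReal_pow (norm_nonneg _),
    ← ENNReal.ofReal_mul (norm_nonneg _), ← ENNReal.ofReal_natCast,
    ← ENNReal.ofReal_mul (by positivity)]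
  exact ENNReal.ofReal_le_ofReal hreal

/-- The trace inequality in `L²`. -/
theorem exists_trace_bound {Ω : Set Plane} (hΩ : IsPolygonalDomain Ω) :
    ∃ C : NNReal, ∀ φ : Plane → ℂ, ContDiff ℝ 1 φ →
      ∫⁻ y, ‖φ y‖ₑ ^ 2 ∂arc (frontier Ω)
        ≤ C * ((∫⁻ y in Ω, ‖φ y‖ₑ ^ 2) + ∫⁻ y in Ω, ‖fderiv ℝ φ y‖ₑ ^ 2) := by
  obtain ⟨C, hC⟩ := exists_sobolev_trace hΩ
  refine ⟨2 * C, fun φ hφ => ?_⟩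
  -- The `L¹` trace inequality applied to `‖φ‖²`, whose gradient is at most `2‖φ‖‖∇φ‖`.
  have h1 := (hC _ (contDiff_norm_pow_even hφ 1)).2
  have he : ∀ y, ‖‖φ y‖ ^ (2 * 1)‖ₑ = ‖φ y‖ₑ ^ 2 := fun y => by
    rw [enorm_pow, enorm_norm]
  simp only [he] at h1
  refine h1.trans ?_
  push_cast
  rw [mul_comm 2 (C : ENNReal), mul_assoc]
  refine mul_le_mul_right ?_ _
  have hd : Continuous (fderiv ℝ φ) := hφ.continuous_fderiv (by norm_num)
  have hc := hφ.continuous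
  calc _ ≤ (∫⁻ y in Ω, (‖φ y‖ₑ ^ 2 + ‖fderiv ℝ φ y‖ₑ ^ 2)) + ∫⁻ y in Ω, ‖φ y‖ₑ ^ 2 := by
        refine add_le_add (lintegral_mono fun y => ?_) le_rfl
        refine (enorm_fderiv_norm_pow_even_le hφ 0 y).trans ?_
        norm_num
        rw [← ofReal_norm, ← ofReal_norm, ← ENNReal.ofReal_pow (norm_nonneg _),
          ← ENNReal.ofReal_pow (norm_nonneg _), ← ENNReal.ofReal_mul (norm_nonneg _),
          ← ENNReal.ofReal_add (by positivity) (by positivity),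
          two_mul, ← ENNReal.ofReal_add (by positivity) (by positivity)]
        refine ENNReal.ofReal_le_ofReal ?_
        nlinarith [sq_nonneg (‖φ y‖ - ‖fderiv ℝ φ y‖)]
    _ ≤ 2 * ((∫⁻ y in Ω, ‖φ y‖ₑ ^ 2) + ∫⁻ y in Ω, ‖fderiv ℝ φ y‖ₑ ^ 2) := by
        rw [lintegral_add_left (by fun_prop), two_mul]
        exact add_le_add le_rfl le_self_add

/-- The Sobolev inequality `‖φ‖_{4k} ≤ C (‖∇φ‖_q + ‖φ‖_q)`, `q = 4k / (2k + 1)`. -/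
theorem exists_sobolev_bound {Ω : Set Plane} (hΩ : IsPolygonalDomain Ω) {k : ℕ} (hk : 0 < k)
    {p q : ℝ} (hp : p = 4 * k / (2 * k - 1)) (hpq : p.HolderConjugate q) :
    ∃ C : NNReal, ∀ φ : Plane → ℂ, ContDiff ℝ 1 φ →
      eLpNorm φ (4 * k : ℕ) (volume.restrict Ω) ≤ C * (eLpNorm (fderiv ℝ φ) (ENNReal.ofReal q)
        (volume.restrict Ω) + eLpNorm φ (ENNReal.ofReal q) (volume.restrict Ω)) := by
  obtain ⟨C, hC⟩ := exists_sobolev_trace hΩ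
  have hk1 : (1 : ℝ) ≤ k := by exact_mod_cast hk
  set C' : ENNReal := (C : ENNReal) ^ (1 / 2 : ℝ) * (2 * k : ℕ) with hC'
  have hC't : C' ≠ ⊤ := by
    rw [hC']
    exact ENNReal.mul_ne_top (ENNReal.rpow_ne_top_of_nonneg (by norm_num) ENNReal.coe_ne_top)
      (ENNReal.natCast_ne_top _)
  refine ⟨C'.toNNReal, fun φ hφ => ?_⟩
  rw [ENNReal.coe_toNNReal hC't]
  have hq0 : 0 < q := hpq.symm.pos
  have hp0 : 0 < p := hpq.pos
  have hqE : ENNReal.ofReal q ≠ 0 := by simpa using hq0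
  have hkE : ((4 * k : ℕ) : ENNReal) ≠ 0 := by
    rw [Nat.cast_ne_zero]; omega
  rw [eLpNorm_eq_lintegral_rpow_enorm_toReal hkE (ENNReal.natCast_ne_top _),
    eLpNorm_eq_lintegral_rpow_enorm_toReal hqE ENNReal.ofReal_ne_top,
    eLpNorm_eq_lintegral_rpow_enorm_toReal hqE ENNReal.ofReal_ne_top,
    ENNReal.toReal_ofReal hq0.le, ENNReal.toReal_natCast]
  set A := (∫⁻ x in Ω, ‖fderiv ℝ φ x‖ₑ ^ q) ^ (1 / q) with hA
  set B := (∫⁻ x in Ω, ‖φ x‖ₑ ^ q) ^ (1 / q) with hB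
  set I := ∫⁻ x in Ω, ‖φ x‖ₑ ^ ((4 * k : ℕ) : ℝ) with hI
  obtain ⟨j, rfl⟩ : ∃ j, k = j + 1 := ⟨k - 1, by omega⟩
  have hd : Continuous (fderiv ℝ φ) := hφ.continuous_fderiv (by norm_num)
  have hc := hφ.continuous
  -- The embedding of `W^{1,1}` into `L²` is applied to `‖φ‖^{2k}`, whose gradient carries
  -- `‖φ‖^{2k-1}`. The Hölder exponent `p` satisfies `(2k - 1)p = 4k`, so that this power reproduces
  -- `I`.
  have hexp : ((2 * j + 1 : ℕ) : ℝ) * p = ((4 * (j + 1) : ℕ) : ℝ) := by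
    rw [hp]; push_cast; push_cast at hk1
    have : (2 * ((j : ℝ) + 1) - 1) ≠ 0 := by linarith
    field_simp
    ring
  have hpow : ∀ x, (‖φ x‖ₑ ^ (2 * j + 1)) ^ p = ‖φ x‖ₑ ^ ((4 * (j + 1) : ℕ) : ℝ) := by
    intro x
    rw [← hexp, ENNReal.rpow_mul, ENNReal.rpow_natCast]
  have hHol : ∀ f : Plane → ENNReal, Measurable f →
      ∫⁻ x in Ω, f x * ‖φ x‖ₑ ^ (2 * j + 1) ≤ (∫⁻ x in Ω, f x ^ q) ^ (1 / q) * I ^ (1 / p) := by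
    intro f hf
    have := ENNReal.lintegral_mul_le_Lp_mul_Lq (volume.restrict Ω) hpq.symm hf.aemeasurable
      (g := fun x => ‖φ x‖ₑ ^ (2 * j + 1)) (by fun_prop)
    simpa only [Pi.mul_apply, hpow] using this
  -- Finite since `φ` is bounded on the compact closure; this permits cancelling a power of `I` at
  -- the end.
  have hIt : I ≠ ⊤ := by
    obtain ⟨M, hM⟩ := (hΩ.isBounded.isCompact_closure).exists_bound_of_continuousOn
      hc.continuousOn
    have hvol : volume Ω ≠ ⊤ := hΩ.isBounded.measure_lt_top.ne
    refine (lt_of_le_of_lt (setLIntegral_mono' (g := fun _ =>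
      ENNReal.ofReal M ^ ((4 * (j + 1) : ℕ) : ℝ)) hΩ.isOpen.measurableSet fun x hx => ?_) ?_).ne
    · gcongr
      rw [← ofReal_norm]
      exact ENNReal.ofReal_le_ofReal (hM x (subset_closure hx))
    · rw [lintegral_const, Measure.restrict_apply_univ]
      exact ENNReal.mul_lt_top (ENNReal.rpow_lt_top_of_nonneg (by positivity)
        ENNReal.ofReal_ne_top) hvol.lt_top
  have hmain : I ≤ C * ((2 * (j + 1) : ℕ) * ((A + B) * I ^ (1 / p))) ^ 2 := by
    have h1 := (hC _ (contDiff_norm_pow_even hφ (j + 1))).1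
    have he : ∀ y, ‖‖φ y‖ ^ (2 * (j + 1))‖ₑ = ‖φ y‖ₑ ^ (2 * (j + 1)) := fun y => by
      rw [enorm_pow, enorm_norm]
    simp only [he] at h1
    have hIe : I = ∫⁻ y in Ω, (‖φ y‖ₑ ^ (2 * (j + 1))) ^ 2 := by
      rw [hI]
      refine lintegral_congr fun y => ?_
      rw [ENNReal.rpow_natCast, ← pow_mul]
      congr 1; ring
    refine (hIe.le.trans h1).trans ?_
    gcongr
    have h2 : (∫⁻ y in Ω, ‖fderiv ℝ (fun x => ‖φ x‖ ^ (2 * (j + 1))) y‖ₑ)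
        ≤ (2 * (j + 1) : ℕ) * (A * I ^ (1 / p)) := by
      refine (lintegral_mono fun y => enorm_fderiv_norm_pow_even_le hφ j y).trans ?_
      rw [lintegral_const_mul' _ _ (ENNReal.natCast_ne_top _)]
      gcongr
      exact hHol _ hd.enorm.measurable
    have h3 : (∫⁻ y in Ω, ‖φ y‖ₑ ^ (2 * (j + 1))) ≤ (2 * (j + 1) : ℕ) * (B * I ^ (1 / p)) := by
      refine le_trans (le_of_eq ?_) ((hHol _ hc.enorm.measurable).trans ?_)
      · refine lintegral_congr fun y => ?_
        rw [← pow_succ']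
        congr 1
      · refine le_mul_of_one_le_left zero_le ?_
        exact_mod_cast (by omega : 1 ≤ 2 * (j + 1))
    refine (add_le_add h2 h3).trans_eq ?_
    ring
  by_cases hI0 : I = 0
  · rw [hI0, ENNReal.zero_rpow_of_pos (by positivity)]
    exact zero_le
  -- After a square root, cancelling `I^{1/p}` from `I^{1/2}` leaves exactly the `L^{4k}` norm.
  have hsplit : (1 : ℝ) / 2 = 1 / ((4 * (j + 1) : ℕ) : ℝ) + 1 / p := by
    rw [hp]; push_cast; push_cast at hk1
    have : (2 * ((j : ℝ) + 1) - 1) ≠ 0 := by linarith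
    field_simp
    ring
  have h4 : I ^ (1 / 2 : ℝ) ≤ C' * (A + B) * I ^ (1 / p) := by
    have := ENNReal.rpow_le_rpow hmain (show (0 : ℝ) ≤ 1 / 2 by norm_num)
    refine this.trans_eq ?_
    rw [ENNReal.mul_rpow_of_nonneg _ _ (by norm_num), ← ENNReal.rpow_natCast, ← ENNReal.rpow_mul]
    norm_num
    rw [hC']
    push_cast
    ring
  rw [hsplit, ENNReal.rpow_add _ _ hI0 hIt] at h4
  have hIp0 : I ^ (1 / p) ≠ 0 := by
    rw [Ne, ENNReal.rpow_eq_zero_iff]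
    push Not
    exact ⟨fun h => absurd h hI0, fun h => absurd h hIt⟩
  have hIpt : I ^ (1 / p) ≠ ⊤ := ENNReal.rpow_ne_top_of_nonneg (by positivity) hIt
  exact (ENNReal.mul_le_mul_iff_left hIp0 hIpt).1 h4

end RhombiSlits

namespace RhombiSlits

/-! ### Limits of smooth functions -/

/-- The Euclidean space `ℂ²` in which complex gradients live. -/
abbrev CPlane := EuclideanSpace ℂ (Fin 2)

/-- `(a, G, f)` is a limit of triples `(φ, ∇φ, φ)` with smooth `φ`, in
`L²(Ω) × L²(Ω) × L²(∂Ω)`. -/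
def SmoothLimit (Ω : Set Plane) (a : Plane → ℂ) (G : Plane → CPlane) (f : Plane → ℂ) : Prop :=
  ∀ ε : NNReal, 0 < ε → ∃ φ : Plane → ℂ, ContDiff ℝ ∞ φ ∧
    eLpNorm (fun x => φ x - a x) 2 (volume.restrict Ω) ≤ ε ∧
    eLpNorm (fun x => classicalGrad φ x - G x) 2 (volume.restrict Ω) ≤ ε ∧
    eLpNorm (fun x => φ x - f x) 2 (arc (frontier Ω)) ≤ ε

theorem eLpNorm_coe_sub {X E : Type*} [MeasurableSpace X] {μ : Measure X} [NormedAddCommGroup E]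
    (f g : Lp E 2 μ) : eLpNorm (fun x => f x - g x) 2 μ = ‖f - g‖ₑ := by
  rw [Lp.enorm_def]
  exact eLpNorm_congr_ae (Lp.coeFn_sub f g).symm

variable {Ω D : Set Plane}

/-- The form with a tolerance speaks of plain functions rather than classes, so sums, products with
cut-offs and limits can be formed before a Sobolev function is built. -/
theorem isTrace_iff_smoothLimit {u : H1 Ω ℂ} {f : Lp ℂ 2 (arc (frontier Ω))} :
    IsTrace u f ↔ SmoothLimit Ω (h1Fn u) (h1Grad u) f := by
  constructor
  · rintro ⟨φ, hφ, h1, h2, h3⟩ ε hε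
    have hε' : (0 : ENNReal) < ε := by exact_mod_cast hε
    have := ((h1.eventually (gt_mem_nhds hε')).and (h2.eventually (gt_mem_nhds hε'))).and
      (h3.eventually (gt_mem_nhds hε'))
    obtain ⟨n, ⟨hn1, hn2⟩, hn3⟩ := this.exists
    exact ⟨φ n, hφ n, hn1.le, hn2.le, hn3.le⟩
  · intro h
    have hpos : ∀ n : ℕ, (0 : NNReal) < 1 / (n + 1) := fun n => by positivity
    choose φ hφ h1 h2 h3 using fun n : ℕ => h (1 / (n + 1)) (hpos n)
    have hlim : Tendsto (fun n : ℕ => ((1 / (n + 1) : NNReal) : ENNReal)) atTop (𝓝 0) := by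
      rw [← ENNReal.coe_zero, ENNReal.tendsto_coe]
      exact tendsto_one_div_add_atTop_nhds_zero_nat
    have hz : ∀ n : ℕ, (0 : ENNReal) ≤ 0 := fun _ => le_rfl
    exact ⟨φ, hφ, tendsto_of_tendsto_of_tendsto_of_le_of_le tendsto_const_nhds hlim
      (fun _ => zero_le) h1, tendsto_of_tendsto_of_tendsto_of_le_of_le tendsto_const_nhds hlim
      (fun _ => zero_le) h2, tendsto_of_tendsto_of_tendsto_of_le_of_le tendsto_const_nhds hlim
      (fun _ => zero_le) h3⟩

theorem continuous_classicalGrad {φ : Plane → ℂ} (hφ : ContDiff ℝ ∞ φ) :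
    Continuous (classicalGrad φ) := by
  refine (PiLp.continuous_toLp 2 _).comp (continuous_pi fun i => ?_)
  exact (hφ.continuous_fderiv (by simp)).clm_apply continuous_const

theorem norm_fderiv_le_classicalGrad (φ : Plane → ℂ) (x : Plane) :
    ‖fderiv ℝ φ x‖ ≤ ‖classicalGrad φ x‖ := by
  refine ContinuousLinearMap.opNorm_le_bound _ (norm_nonneg _) fun y => ?_
  have hy : y = y 0 • EuclideanSpace.single (0 : Fin 2) (1 : ℝ)
      + y 1 • EuclideanSpace.single (1 : Fin 2) (1 : ℝ) := by
    ext i; fin_cases i <;> simp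
  have h1 : fderiv ℝ φ x y = (y 0 : ℂ) * pderiv φ 0 x + (y 1 : ℂ) * pderiv φ 1 x := by
    nth_rewrite 1 [hy]
    simp only [map_add, map_smul, Complex.real_smul, pderiv]
  rw [h1, EuclideanSpace.norm_eq, EuclideanSpace.norm_eq, ← Real.sqrt_mul (by positivity)]
  refine Real.le_sqrt_of_sq_le ?_
  simp only [Fin.sum_univ_two, classicalGrad, Real.norm_eq_abs, sq_abs]
  have h2 : ‖(y 0 : ℂ) * pderiv φ 0 x + (y 1 : ℂ) * pderiv φ 1 x‖
      ≤ |y 0| * ‖pderiv φ 0 x‖ + |y 1| * ‖pderiv φ 1 x‖ := by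
    refine (norm_add_le _ _).trans ?_
    simp
  calc _ ≤ (|y 0| * ‖pderiv φ 0 x‖ + |y 1| * ‖pderiv φ 1 x‖) ^ 2 := by gcongr
    _ ≤ _ := by
      nlinarith [sq_nonneg (|y 0| * ‖pderiv φ 1 x‖ - |y 1| * ‖pderiv φ 0 x‖), sq_abs (y 0),
        sq_abs (y 1)]

theorem isFiniteMeasure_restrict (hΩ : IsPolygonalDomain Ω) :
    IsFiniteMeasure (volume.restrict Ω) :=
  ⟨by simpa using hΩ.isBounded.measure_lt_top⟩

theorem isFiniteMeasure_arc (hΩ : IsPolygonalDomain Ω) :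
    IsFiniteMeasure (arc (frontier Ω)) :=
  ⟨by simpa using measure_frontier_lt_top hΩ⟩

/-- Smooth functions satisfy the weak gradient identity. -/
theorem integral_pderiv_smul_eq {φ : Plane → ℂ} (hφ : ContDiff ℝ ∞ φ) {ψ : Plane → ℝ}
    (hψ : ContDiff ℝ ∞ ψ) (hc : HasCompactSupport ψ) (hs : tsupport ψ ⊆ Ω) (i : Fin 2) :
    ∫ x in Ω, pderiv ψ i x • φ x = -∫ x in Ω, ψ x • pderiv φ i x := by
  have h1 : ∫ x in Ω, pderiv ψ i x • φ x = ∫ x, pderiv ψ i x • φ x := by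
    refine setIntegral_eq_integral_of_forall_compl_eq_zero fun x hx => ?_
    have : x ∉ tsupport (fderiv ℝ ψ) := fun h => hx (hs (tsupport_fderiv_subset ℝ h))
    rw [pderiv, image_eq_zero_of_notMem_tsupport this]
    simp
  have h2 : ∫ x in Ω, ψ x • pderiv φ i x = ∫ x, ψ x • pderiv φ i x := by
    refine setIntegral_eq_integral_of_forall_compl_eq_zero fun x hx => ?_
    rw [image_eq_zero_of_notMem_tsupport fun h => hx (hs h), zero_smul]
  have hcψ : Continuous (pderiv ψ i) := continuous_pderiv hψ i
  have hcφ : Continuous (pderiv φ i) :=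
    (hφ.continuous_fderiv (by simp)).clm_apply continuous_const
  rw [h1, h2, eq_comm, neg_eq_iff_eq_neg]
  refine integral_smul_fderiv_eq_neg_fderiv_smul_of_integrable ?_ ?_ ?_ ?_ ?_
  · exact (hcψ.smul hφ.continuous).integrable_of_hasCompactSupport
      ((hasCompactSupport_pderiv hc i).smul_right)
  · exact (hψ.continuous.smul hcφ).integrable_of_hasCompactSupport hc.smul_right
  · exact (hψ.continuous.smul hφ.continuous).integrable_of_hasCompactSupport hc.smul_right
  · exact fun x _ => hψ.differentiable (by simp) x
  · exact fun x _ => hφ.differentiable (by simp) x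

theorem enorm_integral_smul_sub_le {μ : Measure Plane} {χ : Plane → ℝ} {a b : Plane → ℂ}
    (hχ : MemLp χ 2 μ) (ha : MemLp a 2 μ) (hb : AEStronglyMeasurable b μ)
    (hi : Integrable (fun x => χ x • b x) μ) :
    ‖(∫ x, χ x • b x ∂μ) - ∫ x, χ x • a x ∂μ‖ₑ
      ≤ eLpNorm χ 2 μ * eLpNorm (fun x => b x - a x) 2 μ := by
  have hia : Integrable (fun x => χ x • a x) μ := memLp_one_iff_integrable.1 (ha.smul hχ)
  rw [← integral_sub hi hia]
  refine (enorm_integral_le_lintegral_enorm _).trans ?_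
  rw [← eLpNorm_one_eq_lintegral_enorm]
  refine le_trans (le_of_eq ?_) (eLpNorm_smul_le_mul_eLpNorm (p := 2) (q := 2) (r := 1)
    (hb.sub ha.1) hχ.1)
  congr 1
  ext x
  simp only [Pi.smul_apply', Pi.sub_apply, smul_sub]

/-- The device by which inequalities for smooth functions pass to limits: each replacement by an
approximant costs a multiple of `ε`. -/
theorem le_of_forall_eps {X Y K : ENNReal} (hK : K ≠ ⊤)
    (h : ∀ ε : NNReal, 0 < ε → X ≤ Y + K * ε) : X ≤ Y := by
  refine ENNReal.le_of_forall_pos_le_add fun ε hε _ => ?_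
  lift K to NNReal using hK
  refine (h (ε / (K + 1)) (by positivity)).trans ?_
  gcongr
  rw [← ENNReal.coe_mul, ENNReal.coe_le_coe]
  rw [mul_div_assoc', div_le_iff₀ (by positivity)]
  calc K * ε ≤ (K + 1) * ε := by gcongr; exact le_self_add
    _ = ε * (K + 1) := mul_comm _ _

/-- Against a fixed test function both sides are continuous for `L²` convergence, and smooth
functions satisfy the identity. -/
theorem SmoothLimit.weakGradient {a : Plane → ℂ} {G : Plane → CPlane}
    {f : Plane → ℂ} (h : SmoothLimit Ω a G f) (ha : MemLp a 2 (volume.restrict Ω))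
    (hG : MemLp G 2 (volume.restrict Ω)) {ψ : Plane → ℝ} (hψ : ContDiff ℝ ∞ ψ)
    (hc : HasCompactSupport ψ) (hs : tsupport ψ ⊆ Ω) (i : Fin 2) :
    ∫ x in Ω, pderiv ψ i x • a x = -∫ x in Ω, ψ x • G x i := by
  have hcψ : Continuous (pderiv ψ i) := continuous_pderiv hψ i
  have hψ2 : MemLp ψ 2 (volume.restrict Ω) :=
    (hψ.continuous.memLp_of_hasCompactSupport (μ := (volume : Measure Plane)) hc).restrict Ω
  have hdψ2 : MemLp (pderiv ψ i) 2 (volume.restrict Ω) :=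
    (hcψ.memLp_of_hasCompactSupport (μ := (volume : Measure Plane))
      (hasCompactSupport_pderiv hc i)).restrict Ω
  have hGi : MemLp (fun x => G x i) 2 (volume.restrict Ω) :=
    (EuclideanSpace.proj (𝕜 := ℂ) i : CPlane →L[ℂ] ℂ).comp_memLp' hG
  rw [← add_eq_zero_iff_eq_neg, ← enorm_eq_zero, ← nonpos_iff_eq_zero]
  set K := eLpNorm (pderiv ψ i) 2 (volume.restrict Ω) + eLpNorm ψ 2 (volume.restrict Ω) with hK
  have hKt : K ≠ ⊤ := ENNReal.add_ne_top.2 ⟨hdψ2.2.ne, hψ2.2.ne⟩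
  refine le_of_forall_eps hKt fun ε hε => ?_
  obtain ⟨φ, hφ, h1, h2, -⟩ := h ε hε
  have hcφ : Continuous (pderiv φ i) :=
    (hφ.continuous_fderiv (by simp)).clm_apply continuous_const
  have e1 := enorm_integral_smul_sub_le hdψ2 ha hφ.continuous.aestronglyMeasurable
    ((hcψ.smul hφ.continuous).integrable_of_hasCompactSupport
      ((hasCompactSupport_pderiv hc i).smul_right)).integrableOn
  have e2 := enorm_integral_smul_sub_le hψ2 hGi hcφ.aestronglyMeasurable
    ((hψ.continuous.smul hcφ).integrable_of_hasCompactSupport hc.smul_right).integrableOn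
  have e3 := integral_pderiv_smul_eq hφ hψ hc hs i
  have e4 : eLpNorm (fun x => pderiv φ i x - G x i) 2 (volume.restrict Ω) ≤ ε := by
    refine (eLpNorm_mono fun x => ?_).trans h2
    exact PiLp.norm_apply_le (classicalGrad φ x - G x) i
  rw [zero_add]
  calc ‖(∫ x in Ω, pderiv ψ i x • a x) + ∫ x in Ω, ψ x • G x i‖ₑ
      = ‖((∫ x in Ω, pderiv ψ i x • φ x) - ∫ x in Ω, pderiv ψ i x • a x) +
          ((∫ x in Ω, ψ x • pderiv φ i x) - ∫ x in Ω, ψ x • G x i)‖ₑ := by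
        rw [e3, ← enorm_neg]
        congr 1
        ring
    _ ≤ _ := enorm_add_le _ _
    _ ≤ eLpNorm (pderiv ψ i) 2 (volume.restrict Ω) * ε + eLpNorm ψ 2 (volume.restrict Ω) * ε :=
        add_le_add (e1.trans (by gcongr)) (e2.trans (by gcongr))
    _ = K * ε := by rw [hK, add_mul]

theorem SmoothLimit.congr {a a' : Plane → ℂ} {G G' : Plane → CPlane}
    {f f' : Plane → ℂ} (h : SmoothLimit Ω a G f) (ha : a =ᵐ[volume.restrict Ω] a')
    (hG : G =ᵐ[volume.restrict Ω] G') (hf : f =ᵐ[arc (frontier Ω)] f') :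
    SmoothLimit Ω a' G' f' := by
  intro ε hε
  obtain ⟨φ, hφ, h1, h2, h3⟩ := h ε hε
  refine ⟨φ, hφ, ?_, ?_, ?_⟩
  · refine (eLpNorm_congr_ae ?_).trans_le h1
    filter_upwards [ha] with x hx; rw [hx]
  · refine (eLpNorm_congr_ae ?_).trans_le h2
    filter_upwards [hG] with x hx; rw [hx]
  · refine (eLpNorm_congr_ae ?_).trans_le h3
    filter_upwards [hf] with x hx; rw [hx]

/-- Limits of smooth functions are Sobolev functions with a trace. -/
theorem SmoothLimit.exists_h1 {a : Plane → ℂ} {G : Plane → CPlane}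
    {f : Plane → ℂ} (h : SmoothLimit Ω a G f) (ha : MemLp a 2 (volume.restrict Ω))
    (hG : MemLp G 2 (volume.restrict Ω)) (hf : MemLp f 2 (arc (frontier Ω))) :
    ∃ u : H1 Ω ℂ, h1Fn u =ᵐ[volume.restrict Ω] a ∧ h1Grad u =ᵐ[volume.restrict Ω] G ∧
      IsTrace u (hf.toLp f) := by
  set p : L2Pair Ω ℂ := WithLp.toLp 2 (ha.toLp a, hG.toLp G) with hp
  have e1 : p.fst =ᵐ[volume.restrict Ω] a := ha.coeFn_toLp
  have e2 : p.snd =ᵐ[volume.restrict Ω] G := hG.coeFn_toLp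
  have hpm : p ∈ H1 Ω ℂ := by
    intro ψ hψ hc hs i
    rw [show ∫ x in Ω, pderiv ψ i x • p.fst x = ∫ x in Ω, pderiv ψ i x • a x from
        integral_congr_ae (by filter_upwards [e1] with x hx; rw [hx]),
      show ∫ x in Ω, ψ x • p.snd x i = ∫ x in Ω, ψ x • G x i from
        integral_congr_ae (by filter_upwards [e2] with x hx; rw [hx])]
    exact h.weakGradient ha hG hψ hc hs i
  refine ⟨⟨p, hpm⟩, e1, e2, isTrace_iff_smoothLimit.2 ?_⟩
  exact h.congr e1.symm e2.symm hf.coeFn_toLp.symm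

/-! Algebraic operations on limits of smooth functions. -/

theorem classicalGrad_add {φ ψ : Plane → ℂ} (hφ : ContDiff ℝ ∞ φ) (hψ : ContDiff ℝ ∞ ψ)
    (x : Plane) : classicalGrad (fun x => φ x + ψ x) x = classicalGrad φ x + classicalGrad ψ x := by
  ext i
  have := fderiv_add (hφ.differentiable (by simp) x) (hψ.differentiable (by simp) x)
  simp only [classicalGrad, pderiv, PiLp.add_apply]
  rw [show (fun x => φ x + ψ x) = φ + ψ from rfl, this]
  rfl

theorem classicalGrad_const_mul {φ : Plane → ℂ} (hφ : ContDiff ℝ ∞ φ) (c : ℂ)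
    (x : Plane) : classicalGrad (fun x => c * φ x) x = c • classicalGrad φ x := by
  ext i
  have := fderiv_const_mul (hφ.differentiable (by simp) x) c
  simp only [classicalGrad, pderiv, PiLp.smul_apply, smul_eq_mul]
  rw [this]
  rfl

theorem classicalGrad_const (c : ℂ) (x : Plane) : classicalGrad (fun _ => c) x = 0 := by
  ext i
  simp [classicalGrad, pderiv]

/-- The complexified gradient of a real function. -/
noncomputable def gradC (ψ : Plane → ℝ) (x : Plane) : CPlane :=
  WithLp.toLp 2 fun i => ((pderiv ψ i x : ℝ) : ℂ)

theorem classicalGrad_smul {φ : Plane → ℂ} (hφ : ContDiff ℝ ∞ φ) {ψ : Plane → ℝ}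
    (hψ : ContDiff ℝ ∞ ψ) (x : Plane) :
    classicalGrad (fun x => (ψ x : ℂ) * φ x) x = (ψ x : ℂ) • classicalGrad φ x + φ x • gradC ψ x := by
  ext i
  have := fderiv_fun_smul (hψ.differentiable (by simp) x) (hφ.differentiable (by simp) x)
  simp only [classicalGrad, pderiv, PiLp.smul_apply, PiLp.add_apply, smul_eq_mul, gradC]
  rw [show (fun x => (ψ x : ℂ) * φ x) = fun y => ψ y • φ y by ext y; simp, this]
  simp [mul_comm]

theorem SmoothLimit.add {a a' : Plane → ℂ} {G G' : Plane → CPlane}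
    {f f' : Plane → ℂ} (h : SmoothLimit Ω a G f) (h' : SmoothLimit Ω a' G' f')
    (ha : AEStronglyMeasurable a (volume.restrict Ω))
    (ha' : AEStronglyMeasurable a' (volume.restrict Ω))
    (hG : AEStronglyMeasurable G (volume.restrict Ω))
    (hG' : AEStronglyMeasurable G' (volume.restrict Ω))
    (hf : AEStronglyMeasurable f (arc (frontier Ω)))
    (hf' : AEStronglyMeasurable f' (arc (frontier Ω))) :
    SmoothLimit Ω (fun x => a x + a' x) (fun x => G x + G' x) (fun x => f x + f' x) := by
  intro ε hε
  obtain ⟨φ, hφ, h1, h2, h3⟩ := h (ε / 2) (by positivity)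
  obtain ⟨ψ, hψ, k1, k2, k3⟩ := h' (ε / 2) (by positivity)
  have hsum : ((ε / 2 : NNReal) : ENNReal) + ((ε / 2 : NNReal) : ENNReal) = ε := by
    rw [← ENNReal.coe_add, add_halves]
  refine ⟨fun x => φ x + ψ x, hφ.add hψ, ?_, ?_, ?_⟩
  · rw [← hsum]
    refine le_trans (le_of_eq ?_) ((eLpNorm_add_le
      (hφ.continuous.aestronglyMeasurable.sub ha) (hψ.continuous.aestronglyMeasurable.sub ha')
      (by norm_num)).trans (add_le_add h1 k1))
    congr 1; ext x; simp only [Pi.add_apply, Pi.sub_apply]; ring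
  · rw [← hsum]
    refine le_trans (le_of_eq ?_) ((eLpNorm_add_le
      ((continuous_classicalGrad hφ).aestronglyMeasurable.sub hG)
      ((continuous_classicalGrad hψ).aestronglyMeasurable.sub hG')
      (by norm_num)).trans (add_le_add h2 k2))
    congr 1; ext x : 1
    simp only [Pi.add_apply, Pi.sub_apply, classicalGrad_add hφ hψ]; abel
  · rw [← hsum]
    refine le_trans (le_of_eq ?_) ((eLpNorm_add_le
      (hφ.continuous.aestronglyMeasurable.sub hf) (hψ.continuous.aestronglyMeasurable.sub hf')
      (by norm_num)).trans (add_le_add h3 k3))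
    congr 1; ext x; simp only [Pi.add_apply, Pi.sub_apply]; ring

theorem SmoothLimit.const_mul {a : Plane → ℂ} {G : Plane → CPlane}
    {f : Plane → ℂ} (h : SmoothLimit Ω a G f) (c : ℂ) :
    SmoothLimit Ω (fun x => c * a x) (fun x => c • G x) (fun x => c * f x) := by
  intro ε hε
  obtain ⟨φ, hφ, h1, h2, h3⟩ := h (ε / (‖c‖₊ + 1)) (by positivity)
  have hle : ‖c‖ₑ * ((ε / (‖c‖₊ + 1) : NNReal) : ENNReal) ≤ ε := by
    rw [enorm_eq_nnnorm, ← ENNReal.coe_mul, ENNReal.coe_le_coe, mul_div_assoc',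
      div_le_iff₀ (by positivity), mul_comm]
    gcongr
    exact le_self_add
  have key : ∀ {E : Type} [NormedAddCommGroup E] [NormedSpace ℂ E] (μ : Measure Plane)
      (F : Plane → E), eLpNorm F 2 μ ≤ ((ε / (‖c‖₊ + 1) : NNReal) : ENNReal) →
      eLpNorm (fun x => c • F x) 2 μ ≤ ε := by
    intro E _ _ μ F hF
    refine (eLpNorm_const_smul_le (c := c) (f := F)).trans (le_trans ?_ hle)
    gcongr
  refine ⟨fun x => c * φ x, contDiff_const.mul hφ, ?_, ?_, ?_⟩
  · simpa only [smul_eq_mul, mul_sub] using key _ _ h1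
  · simpa only [classicalGrad_const_mul hφ, smul_sub] using key _ _ h2
  · simpa only [smul_eq_mul, mul_sub] using key _ _ h3

theorem smoothLimit_const (Ω : Set Plane) (c : ℂ) :
    SmoothLimit Ω (fun _ => c) (fun _ => 0) (fun _ => c) := by
  intro ε hε
  refine ⟨fun _ => c, contDiff_const, ?_, ?_, ?_⟩ <;> simp [classicalGrad_const]

theorem continuous_gradC {ψ : Plane → ℝ} (hψ : ContDiff ℝ ∞ ψ) : Continuous (gradC ψ) := by
  refine (PiLp.continuous_toLp 2 _).comp (continuous_pi fun i => ?_)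
  exact Complex.continuous_ofReal.comp (continuous_pderiv hψ i)

theorem exists_bound_gradC {ψ : Plane → ℝ} (hψ : ContDiff ℝ ∞ ψ) (hc : HasCompactSupport ψ) :
    ∃ M : NNReal, ∀ x, ‖ψ x‖ ≤ M ∧ ‖gradC ψ x‖ ≤ M := by
  have hgc : HasCompactSupport (gradC ψ) := by
    refine (hc.fderiv (𝕜 := ℝ)).mono fun x hx => ?_
    contrapose! hx
    have h0 : fderiv ℝ ψ x = 0 := by simpa using hx
    have : gradC ψ x = 0 := by ext i; simp [gradC, pderiv, h0]
    simpa using this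
  obtain ⟨M₁, hM₁⟩ := hc.exists_bound_of_continuous hψ.continuous
  obtain ⟨M₂, hM₂⟩ := hgc.exists_bound_of_continuous (continuous_gradC hψ)
  refine ⟨(max M₁ M₂).toNNReal, fun x => ⟨?_, ?_⟩⟩
  · exact (hM₁ x).trans ((le_max_left _ _).trans (Real.le_coe_toNNReal _))
  · exact (hM₂ x).trans ((le_max_right _ _).trans (Real.le_coe_toNNReal _))

/-- The product rule for limits. It produces the localised test functions of the Caccioppoli
inequality. -/
theorem SmoothLimit.mul {a : Plane → ℂ} {G : Plane → CPlane}
    {f : Plane → ℂ} (h : SmoothLimit Ω a G f) {ψ : Plane → ℝ} (hψ : ContDiff ℝ ∞ ψ)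
    (hc : HasCompactSupport ψ) (ha : AEStronglyMeasurable a (volume.restrict Ω))
    (hG : AEStronglyMeasurable G (volume.restrict Ω)) :
    SmoothLimit Ω (fun x => (ψ x : ℂ) * a x) (fun x => (ψ x : ℂ) • G x + a x • gradC ψ x)
      (fun x => (ψ x : ℂ) * f x) := by
  obtain ⟨M, hM⟩ := exists_bound_gradC hψ hc
  intro ε hε
  set δ : NNReal := ε / (2 * (M + 1)) with hδ
  obtain ⟨φ, hφ, h1, h2, h3⟩ := h δ (by positivity)
  have hδ2 : (M : ENNReal) * δ + M * δ ≤ ε := by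
    rw [← ENNReal.coe_mul, ← ENNReal.coe_add, ENNReal.coe_le_coe, hδ, ← two_mul, mul_div_assoc',
      mul_div_assoc', div_le_iff₀ (by positivity)]
    calc 2 * (M * ε) = ε * (2 * M) := by ring
      _ ≤ ε * (2 * (M + 1)) := by gcongr; exact le_self_add
  have hδ1 : (M : ENNReal) * δ ≤ ε := le_self_add.trans hδ2
  have hψC : Continuous fun x => (ψ x : ℂ) := Complex.continuous_ofReal.comp hψ.continuous
  have key : ∀ {E E' : Type} [NormedAddCommGroup E] [NormedAddCommGroup E'] (μ : Measure Plane)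
      (F : Plane → E) (F' : Plane → E'), (∀ x, ‖F' x‖ ≤ M * ‖F x‖) →
      eLpNorm F 2 μ ≤ δ → eLpNorm F' 2 μ ≤ M * δ := by
    intro E E' _ _ μ F F' hle hF
    refine (eLpNorm_le_nnreal_smul_eLpNorm_of_ae_le_mul (f := F') (g := F) (c := M)
      (ae_of_all _ fun x => ?_) 2).trans ?_
    · exact_mod_cast hle x
    · rw [ENNReal.smul_def, smul_eq_mul]; gcongr
  have hψn : ∀ x, ‖(ψ x : ℂ)‖ ≤ M := fun x => by
    rw [Complex.norm_real]; exact (hM x).1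
  refine ⟨fun x => (ψ x : ℂ) * φ x, (Complex.ofRealCLM.contDiff.comp hψ).mul hφ, ?_, ?_, ?_⟩
  · refine (key _ _ _ (fun x => ?_) h1).trans hδ1
    rw [← mul_sub, norm_mul]
    exact mul_le_mul_of_nonneg_right (hψn x) (norm_nonneg _)
  · refine le_trans ?_ hδ2
    have e : (fun x => classicalGrad (fun x => (ψ x : ℂ) * φ x) x
        - ((ψ x : ℂ) • G x + a x • gradC ψ x))
        = (fun x => (ψ x : ℂ) • (classicalGrad φ x - G x)) + fun x => (φ x - a x) • gradC ψ x := by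
      ext x : 1
      simp only [classicalGrad_smul hφ hψ, Pi.add_apply, smul_sub, sub_smul]
      abel
    rw [e]
    refine (eLpNorm_add_le (hψC.aestronglyMeasurable.smul
      ((continuous_classicalGrad hφ).aestronglyMeasurable.sub hG))
      ((hφ.continuous.aestronglyMeasurable.sub ha).smul
        (continuous_gradC hψ).aestronglyMeasurable) (by norm_num)).trans ?_
    refine add_le_add (key _ _ _ (fun x => ?_) h2) (key _ _ _ (fun x => ?_) h1)
    · change ‖(ψ x : ℂ) • (classicalGrad φ x - G x)‖ ≤ _
      rw [norm_smul]
      exact mul_le_mul_of_nonneg_right (hψn x) (norm_nonneg _)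
    · change ‖(φ x - a x) • gradC ψ x‖ ≤ _
      rw [norm_smul, mul_comm]
      exact mul_le_mul_of_nonneg_right (hM x).2 (norm_nonneg _)
  · refine (key _ _ _ (fun x => ?_) h3).trans hδ1
    rw [← mul_sub, norm_mul]
    exact mul_le_mul_of_nonneg_right (hψn x) (norm_nonneg _)

end RhombiSlits

namespace RhombiSlits

/-! ### Norm inequalities for limits of smooth functions -/

theorem eLpNorm_two_sq {X E : Type*} [MeasurableSpace X] {μ : Measure X} [NormedAddCommGroup E]
    (f : X → E) : eLpNorm f 2 μ ^ 2 = ∫⁻ x, ‖f x‖ₑ ^ 2 ∂μ := by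
  have := eLpNorm_nnreal_pow_eq_lintegral (f := f) (μ := μ) (p := 2) (by norm_num)
  simpa using this

theorem eLpNorm_two_le_of_lintegral_sq_le {X E : Type*} [MeasurableSpace X] {μ : Measure X}
    [NormedAddCommGroup E] {f : X → E} {C : NNReal} {B : ENNReal}
    (h : ∫⁻ x, ‖f x‖ₑ ^ 2 ∂μ ≤ C * B ^ 2) : eLpNorm f 2 μ ≤ NNReal.sqrt C * B := by
  rw [← eLpNorm_two_sq] at h
  have hC : (C : ENNReal) = (NNReal.sqrt C : ENNReal) ^ 2 := by
    rw [← ENNReal.coe_pow, NNReal.sq_sqrt]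
  rw [hC, ← mul_pow] at h
  exact (ENNReal.pow_le_pow_left_iff two_ne_zero).1 h

theorem eLpNorm_le_add_sub {X E : Type*} [MeasurableSpace X] {μ : Measure X}
    [NormedAddCommGroup E] {f g : X → E} {p : ENNReal} (hp : 1 ≤ p)
    (hf : AEStronglyMeasurable f μ) (hg : AEStronglyMeasurable g μ) :
    eLpNorm f p μ ≤ eLpNorm g p μ + eLpNorm (fun x => f x - g x) p μ := by
  refine le_trans (le_of_eq ?_) (eLpNorm_add_le hg (hf.sub hg) hp)
  congr 1
  ext x
  simp

theorem eLpNorm_le_add_sub' {X E : Type*} [MeasurableSpace X] {μ : Measure X}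
    [NormedAddCommGroup E] {f g : X → E} {p : ENNReal} (hp : 1 ≤ p)
    (hf : AEStronglyMeasurable f μ) (hg : AEStronglyMeasurable g μ) :
    eLpNorm g p μ ≤ eLpNorm f p μ + eLpNorm (fun x => f x - g x) p μ := by
  refine (eLpNorm_le_add_sub hp hg hf).trans_eq ?_
  congr 1
  rw [← eLpNorm_neg]
  congr 1
  ext x
  simp

/-- On a finite measure space the lower Lebesgue norms are controlled by the `L²` norm. -/
theorem exists_eLpNorm_le_two {X : Type*} [MeasurableSpace X] (μ : Measure X) [IsFiniteMeasure μ]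
    {p : ENNReal} (hp : p ≤ 2) (hp1 : 1 ≤ p) :
    ∃ K : NNReal, ∀ {E : Type} [NormedAddCommGroup E] {f : X → E}, AEStronglyMeasurable f μ →
      eLpNorm f p μ ≤ K * eLpNorm f 2 μ := by
  have ht : μ Set.univ ^ (1 / p.toReal - 1 / (2 : ENNReal).toReal) ≠ ⊤ := by
    refine ENNReal.rpow_ne_top_of_nonneg ?_ (measure_ne_top _ _)
    have h1 : 1 ≤ p.toReal := by
      rw [← ENNReal.toReal_one]; exact ENNReal.toReal_mono (ne_top_of_le_ne_top (by simp) hp) hp1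
    have h2 : p.toReal ≤ (2 : ENNReal).toReal := ENNReal.toReal_mono (by simp) hp
    rw [sub_nonneg]
    exact one_div_le_one_div_of_le (by linarith) h2
  refine ⟨(μ Set.univ ^ (1 / p.toReal - 1 / (2 : ENNReal).toReal)).toNNReal, fun {E} _ {f} hf => ?_⟩
  rw [ENNReal.coe_toNNReal ht, mul_comm]
  exact eLpNorm_le_eLpNorm_mul_rpow_measure_univ hp hf

theorem contDiff_one {φ : Plane → ℂ} (hφ : ContDiff ℝ ∞ φ) : ContDiff ℝ 1 φ :=
  hφ.of_le (by exact_mod_cast le_top)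

theorem eLpNorm_fderiv_le (φ : Plane → ℂ) (p : ENNReal) (μ : Measure Plane) :
    eLpNorm (fderiv ℝ φ) p μ ≤ eLpNorm (classicalGrad φ) p μ :=
  eLpNorm_mono fun x => norm_fderiv_le_classicalGrad φ x

variable {Ω D : Set Plane}

/-- Gathers the measurability of the three components of a triple `(a, G, f)`. -/
structure MeasTriple (Ω : Set Plane) (a : Plane → ℂ) (G : Plane → CPlane) (f : Plane → ℂ) :
    Prop where
  fn : AEStronglyMeasurable a (volume.restrict Ω)
  grad : AEStronglyMeasurable G (volume.restrict Ω)
  trace : AEStronglyMeasurable f (arc (frontier Ω))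

theorem measTriple_h1 (u : H1 Ω ℂ) (f : Lp ℂ 2 (arc (frontier Ω))) :
    MeasTriple Ω (h1Fn u) (h1Grad u) f :=
  ⟨Lp.aestronglyMeasurable _, Lp.aestronglyMeasurable _, Lp.aestronglyMeasurable _⟩

theorem SmoothLimit.trace_le (hΩ : IsPolygonalDomain Ω) :
    ∃ C : NNReal, ∀ {a : Plane → ℂ} {G : Plane → CPlane} {f : Plane → ℂ}, MeasTriple Ω a G f →
      SmoothLimit Ω a G f → eLpNorm f 2 (arc (frontier Ω))
        ≤ C * (eLpNorm a 2 (volume.restrict Ω) + eLpNorm G 2 (volume.restrict Ω)) := by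
  obtain ⟨C, hC⟩ := exists_trace_bound hΩ
  refine ⟨NNReal.sqrt C, fun {a G f} hm h => ?_⟩
  refine le_of_forall_eps (K := NNReal.sqrt C + NNReal.sqrt C + 1) (by finiteness) fun ε hε => ?_
  obtain ⟨φ, hφ, h1, h2, h3⟩ := h ε hε
  have hφm := hφ.continuous.aestronglyMeasurable (μ := volume.restrict Ω)
  have hgm := (continuous_classicalGrad hφ).aestronglyMeasurable (μ := volume.restrict Ω)
  have e1 := eLpNorm_le_add_sub (p := 2) (by norm_num) hφm hm.fn
  have e2 := eLpNorm_le_add_sub (p := 2) (by norm_num) hgm hm.grad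
  have e3 := eLpNorm_le_add_sub' (p := 2) (by norm_num)
    (hφ.continuous.aestronglyMeasurable (μ := arc (frontier Ω))) hm.trace
  have e4 : eLpNorm φ 2 (arc (frontier Ω)) ≤ NNReal.sqrt C *
      (eLpNorm φ 2 (volume.restrict Ω) + eLpNorm (classicalGrad φ) 2 (volume.restrict Ω)) := by
    refine eLpNorm_two_le_of_lintegral_sq_le ((hC φ (contDiff_one hφ)).trans ?_)
    refine mul_le_mul_right ?_ _
    rw [← eLpNorm_two_sq, ← eLpNorm_two_sq]
    calc _ ≤ eLpNorm φ 2 (volume.restrict Ω) ^ 2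
          + eLpNorm (classicalGrad φ) 2 (volume.restrict Ω) ^ 2 := by
          gcongr 2; exact eLpNorm_fderiv_le φ 2 _
      _ ≤ _ := by
          rw [add_sq]
          refine add_le_add ?_ le_rfl
          exact le_self_add
  calc eLpNorm f 2 (arc (frontier Ω)) ≤ NNReal.sqrt C *
      ((eLpNorm a 2 (volume.restrict Ω) + ε) + (eLpNorm G 2 (volume.restrict Ω) + ε)) + ε := by
        refine e3.trans (add_le_add (e4.trans ?_) h3)
        exact mul_le_mul_right (add_le_add (e1.trans (add_le_add le_rfl h1))
          (e2.trans (add_le_add le_rfl h2))) _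
    _ = _ := by ring

theorem SmoothLimit.friedrichs (hΩ : IsPolygonalDomain Ω) (hD : IsDirichletPart Ω D) :
    ∃ C : NNReal, ∀ {a : Plane → ℂ} {G : Plane → CPlane} {f : Plane → ℂ}, MeasTriple Ω a G f →
      SmoothLimit Ω a G f → f =ᵐ[arc D] 0 →
      eLpNorm a 2 (volume.restrict Ω) ≤ C * eLpNorm G 1 (volume.restrict Ω) := by
  obtain ⟨C, hC⟩ := exists_friedrichs hΩ hD
  have := isFiniteMeasure_restrict hΩ
  have := isFiniteMeasure_arc hΩ
  obtain ⟨K, hK⟩ := exists_eLpNorm_le_two (volume.restrict Ω) (p := 1) (by norm_num) le_rfl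
  obtain ⟨K', hK'⟩ := exists_eLpNorm_le_two (arc (frontier Ω)) (p := 1) (by norm_num) le_rfl
  refine ⟨NNReal.sqrt C, fun {a G f} hm h h0 => ?_⟩
  refine le_of_forall_eps (K := NNReal.sqrt C * K + NNReal.sqrt C * K' + 1) (by finiteness)
    fun ε hε => ?_
  obtain ⟨φ, hφ, h1, h2, h3⟩ := h ε hε
  have hφm := hφ.continuous.aestronglyMeasurable (μ := volume.restrict Ω)
  have hgm := (continuous_classicalGrad hφ).aestronglyMeasurable (μ := volume.restrict Ω)
  have e1 := eLpNorm_le_add_sub' (p := 2) (by norm_num) hφm hm.fn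
  have e2 := eLpNorm_le_add_sub (p := 1) (by norm_num) hgm hm.grad
  -- The approximant need not vanish on `D`, but its trace there equals the approximation error
  -- because `f` does vanish.
  have e3 : eLpNorm φ 1 (arc D) ≤ K' * ε := by
    calc eLpNorm φ 1 (arc D) = eLpNorm (fun x => φ x - f x) 1 (arc D) := by
          refine eLpNorm_congr_ae ?_
          filter_upwards [h0] with x hx
          simp [hx]
      _ ≤ eLpNorm (fun x => φ x - f x) 1 (arc (frontier Ω)) :=
          eLpNorm_mono_measure _ (Measure.restrict_mono hD.subset le_rfl)
      _ ≤ K' * ε := (hK' (hφ.continuous.aestronglyMeasurable.sub hm.trace)).trans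
          (mul_le_mul_right h3 _)
  have e4 := eLpNorm_two_le_of_lintegral_sq_le (hC φ (contDiff_one hφ))
  rw [← eLpNorm_one_eq_lintegral_enorm, ← eLpNorm_one_eq_lintegral_enorm] at e4
  have e5 := (hK (hgm.sub hm.grad)).trans (mul_le_mul_right h2 _)
  calc eLpNorm a 2 (volume.restrict Ω) ≤ NNReal.sqrt C *
      ((eLpNorm G 1 (volume.restrict Ω) + K * ε) + K' * ε) + ε := by
        refine e1.trans (add_le_add (e4.trans ?_) h1)
        exact mul_le_mul_right (add_le_add ((eLpNorm_fderiv_le φ 1 _).trans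
          (e2.trans (add_le_add le_rfl e5))) e3) _
    _ = _ := by ring

/-- Approximation in `L²` says nothing of the `L^{4k}` norm, so the left side is handled by Fatou's
lemma along an almost everywhere convergent subsequence. -/
theorem SmoothLimit.sobolev (hΩ : IsPolygonalDomain Ω) {k : ℕ} (hk : 0 < k)
    {p q : ℝ} (hp : p = 4 * k / (2 * k - 1)) (hpq : p.HolderConjugate q) (hq2 : q ≤ 2) :
    ∃ C : NNReal, ∀ {a : Plane → ℂ} {G : Plane → CPlane} {f : Plane → ℂ}, MeasTriple Ω a G f →
      SmoothLimit Ω a G f →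
      eLpNorm a (4 * k : ℕ) (volume.restrict Ω) ≤ C * (eLpNorm G (ENNReal.ofReal q)
        (volume.restrict Ω) + eLpNorm a (ENNReal.ofReal q) (volume.restrict Ω)) := by
  obtain ⟨C, hC⟩ := exists_sobolev_bound hΩ hk hp hpq
  have := isFiniteMeasure_restrict hΩ
  have hq1 : 1 ≤ ENNReal.ofReal q := by
    rw [← ENNReal.ofReal_one]; exact ENNReal.ofReal_le_ofReal hpq.symm.lt.le
  have hq2' : ENNReal.ofReal q ≤ 2 := by
    rw [← ENNReal.ofReal_ofNat]; exact ENNReal.ofReal_le_ofReal hq2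
  obtain ⟨K, hK⟩ := exists_eLpNorm_le_two (volume.restrict Ω) hq2' hq1
  refine ⟨C, fun {a G f} hm h => ?_⟩
  refine le_of_forall_eps (K := C * K + C * K) (by finiteness) fun ε hε => ?_
  choose φ hφ h1 h2 h3 using fun n : ℕ => h (ε / (n + 1)) (by positivity)
  have hle : ∀ n : ℕ, ((ε / (n + 1) : NNReal) : ENNReal) ≤ ε := fun n => by
    rw [ENNReal.coe_le_coe]
    exact div_le_self zero_le (by simp)
  have hlim : Tendsto (fun n : ℕ => ((ε / (n + 1) : NNReal) : ENNReal)) atTop (𝓝 0) := by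
    rw [← ENNReal.coe_zero, ENNReal.tendsto_coe]
    have := (tendsto_one_div_add_atTop_nhds_zero_nat (𝕜 := NNReal)).const_mul ε
    simpa [div_eq_mul_inv] using this
  have hφm : ∀ n, AEStronglyMeasurable (φ n) (volume.restrict Ω) := fun n =>
    (hφ n).continuous.aestronglyMeasurable
  have htm : TendstoInMeasure (volume.restrict Ω) φ atTop a :=
    tendstoInMeasure_of_tendsto_eLpNorm (p := 2) two_ne_zero hφm hm.fn
      (tendsto_of_tendsto_of_tendsto_of_le_of_le tendsto_const_nhds hlim (fun _ => zero_le) h1)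
  obtain ⟨ns, -, hns⟩ := htm.exists_seq_tendsto_ae
  refine (Lp.eLpNorm_lim_le_liminf_eLpNorm (fun n => hφm (ns n)) a hns).trans ?_
  have hb : ∀ n, eLpNorm (φ n) (4 * k : ℕ) (volume.restrict Ω) ≤ C * (eLpNorm G (ENNReal.ofReal q)
        (volume.restrict Ω) + eLpNorm a (ENNReal.ofReal q) (volume.restrict Ω))
        + (C * K + C * K) * ε := by
    intro n
    have hgm := (continuous_classicalGrad (hφ n)).aestronglyMeasurable (μ := volume.restrict Ω)
    have e1 := eLpNorm_le_add_sub hq1 (hφm n) hm.fn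
    have e2 := eLpNorm_le_add_sub hq1 hgm hm.grad
    have e3 := (hK ((hφm n).sub hm.fn)).trans (mul_le_mul_right ((h1 n).trans (hle n)) _)
    have e4 := (hK (hgm.sub hm.grad)).trans (mul_le_mul_right ((h2 n).trans (hle n)) _)
    calc _ ≤ (C : ENNReal) * ((eLpNorm G (ENNReal.ofReal q) (volume.restrict Ω) + K * ε)
          + (eLpNorm a (ENNReal.ofReal q) (volume.restrict Ω) + K * ε)) := by
          refine (hC _ (contDiff_one (hφ n))).trans (mul_le_mul_right (add_le_add ?_ ?_) _)
          · exact (eLpNorm_fderiv_le _ _ _).trans (e2.trans (add_le_add le_rfl e4))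
          · exact e1.trans (add_le_add le_rfl e3)
      _ = _ := by ring
  exact (liminf_le_liminf (Eventually.of_forall fun n => hb (ns n))).trans (by simp)

/-- Local Poincaré inequality for limits of smooth functions. -/
theorem SmoothLimit.local_poincare (hΩ : IsPolygonalDomain Ω) (hD : IsDirichletPart Ω D) :
    ∃ (K R : ℝ) (C : NNReal), 1 ≤ K ∧ 0 < R ∧
      ∀ {a : Plane → ℂ} {G : Plane → CPlane} {f : Plane → ℂ}, MeasTriple Ω a G f →
      SmoothLimit Ω a G f → f =ᵐ[arc D] 0 → ∀ x ∈ closure Ω, ∀ r : ℝ, 0 < r → r ≤ R →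
      ∀ ε : NNReal, 0 < ε → ∃ c : ℂ, ((D ∩ Metric.closedBall x r).Nonempty → c = 0) ∧
        eLpNorm (fun y => a y - c) 2 (volume.restrict (Ω ∩ Metric.ball x r))
          ≤ C * eLpNorm G 1 (volume.restrict (Ω ∩ Metric.ball x (K * r))) + ε := by
  obtain ⟨K, R, C, hK, hR, hC⟩ := exists_local_poincare hΩ hD
  have := isFiniteMeasure_restrict hΩ
  have := isFiniteMeasure_arc hΩ
  obtain ⟨K₁, hK₁⟩ := exists_eLpNorm_le_two (volume.restrict Ω) (p := 1) (by norm_num) le_rfl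
  obtain ⟨K₂, hK₂⟩ := exists_eLpNorm_le_two (arc (frontier Ω)) (p := 1) (by norm_num) le_rfl
  refine ⟨K, R, NNReal.sqrt C, hK, hR, fun {a G f} hm h h0 x hx r hr hrR ε hε => ?_⟩
  set M : NNReal := NNReal.sqrt C * K₁ + NNReal.sqrt C * K₂ + 1 with hM
  obtain ⟨φ, hφ, h1, h2, h3⟩ := h (ε / M) (by positivity)
  set δ : NNReal := ε / M with hδ
  have hδε : (M : ENNReal) * δ = ε := by
    rw [← ENNReal.coe_mul, hδ, mul_div_cancel₀ _ (by positivity)]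
  set μr := volume.restrict (Ω ∩ Metric.ball x r) with hμr
  set μK := volume.restrict (Ω ∩ Metric.ball x (K * r)) with hμK
  have hler : μr ≤ volume.restrict Ω := Measure.restrict_mono Set.inter_subset_left le_rfl
  have hleK : μK ≤ volume.restrict Ω := Measure.restrict_mono Set.inter_subset_left le_rfl
  have hφm := hφ.continuous.aestronglyMeasurable (μ := volume.restrict Ω)
  have hgm := (continuous_classicalGrad hφ).aestronglyMeasurable (μ := volume.restrict Ω)
  have e5 : eLpNorm (fun x => classicalGrad φ x - G x) 1 μK ≤ K₁ * δ :=
    (eLpNorm_mono_measure _ hleK).trans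
      ((hK₁ (hgm.sub hm.grad)).trans (mul_le_mul_right h2 _))
  have e6 : eLpNorm (fderiv ℝ φ) 1 μK ≤ eLpNorm G 1 μK + K₁ * δ :=
    (eLpNorm_fderiv_le φ 1 _).trans ((eLpNorm_le_add_sub (p := 1) (by norm_num)
      (hgm.mono_measure hleK) (hm.grad.mono_measure hleK)).trans (add_le_add le_rfl e5))
  have key : ∀ (c : ℂ) (T : ENNReal), T ≤ K₂ * δ →
      eLpNorm (fun y => φ y - c) 2 μr ≤ NNReal.sqrt C * (eLpNorm (fderiv ℝ φ) 1 μK + T) →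
      eLpNorm (fun y => a y - c) 2 μr ≤ NNReal.sqrt C * eLpNorm G 1 μK + ε := by
    intro c T hT hc
    have e1 := eLpNorm_le_add_sub' (p := 2) (by norm_num)
      ((hφm.mono_measure hler).sub (aestronglyMeasurable_const (b := c)))
      ((hm.fn.mono_measure hler).sub (aestronglyMeasurable_const (b := c)))
    have e2 : eLpNorm (fun y => (φ y - c) - (a y - c)) 2 μr ≤ δ := by
      refine le_trans ?_ h1
      simp only [sub_sub_sub_cancel_right]
      exact eLpNorm_mono_measure _ hler
    calc eLpNorm (fun y => a y - c) 2 μr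
        ≤ NNReal.sqrt C * ((eLpNorm G 1 μK + K₁ * δ) + K₂ * δ) + δ := by
          refine e1.trans (add_le_add (hc.trans ?_) e2)
          exact mul_le_mul_right (add_le_add e6 hT) _
      _ = NNReal.sqrt C * eLpNorm G 1 μK + M * δ := by
          rw [hM]; push_cast; ring
      _ = _ := by rw [hδε]
  -- The constant belongs to the approximant `φ` and varies with `ε`, which is why the error `ε` is
  -- kept in the conclusion.
  obtain ⟨⟨c, hc⟩, hDc⟩ := hC x hx r hr hrR φ (contDiff_one hφ)
  by_cases hne : (D ∩ Metric.closedBall x r).Nonempty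
  · refine ⟨0, fun _ => rfl, ?_⟩
    have e4 := eLpNorm_two_le_of_lintegral_sq_le (hDc hne)
    rw [← eLpNorm_one_eq_lintegral_enorm, ← eLpNorm_one_eq_lintegral_enorm] at e4
    refine key 0 _ ?_ (by simpa using e4)
    calc _ ≤ eLpNorm φ 1 (arc D) :=
          eLpNorm_mono_measure _ (Measure.restrict_mono Set.inter_subset_left le_rfl)
      _ = eLpNorm (fun x => φ x - f x) 1 (arc D) := by
          refine eLpNorm_congr_ae ?_
          filter_upwards [h0] with x hx
          simp [hx]
      _ ≤ eLpNorm (fun x => φ x - f x) 1 (arc (frontier Ω)) :=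
          eLpNorm_mono_measure _ (Measure.restrict_mono hD.subset le_rfl)
      _ ≤ K₂ * δ := (hK₂ (hφ.continuous.aestronglyMeasurable.sub hm.trace)).trans
          (mul_le_mul_right h3 _)
  · refine ⟨c, fun h => absurd h hne, key c 0 zero_le ?_⟩
    rw [add_zero]
    have e4 := eLpNorm_two_le_of_lintegral_sq_le hc
    rwa [← eLpNorm_one_eq_lintegral_enorm] at e4

end RhombiSlits

namespace RhombiSlits

variable {Ω D : Set Plane}

/-! ### The space `V₀` -/

theorem h1Fn_add (u v : H1 Ω ℂ) :
    h1Fn (u + v) =ᵐ[volume.restrict Ω] fun x => h1Fn u x + h1Fn v x :=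
  Lp.coeFn_add (h1Fn u) (h1Fn v)

theorem h1Grad_add (u v : H1 Ω ℂ) :
    h1Grad (u + v) =ᵐ[volume.restrict Ω] fun x => h1Grad u x + h1Grad v x :=
  Lp.coeFn_add (h1Grad u) (h1Grad v)

theorem h1Fn_smul (c : ℂ) (u : H1 Ω ℂ) :
    h1Fn (c • u) =ᵐ[volume.restrict Ω] fun x => c * h1Fn u x :=
  Lp.coeFn_smul c (h1Fn u)

theorem h1Grad_smul (c : ℂ) (u : H1 Ω ℂ) :
    h1Grad (c • u) =ᵐ[volume.restrict Ω] fun x => c • h1Grad u x :=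
  Lp.coeFn_smul c (h1Grad u)

theorem IsTrace.add {u v : H1 Ω ℂ} {f g : Lp ℂ 2 (arc (frontier Ω))} (hu : IsTrace u f)
    (hv : IsTrace v g) : IsTrace (u + v) (f + g) := by
  rw [isTrace_iff_smoothLimit] at *
  have hm := measTriple_h1 u f
  have hm' := measTriple_h1 v g
  exact (hu.add hv hm.fn hm'.fn hm.grad hm'.grad hm.trace hm'.trace).congr (h1Fn_add u v).symm
    (h1Grad_add u v).symm (Lp.coeFn_add f g).symm

theorem IsTrace.smul {u : H1 Ω ℂ} {f : Lp ℂ 2 (arc (frontier Ω))} (hu : IsTrace u f) (c : ℂ) :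
    IsTrace (c • u) (c • f) := by
  rw [isTrace_iff_smoothLimit] at *
  exact (hu.const_mul c).congr (h1Fn_smul c u).symm (h1Grad_smul c u).symm
    (Lp.coeFn_smul c f).symm

theorem IsTrace.sub {u v : H1 Ω ℂ} {f g : Lp ℂ 2 (arc (frontier Ω))} (hu : IsTrace u f)
    (hv : IsTrace v g) : IsTrace (u - v) (f - g) := by
  have := hu.add (hv.smul (-1))
  rwa [neg_one_smul, neg_one_smul, ← sub_eq_add_neg, ← sub_eq_add_neg] at this

theorem isTrace_zero : IsTrace (0 : H1 Ω ℂ) 0 := by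
  rw [isTrace_iff_smoothLimit]
  exact (smoothLimit_const Ω 0).congr (Lp.coeFn_zero ℂ 2 (volume.restrict Ω)).symm
    (Lp.coeFn_zero CPlane 2 (volume.restrict Ω)).symm (Lp.coeFn_zero ℂ 2 (arc (frontier Ω))).symm

theorem arc_le_frontier (hD : D ⊆ frontier Ω) : arc D ≤ arc (frontier Ω) :=
  Measure.restrict_mono hD le_rfl

theorem norm_h1_sq (u : H1 Ω ℂ) : ‖u‖ ^ 2 = ‖h1Fn u‖ ^ 2 + ‖h1Grad u‖ ^ 2 :=
  WithLp.prod_norm_sq_eq_of_L2 (u : L2Pair Ω ℂ)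

theorem norm_h1Fn_le (u : H1 Ω ℂ) : ‖h1Fn u‖ ≤ ‖u‖ := by
  refine le_of_sq_le_sq ?_ (norm_nonneg _)
  rw [norm_h1_sq]; nlinarith [sq_nonneg ‖h1Grad u‖]

theorem norm_h1Grad_le (u : H1 Ω ℂ) : ‖h1Grad u‖ ≤ ‖u‖ := by
  refine le_of_sq_le_sq ?_ (norm_nonneg _)
  rw [norm_h1_sq]; nlinarith [sq_nonneg ‖h1Fn u‖]

theorem norm_h1_le (u : H1 Ω ℂ) : ‖u‖ ≤ ‖h1Fn u‖ + ‖h1Grad u‖ := by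
  refine le_of_sq_le_sq ?_ (by positivity)
  rw [norm_h1_sq]; nlinarith [norm_nonneg (h1Fn u), norm_nonneg (h1Grad u)]

/-- The trace is bounded by the `H¹` norm. -/
theorem exists_norm_trace_le (hΩ : IsPolygonalDomain Ω) :
    ∃ C : NNReal, ∀ {u : H1 Ω ℂ} {f : Lp ℂ 2 (arc (frontier Ω))}, IsTrace u f →
      ‖f‖ ≤ C * ‖u‖ := by
  obtain ⟨C, hC⟩ := SmoothLimit.trace_le hΩ
  refine ⟨C * 2, fun {u f} h => ?_⟩
  have := hC (measTriple_h1 u f) (isTrace_iff_smoothLimit.1 h)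
  rw [← Lp.enorm_def, ← Lp.enorm_def, ← Lp.enorm_def, ← ofReal_norm, ← ofReal_norm, ← ofReal_norm,
    ← ENNReal.ofReal_add (norm_nonneg _) (norm_nonneg _), ← ENNReal.ofReal_coe_nnreal,
    ← ENNReal.ofReal_mul C.coe_nonneg, ENNReal.ofReal_le_ofReal_iff (by positivity)] at this
  have h1 := norm_h1Fn_le u
  have h2 := norm_h1Grad_le u
  calc ‖f‖ ≤ C * (‖h1Fn u‖ + ‖h1Grad u‖) := this
    _ ≤ C * (‖u‖ + ‖u‖) := by gcongr
    _ = _ := by push_cast; ring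

/-- `V₀`: the functions of `H¹(Ω; ℂ)` whose trace vanishes on `D`. -/
def V0 (Ω D : Set Plane) (hD : D ⊆ frontier Ω) : Submodule ℂ (H1 Ω ℂ) where
  carrier := {u | ∃ f : Lp ℂ 2 (arc (frontier Ω)), IsTrace u f ∧ f =ᵐ[arc D] 0}
  zero_mem' := ⟨0, isTrace_zero, ae_mono (arc_le_frontier hD) (Lp.coeFn_zero _ _ _)⟩
  add_mem' := by
    rintro u v ⟨f, hf, hf0⟩ ⟨g, hg, hg0⟩
    refine ⟨f + g, hf.add hg, ?_⟩
    filter_upwards [ae_mono (arc_le_frontier hD) (Lp.coeFn_add f g), hf0, hg0] with x h1 h2 h3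
    rw [h1, Pi.add_apply, h2, h3]
    simp
  smul_mem' := by
    rintro c u ⟨f, hf, hf0⟩
    refine ⟨c • f, hf.smul c, ?_⟩
    filter_upwards [ae_mono (arc_le_frontier hD) (Lp.coeFn_smul c f), hf0] with x h1 h2
    rw [h1, Pi.smul_apply, h2]
    simp

/-- Limits of limits are limits; the completeness of `V₀` rests on this. -/
theorem SmoothLimit.of_approx {a : Plane → ℂ} {G : Plane → CPlane} {f : Plane → ℂ}
    (hm : MeasTriple Ω a G f)
    (h : ∀ ε : NNReal, 0 < ε → ∃ (a' : Plane → ℂ) (G' : Plane → CPlane) (f' : Plane → ℂ),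
      MeasTriple Ω a' G' f' ∧ SmoothLimit Ω a' G' f' ∧
      eLpNorm (fun x => a' x - a x) 2 (volume.restrict Ω) ≤ ε ∧
      eLpNorm (fun x => G' x - G x) 2 (volume.restrict Ω) ≤ ε ∧
      eLpNorm (fun x => f' x - f x) 2 (arc (frontier Ω)) ≤ ε) : SmoothLimit Ω a G f := by
  intro ε hε
  obtain ⟨a', G', f', hm', hs, h1, h2, h3⟩ := h (ε / 2) (by positivity)
  obtain ⟨φ, hφ, k1, k2, k3⟩ := hs (ε / 2) (by positivity)
  have hsum : ((ε / 2 : NNReal) : ENNReal) + ((ε / 2 : NNReal) : ENNReal) = ε := by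
    rw [← ENNReal.coe_add, add_halves]
  refine ⟨φ, hφ, ?_, ?_, ?_⟩
  · rw [← hsum]
    refine le_trans (le_of_eq ?_) ((eLpNorm_add_le (hφ.continuous.aestronglyMeasurable.sub hm'.fn)
      (hm'.fn.sub hm.fn) (by norm_num)).trans (add_le_add k1 h1))
    congr 1; ext x; simp
  · rw [← hsum]
    refine le_trans (le_of_eq ?_) ((eLpNorm_add_le
      ((continuous_classicalGrad hφ).aestronglyMeasurable.sub hm'.grad)
      (hm'.grad.sub hm.grad) (by norm_num)).trans (add_le_add k2 h2))
    congr 1; ext x : 1; simp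
  · rw [← hsum]
    refine le_trans (le_of_eq ?_) ((eLpNorm_add_le
      (hφ.continuous.aestronglyMeasurable.sub hm'.trace)
      (hm'.trace.sub hm.trace) (by norm_num)).trans (add_le_add k3 h3))
    congr 1; ext x; simp

theorem exists_nat_enorm_sub_le {E : Type*} [NormedAddCommGroup E] {u : ℕ → E} {v : E}
    (h : Tendsto u atTop (𝓝 v)) {ε : NNReal} (hε : 0 < ε) :
    ∀ᶠ n in atTop, ‖u n - v‖ₑ ≤ ε := by
  have := Metric.tendsto_nhds.1 h ε (by exact_mod_cast hε)
  filter_upwards [this] with n hn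
  rw [dist_eq_norm] at hn
  rw [enorm_eq_nnnorm, ENNReal.coe_le_coe]
  exact_mod_cast hn.le

/-- A Cauchy sequence of functions whose traces vanish on `D` converges in `H¹`, and the trace of
the limit vanishes on `D`. -/
theorem exists_limit_of_cauchySeq (hΩ : IsPolygonalDomain Ω) (hD : D ⊆ frontier Ω)
    {w : ℕ → H1 Ω ℂ} (hw : CauchySeq w) {f : ℕ → Lp ℂ 2 (arc (frontier Ω))}
    (hf : ∀ n, IsTrace (w n) (f n)) (hf0 : ∀ n, f n =ᵐ[arc D] 0) :
    ∃ (u : H1 Ω ℂ) (g : Lp ℂ 2 (arc (frontier Ω))), IsTrace u g ∧ g =ᵐ[arc D] 0 ∧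
      Tendsto w atTop (𝓝 u) := by
  obtain ⟨C, hC⟩ := exists_norm_trace_le hΩ
  have hwc : CauchySeq fun n => (w n : L2Pair Ω ℂ) := hw.map uniformContinuous_subtype_val
  obtain ⟨p, hp⟩ := cauchySeq_tendsto_of_complete hwc
  -- The trace inequality transfers the Cauchy property to the traces, so the limit function comes
  -- with a limit trace.
  have hfc : CauchySeq f := by
    rw [Metric.cauchySeq_iff] at hw ⊢
    intro ε hε
    obtain ⟨N, hN⟩ := hw (ε / (C + 1)) (by positivity)
    refine ⟨N, fun m hm n hn => ?_⟩
    have h1 := hC ((hf m).sub (hf n))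
    have h2 : ‖w m - w n‖ < ε / (C + 1) := by
      rw [← dist_eq_norm]
      exact hN m hm n hn
    rw [dist_eq_norm]
    calc ‖f m - f n‖ ≤ C * ‖w m - w n‖ := h1
      _ ≤ (C + 1) * ‖w m - w n‖ := by gcongr; linarith
      _ < (C + 1) * (ε / (C + 1)) := by gcongr
      _ = ε := by field_simp
  obtain ⟨g, hg⟩ := cauchySeq_tendsto_of_complete hfc
  have hp1 : Tendsto (fun n => h1Fn (w n)) atTop (𝓝 p.fst) :=
    ((WithLp.fstL 2 ℂ _ _).continuous.tendsto p).comp hp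
  have hp2 : Tendsto (fun n => h1Grad (w n)) atTop (𝓝 p.snd) :=
    ((WithLp.sndL 2 ℂ _ _).continuous.tendsto p).comp hp
  have hsl : SmoothLimit Ω p.fst p.snd g := by
    refine SmoothLimit.of_approx ⟨Lp.aestronglyMeasurable _, Lp.aestronglyMeasurable _,
      Lp.aestronglyMeasurable _⟩ fun ε hε => ?_
    obtain ⟨n, ⟨h1, h2⟩, h3⟩ := (((exists_nat_enorm_sub_le hp1 hε).and
      (exists_nat_enorm_sub_le hp2 hε)).and (exists_nat_enorm_sub_le hg hε)).exists
    refine ⟨h1Fn (w n), h1Grad (w n), f n, measTriple_h1 _ _,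
      isTrace_iff_smoothLimit.1 (hf n), ?_, ?_, ?_⟩
    · rwa [eLpNorm_coe_sub]
    · rwa [eLpNorm_coe_sub]
    · rwa [eLpNorm_coe_sub]
  obtain ⟨u, hu1, hu2, hu3⟩ := hsl.exists_h1 (Lp.memLp _) (Lp.memLp _) (Lp.memLp g)
  rw [Lp.toLp_coeFn] at hu3
  have hup : (u : L2Pair Ω ℂ) = p := by
    refine WithLp.ofLp_injective 2 (Prod.ext ?_ ?_)
    · exact Lp.ext hu1
    · exact Lp.ext hu2
  have hg0 : g =ᵐ[arc D] 0 := by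
    have : eLpNorm g 2 (arc D) = 0 := by
      rw [← nonpos_iff_eq_zero]
      refine le_of_forall_eps (K := 1) (by simp) fun ε hε => ?_
      obtain ⟨n, h3⟩ := (exists_nat_enorm_sub_le hg hε).exists
      rw [zero_add, one_mul]
      rw [← eLpNorm_coe_sub] at h3
      refine le_trans ?_ ((eLpNorm_mono_measure _ (arc_le_frontier hD)).trans h3)
      rw [← eLpNorm_neg]
      refine (eLpNorm_congr_ae ?_).le
      filter_upwards [hf0 n] with x hx
      simp [hx]
    rwa [eLpNorm_eq_zero_iff ((Lp.aestronglyMeasurable g).mono_measure (arc_le_frontier hD))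
      two_ne_zero] at this
  refine ⟨u, g, hu3, hg0, ?_⟩
  rw [tendsto_subtype_rng, hup]
  exact hp

theorem completeSpace_V0 (hΩ : IsPolygonalDomain Ω) (hD : D ⊆ frontier Ω) :
    CompleteSpace (V0 Ω D hD) := by
  refine Metric.complete_of_cauchySeq_tendsto fun w hw => ?_
  choose f hf hf0 using fun n => (w n).2
  obtain ⟨u, g, hu, hg, hlim⟩ := exists_limit_of_cauchySeq hΩ hD
    (hw.map uniformContinuous_subtype_val) hf hf0
  refine ⟨⟨u, g, hu, hg⟩, ?_⟩
  rw [tendsto_subtype_rng]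
  exact hlim

/-- Every function of `H¹(Ω; ℝ)` with a trace can be regarded as complex valued. -/
theorem exists_complexification {u : H1 Ω ℝ} {f : Lp ℝ 2 (arc (frontier Ω))} (h : IsTrace u f) :
    ∃ (U : H1 Ω ℂ) (F : Lp ℂ 2 (arc (frontier Ω))), IsTrace U F ∧ ‖U‖ = ‖u‖ ∧
      F =ᵐ[arc (frontier Ω)] fun x => (f x : ℂ) := by
  set J : EuclideanSpace ℝ (Fin 2) → CPlane := fun v => WithLp.toLp 2 fun i => (v i : ℂ) with hJ
  have hJn : ∀ v, ‖J v‖ = ‖v‖ := fun v => by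
    simp [hJ, EuclideanSpace.norm_eq]
  have hJsub : ∀ v w, J (v - w) = J v - J w := fun v w => by
    ext i; simp [hJ]
  have hJc : Continuous J := by
    refine (PiLp.continuous_toLp 2 _).comp (continuous_pi fun i => ?_)
    exact Complex.continuous_ofReal.comp (by fun_prop)
  have ha : MemLp (fun x => (h1Fn u x : ℂ)) 2 (volume.restrict Ω) :=
    (Lp.memLp (h1Fn u)).ofReal
  have hG : MemLp (fun x => J (h1Grad u x)) 2 (volume.restrict Ω) :=
    (memLp_congr_norm (hJc.comp_aestronglyMeasurable (Lp.aestronglyMeasurable _))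
      (Lp.aestronglyMeasurable _) (ae_of_all _ fun x => hJn _)).2 (Lp.memLp (h1Grad u))
  have hF : MemLp (fun x => (f x : ℂ)) 2 (arc (frontier Ω)) := (Lp.memLp f).ofReal
  have hs : SmoothLimit Ω (fun x => (h1Fn u x : ℂ)) (fun x => J (h1Grad u x))
      fun x => (f x : ℂ) := by
    obtain ⟨φ, hφ, h1, h2, h3⟩ := h
    intro ε hε
    have hε' : (0 : ENNReal) < ε := by exact_mod_cast hε
    obtain ⟨n, ⟨hn1, hn2⟩, hn3⟩ := (((h1.eventually (gt_mem_nhds hε')).and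
      (h2.eventually (gt_mem_nhds hε'))).and (h3.eventually (gt_mem_nhds hε'))).exists
    refine ⟨fun x => (φ n x : ℂ), Complex.ofRealCLM.contDiff.comp (hφ n), ?_, ?_, ?_⟩
    · refine le_trans (eLpNorm_mono fun x => ?_) hn1.le
      rw [← Complex.ofReal_sub, Complex.norm_real]
    · refine le_trans (eLpNorm_mono fun x => ?_) hn2.le
      have : classicalGrad (fun x => (φ n x : ℂ)) x = J (classicalGrad (φ n) x) := by
        ext i
        have hd := (Complex.ofRealCLM.hasFDerivAt.comp x
          ((hφ n).differentiable (by simp) x).hasFDerivAt).fderiv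
        simp only [classicalGrad, pderiv, hJ]
        change fderiv ℝ (Complex.ofRealCLM ∘ φ n) x _ = _
        rw [hd]
        rfl
      rw [this, ← hJsub, hJn]
    · refine le_trans (eLpNorm_mono fun x => ?_) hn3.le
      rw [← Complex.ofReal_sub, Complex.norm_real]
  obtain ⟨U, hU1, hU2, hU3⟩ := hs.exists_h1 ha hG hF
  refine ⟨U, _, hU3, ?_, hF.coeFn_toLp⟩
  have e1 : ‖h1Fn U‖ = ‖h1Fn u‖ := by
    rw [Lp.norm_def, Lp.norm_def]
    congr 1
    refine eLpNorm_congr_norm_ae ?_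
    filter_upwards [hU1] with x hx
    rw [hx, Complex.norm_real]
  have e2 : ‖h1Grad U‖ = ‖h1Grad u‖ := by
    rw [Lp.norm_def, Lp.norm_def]
    congr 1
    refine eLpNorm_congr_norm_ae ?_
    filter_upwards [hU2] with x hx
    rw [hx, hJn]
  have e3 : ‖u‖ ^ 2 = ‖h1Fn u‖ ^ 2 + ‖h1Grad u‖ ^ 2 :=
    WithLp.prod_norm_sq_eq_of_L2 (u : L2Pair Ω ℝ)
  have e4 := norm_h1_sq U
  rw [e1, e2, ← e3] at e4
  exact (sq_eq_sq₀ (norm_nonneg _) (norm_nonneg _)).1 e4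

end RhombiSlits

namespace RhombiSlits

variable {Ω D : Set Plane}

/-! ### Diagonal sesquilinear forms -/

/-- The pointwise form `∑ᵢ mᵢ aᵢ conj bᵢ`. -/
noncomputable def diagForm (m : Fin 2 → ℂ) (a b : CPlane) : ℂ := ∑ i, m i * a i * star (b i)

theorem norm_diagForm_le {m : Fin 2 → ℂ} {M : ℝ} (hm : ∀ i, ‖m i‖ ≤ M) (a b : CPlane) :
    ‖diagForm m a b‖ ≤ M * ‖a‖ * ‖b‖ := by
  have hM : 0 ≤ M := (norm_nonneg _).trans (hm 0)
  have h1 : ‖diagForm m a b‖ ≤ M * (‖a 0‖ * ‖b 0‖ + ‖a 1‖ * ‖b 1‖) := by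
    rw [diagForm, Fin.sum_univ_two]
    refine (norm_add_le _ _).trans ?_
    simp only [norm_mul, norm_star]
    nlinarith [mul_le_mul_of_nonneg_right (hm 0) (mul_nonneg (norm_nonneg (a 0))
      (norm_nonneg (b 0))), mul_le_mul_of_nonneg_right (hm 1) (mul_nonneg (norm_nonneg (a 1))
      (norm_nonneg (b 1)))]
  have h2 : ‖a 0‖ * ‖b 0‖ + ‖a 1‖ * ‖b 1‖ ≤ ‖a‖ * ‖b‖ := by
    rw [EuclideanSpace.norm_eq, EuclideanSpace.norm_eq, ← Real.sqrt_mul (by positivity)]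
    refine Real.le_sqrt_of_sq_le ?_
    simp only [Fin.sum_univ_two]
    nlinarith [sq_nonneg (‖a 0‖ * ‖b 1‖ - ‖a 1‖ * ‖b 0‖)]
  rw [mul_assoc]
  exact h1.trans (mul_le_mul_of_nonneg_left h2 hM)

theorem diagForm_add_left (m : Fin 2 → ℂ) (a a' b : CPlane) :
    diagForm m (a + a') b = diagForm m a b + diagForm m a' b := by
  simp only [diagForm, Fin.sum_univ_two, PiLp.add_apply]; ring

theorem diagForm_smul_left (m : Fin 2 → ℂ) (c : ℂ) (a b : CPlane) :
    diagForm m (c • a) b = c * diagForm m a b := by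
  simp only [diagForm, Fin.sum_univ_two, PiLp.smul_apply, smul_eq_mul]; ring

theorem im_diagForm_self {m : Fin 2 → ℂ} {ε : ℝ} (hm : ∀ i, (m i).im = ε) (a : CPlane) :
    (diagForm m a a).im = ε * ‖a‖ ^ 2 := by
  have : ∀ i, (m i * a i * star (a i)).im = ε * ‖a i‖ ^ 2 := fun i => by
    rw [mul_assoc, Complex.star_def, Complex.mul_conj, Complex.im_mul_ofReal, hm,
      Complex.normSq_eq_norm_sq]
  rw [diagForm, Complex.im_sum, EuclideanSpace.norm_sq_eq, Finset.mul_sum]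
  exact Finset.sum_congr rfl fun i _ => this i

/-- The pointwise inequality behind the Caccioppoli estimate. -/
theorem le_im_diagForm_sub {m : Fin 2 → ℂ} {M ε : ℝ} (hε : 0 < ε) (hm : ∀ i, ‖m i‖ ≤ M)
    (him : ∀ i, (m i).im = ε) (G Z F : CPlane) (v : ℂ) (z : ℝ) (w : CPlane)
    (hw : w = ((z ^ 2 : ℝ) : ℂ) • G + v • ((2 * z : ℝ) : ℂ) • Z) :
    ε / 2 * (z ^ 2 * ‖G‖ ^ 2) - (4 * M ^ 2 / ε + 1 / ε + 1) * (‖v‖ ^ 2 * ‖Z‖ ^ 2 + z ^ 2 * ‖F‖ ^ 2)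
      ≤ (diagForm m w G - diagForm 1 w F).im := by
  -- At a point, `w` is the gradient of the test function `ζ²(η - c)`, with `G = ∇η`, `v = η - c`,
  -- `z = ζ` and `Z = ∇ζ`.
  have e1 : diagForm m w G = ((z ^ 2 : ℝ) : ℂ) * diagForm m G G
      + v * ((2 * z : ℝ) : ℂ) * diagForm m Z G := by
    rw [hw, diagForm_add_left, diagForm_smul_left, diagForm_smul_left, diagForm_smul_left, mul_assoc]
  have e2 : (diagForm m w G).im = ε * (z ^ 2 * ‖G‖ ^ 2)
      + (v * ((2 * z : ℝ) : ℂ) * diagForm m Z G).im := by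
    rw [e1, Complex.add_im, Complex.im_ofReal_mul, im_diagForm_self him]; ring
  have e3 : |(v * ((2 * z : ℝ) : ℂ) * diagForm m Z G).im| ≤ 2 * |z| * ‖v‖ * (M * ‖Z‖ * ‖G‖) := by
    refine (Complex.abs_im_le_norm _).trans ?_
    rw [norm_mul, norm_mul, Complex.norm_real, Real.norm_eq_abs, abs_mul, abs_two]
    refine (mul_le_mul_of_nonneg_left (norm_diagForm_le hm Z G) (by positivity)).trans_eq ?_
    ring
  have e4 : |(diagForm 1 w F).im| ≤ (z ^ 2 * ‖G‖ + 2 * |z| * ‖v‖ * ‖Z‖) * ‖F‖ := by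
    refine (Complex.abs_im_le_norm _).trans ((norm_diagForm_le (M := 1) (by simp) w F).trans ?_)
    rw [one_mul]
    refine mul_le_mul_of_nonneg_right ?_ (norm_nonneg _)
    rw [hw]
    refine (norm_add_le _ _).trans (le_of_eq ?_)
    rw [norm_smul, norm_smul, norm_smul, Complex.norm_real, Complex.norm_real, Real.norm_eq_abs,
      Real.norm_eq_abs, abs_mul, abs_two, abs_of_nonneg (sq_nonneg z)]
    ring
  rw [Complex.sub_im, e2]
  have f1 := (abs_le.1 e3).1
  have f2 := (abs_le.1 e4).2
  have hz : z ^ 2 = |z| ^ 2 := (sq_abs z).symm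
  rw [hz] at f2 ⊢
  set y := |z| * ‖G‖ with hy
  set t := ‖v‖ * ‖Z‖ with ht
  set h := |z| * ‖F‖ with hh
  -- Young's inequality. This term and the next each use up a quarter of the coercive term `ε y²`;
  -- half of it survives.
  have g1 : 2 * |z| * ‖v‖ * (M * ‖Z‖ * ‖G‖) ≤ ε / 4 * y ^ 2 + 4 * M ^ 2 / ε * t ^ 2 := by
    have : 0 ≤ (ε / 2 * y - 2 * M * t) ^ 2 / ε := by positivity
    have e : (ε / 2 * y - 2 * M * t) ^ 2 / ε = ε / 4 * y ^ 2 + 4 * M ^ 2 / ε * t ^ 2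
        - 2 * M * t * y := by field_simp; ring
    rw [e] at this
    calc 2 * |z| * ‖v‖ * (M * ‖Z‖ * ‖G‖) = 2 * M * t * y := by rw [hy, ht]; ring
      _ ≤ _ := by linarith
  have g2 : |z| ^ 2 * ‖G‖ * ‖F‖ ≤ ε / 4 * y ^ 2 + 1 / ε * h ^ 2 := by
    have : 0 ≤ (ε / 2 * y - h) ^ 2 / ε := by positivity
    have e : (ε / 2 * y - h) ^ 2 / ε = ε / 4 * y ^ 2 + 1 / ε * h ^ 2 - y * h := by
      field_simp; ring
    rw [e] at this
    calc |z| ^ 2 * ‖G‖ * ‖F‖ = y * h := by rw [hy, hh]; ring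
      _ ≤ _ := by linarith
  have g3 : 2 * |z| * ‖v‖ * ‖Z‖ * ‖F‖ ≤ t ^ 2 + h ^ 2 := by
    calc 2 * |z| * ‖v‖ * ‖Z‖ * ‖F‖ = 2 * t * h := by rw [ht, hh]; ring
      _ ≤ _ := by nlinarith [sq_nonneg (t - h)]
  have p1 : 0 ≤ 1 / ε * t ^ 2 := by positivity
  have p2 : 0 ≤ 4 * M ^ 2 / ε * h ^ 2 := by positivity
  have q1 : |z| ^ 2 * ‖G‖ ^ 2 = y ^ 2 := by rw [hy]; ring
  have q2 : ‖v‖ ^ 2 * ‖Z‖ ^ 2 = t ^ 2 := by rw [ht]; ring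
  have q3 : |z| ^ 2 * ‖F‖ ^ 2 = h ^ 2 := by rw [hh]; ring
  rw [q1, q2, q3]
  nlinarith

theorem integrable_diagForm {μ : Measure Plane} {m : Plane → Fin 2 → ℂ} {M : ℝ}
    (hmm : ∀ i, AEStronglyMeasurable (fun x => m x i) μ) (hm : ∀ x i, ‖m x i‖ ≤ M)
    {G H : Plane → CPlane} (hG : MemLp G 2 μ) (hH : MemLp H 2 μ) :
    Integrable (fun x => diagForm (m x) (G x) (H x)) μ := by
  have hM : 0 ≤ M := (norm_nonneg _).trans (hm 0 0)
  have hi : Integrable (fun x => M * (‖G x‖ * ‖H x‖)) μ :=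
    (MemLp.integrable_mul hG.norm hH.norm).const_mul M
  refine hi.mono ?_ (ae_of_all _ fun x => ?_)
  · refine Finset.aestronglyMeasurable_fun_sum _ fun i _ => ?_
    have h1 : AEStronglyMeasurable (fun x => G x i) μ :=
      (EuclideanSpace.proj (𝕜 := ℂ) i : CPlane →L[ℂ] ℂ).continuous.comp_aestronglyMeasurable hG.1
    have h2 : AEStronglyMeasurable (fun x => H x i) μ :=
      (EuclideanSpace.proj (𝕜 := ℂ) i : CPlane →L[ℂ] ℂ).continuous.comp_aestronglyMeasurable hH.1
    exact ((hmm i).mul h1).mul (continuous_star.comp_aestronglyMeasurable h2)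
  · rw [Real.norm_of_nonneg (by positivity), ← mul_assoc]
    exact norm_diagForm_le (hm x) _ _

/-! ### Cut-off functions -/

/-- One fixed bump is translated and rescaled, hence the gradient bound `C/r` with a universal
constant. It is supported in radius `2r`, so the gradient vanishes as well outside radius `3r`. -/
theorem exists_cutoff : ∃ C : ℝ, 0 < C ∧ ∀ (x : Plane) (r : ℝ), 0 < r → ∃ ζ : Plane → ℝ,
    ContDiff ℝ ∞ ζ ∧ HasCompactSupport ζ ∧ (∀ y, 0 ≤ ζ y ∧ ζ y ≤ 1) ∧
    (∀ y ∈ Metric.closedBall x r, ζ y = 1) ∧ (∀ y ∉ Metric.ball x (3 * r), ζ y = 0 ∧ gradC ζ y = 0) ∧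
    ∀ y, ‖gradC ζ y‖ ≤ C / r := by
  set b : ContDiffBump (0 : Plane) := ⟨1, 2, by norm_num, by norm_num⟩ with hb
  obtain ⟨M, hM⟩ := exists_bound_gradC (ψ := b) b.contDiff b.hasCompactSupport
  refine ⟨M + 1, by positivity, fun x r hr => ?_⟩
  set ζ : Plane → ℝ := fun y => b (r⁻¹ • (y - x)) with hζ
  have hcd : ContDiff ℝ ∞ ζ := b.contDiff.comp ((contDiff_id.sub contDiff_const).const_smul _)
  have hnorm : ∀ y, ‖r⁻¹ • (y - x)‖ = dist y x / r := fun y => by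
    rw [norm_smul, norm_inv, Real.norm_of_nonneg hr.le, dist_eq_norm]
    ring
  have hz : ∀ y, y ∉ Metric.closedBall x (2 * r) → ζ y = 0 := fun y hy => by
    refine b.zero_of_le_dist ?_
    rw [dist_zero_right, hnorm]
    rw [Metric.mem_closedBall, not_le] at hy
    rw [le_div_iff₀ hr]
    exact hy.le
  have hgrad : ∀ y, gradC ζ y = ((r⁻¹ : ℝ) : ℂ) • gradC b (r⁻¹ • (y - x)) := by
    intro y
    have h1 : HasFDerivAt (fun y : Plane => r⁻¹ • (y - x))
        (r⁻¹ • ContinuousLinearMap.id ℝ Plane) y :=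
      ((hasFDerivAt_id y).sub_const x).const_smul r⁻¹
    have h2 : HasFDerivAt b (fderiv ℝ b (r⁻¹ • (y - x))) (r⁻¹ • (y - x)) :=
      (b.contDiff (n := 1).differentiable (by norm_num) _).hasFDerivAt
    have h3 := (h2.comp y h1).fderiv
    ext i
    have h4 : pderiv ζ i y = r⁻¹ * pderiv b i (r⁻¹ • (y - x)) := by
      rw [pderiv, pderiv]
      change fderiv ℝ (b ∘ fun y => r⁻¹ • (y - x)) y _ = _
      rw [h3]
      simp
    simp only [gradC, PiLp.smul_apply, smul_eq_mul, h4, Complex.ofReal_mul]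
  have hts : tsupport ζ ⊆ Metric.closedBall x (2 * r) := by
    refine closure_minimal (fun y hy => ?_) Metric.isClosed_closedBall
    by_contra h
    exact hy (hz y h)
  refine ⟨ζ, hcd, HasCompactSupport.of_support_subset_isCompact
    (isCompact_closedBall x (2 * r)) (subset_closure.trans hts), fun y => ⟨b.nonneg, b.le_one⟩,
    fun y hy => ?_, fun y hy => ?_, fun y => ?_⟩
  · refine b.one_of_mem_closedBall ?_
    rw [mem_closedBall_zero_iff, hnorm, div_le_iff₀ hr]
    simpa [hb] using hy
  · have hy2 : y ∉ Metric.closedBall x (2 * r) := fun h => hy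
      (Metric.closedBall_subset_ball (by linarith) h)
    refine ⟨hz y hy2, ?_⟩
    have : fderiv ℝ ζ y = 0 := by
      have := fun h => hy2 (hts (tsupport_fderiv_subset ℝ h))
      exact image_eq_zero_of_notMem_tsupport this
    ext i
    simp [gradC, pderiv, this]
  · rw [hgrad, norm_smul, Complex.norm_real, norm_inv, Real.norm_of_nonneg hr.le, div_eq_inv_mul]
    refine mul_le_mul_of_nonneg_left ((hM _).2.trans ?_) (by positivity)
    linarith

theorem gradC_sq {ζ : Plane → ℝ} (hζ : ContDiff ℝ ∞ ζ) (x : Plane) :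
    gradC (fun y => ζ y ^ 2) x = ((2 * ζ x : ℝ) : ℂ) • gradC ζ x := by
  have hd := ((hζ.differentiable (by simp) x).hasFDerivAt.pow 2).fderiv
  ext i
  have : pderiv (fun y => ζ y ^ 2) i x = 2 * ζ x * pderiv ζ i x := by
    rw [pderiv, hd, pderiv]
    simp
  simp only [gradC, PiLp.smul_apply, smul_eq_mul, this, Complex.ofReal_mul]

end RhombiSlits

namespace RhombiSlits

variable {Ω D : Set Plane}

/-! ### Caccioppoli and Meyers estimates -/

/-- `η` vanishes on `D` and solves `∫ ∑ mᵢ ∂ᵢψ conj ∂ᵢη = ∫ ∑ ∂ᵢψ conj Fᵢ` for all `ψ ∈ V₀`. -/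
structure IsAdjointSolution (Ω D : Set Plane) (m : Plane → Fin 2 → ℂ)
    (F : Lp CPlane 2 (volume.restrict Ω)) (η : H1 Ω ℂ) (f : Lp ℂ 2 (arc (frontier Ω))) : Prop where
  trace : IsTrace η f
  zero : f =ᵐ[arc D] 0
  eq : ∀ (ψ : H1 Ω ℂ) (fψ : Lp ℂ 2 (arc (frontier Ω))), IsTrace ψ fψ → fψ =ᵐ[arc D] 0 →
    ∫ x in Ω, diagForm (m x) (h1Grad ψ x) (h1Grad η x) = ∫ x in Ω, diagForm 1 (h1Grad ψ x) (F x)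

/-- Measurable diagonal coefficients, bounded by `M` and with imaginary part `ε`. -/
structure IsCoefficient (Ω : Set Plane) (m : Plane → Fin 2 → ℂ) (M ε : ℝ) : Prop where
  meas : ∀ i, AEStronglyMeasurable (fun x => m x i) (volume.restrict Ω)
  le : ∀ x i, ‖m x i‖ ≤ M
  im : ∀ x i, (m x i).im = ε

/-- The integrated form of the energy inequality, with a general test function. -/
theorem IsAdjointSolution.integral_le {m : Plane → Fin 2 → ℂ} {M ε : ℝ} (hε : 0 < ε)
    (hm : IsCoefficient Ω m M ε) {F : Lp CPlane 2 (volume.restrict Ω)} {η : H1 Ω ℂ}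
    {f : Lp ℂ 2 (arc (frontier Ω))} (h : IsAdjointSolution Ω D m F η f)
    {ψ : H1 Ω ℂ} {fψ : Lp ℂ 2 (arc (frontier Ω))} (hψ : IsTrace ψ fψ) (hψ0 : fψ =ᵐ[arc D] 0)
    {ζ : Plane → ℝ} {v : Plane → ℂ} {Z : Plane → CPlane}
    (hgrad : ∀ᵐ x ∂(volume.restrict Ω), h1Grad ψ x
      = ((ζ x ^ 2 : ℝ) : ℂ) • h1Grad η x + v x • ((2 * ζ x : ℝ) : ℂ) • Z x)
    (hA : Integrable (fun x => ζ x ^ 2 * ‖h1Grad η x‖ ^ 2) (volume.restrict Ω))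
    (hB : Integrable (fun x => ‖v x‖ ^ 2 * ‖Z x‖ ^ 2 + ζ x ^ 2 * ‖F x‖ ^ 2) (volume.restrict Ω)) :
    ∫⁻ x in Ω, ENNReal.ofReal (ζ x ^ 2 * ‖h1Grad η x‖ ^ 2)
      ≤ ENNReal.ofReal (2 / ε * (4 * M ^ 2 / ε + 1 / ε + 1)) *
        ∫⁻ x in Ω, ENNReal.ofReal (‖v x‖ ^ 2 * ‖Z x‖ ^ 2 + ζ x ^ 2 * ‖F x‖ ^ 2) := by
  set C := 4 * M ^ 2 / ε + 1 / ε + 1 with hC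
  have i1 := integrable_diagForm hm.meas hm.le (Lp.memLp (h1Grad ψ)) (Lp.memLp (h1Grad η))
  have i2 := integrable_diagForm (μ := volume.restrict Ω) (m := fun _ => 1) (M := 1)
    (fun _ => aestronglyMeasurable_const) (by simp) (Lp.memLp (h1Grad ψ)) (Lp.memLp F)
  -- Only the imaginary part of the tested equation is used: the real parts of the coefficients have
  -- no sign.
  have hzero : ∫ x in Ω, (diagForm (m x) (h1Grad ψ x) (h1Grad η x)
      - diagForm 1 (h1Grad ψ x) (F x)).im = 0 := by
    have := h.eq ψ fψ hψ hψ0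
    rw [← sub_eq_zero, ← integral_sub i1 i2] at this
    have h2 := integral_im (i1.sub i2)
    simp only [Pi.sub_apply, this] at h2
    simpa using h2
  have hle : ∫ x in Ω, (ε / 2 * (ζ x ^ 2 * ‖h1Grad η x‖ ^ 2)
      - C * (‖v x‖ ^ 2 * ‖Z x‖ ^ 2 + ζ x ^ 2 * ‖F x‖ ^ 2)) ≤ 0 := by
    rw [← hzero]
    refine integral_mono_ae ((hA.const_mul _).sub (hB.const_mul _)) (i1.sub i2).im ?_
    filter_upwards [hgrad] with x hx
    exact le_im_diagForm_sub hε (hm.le x) (hm.im x) _ _ _ _ _ _ hx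
  rw [integral_sub (hA.const_mul _) (hB.const_mul _), integral_const_mul, integral_const_mul] at hle
  rw [← ofReal_integral_eq_lintegral_ofReal hA (ae_of_all _ fun x => by positivity),
    ← ofReal_integral_eq_lintegral_ofReal hB (ae_of_all _ fun x => by positivity),
    ← ENNReal.ofReal_mul (by positivity)]
  refine ENNReal.ofReal_le_ofReal ?_
  have : (∫ x in Ω, ζ x ^ 2 * ‖h1Grad η x‖ ^ 2) = 2 / ε * (ε / 2 *
      ∫ x in Ω, ζ x ^ 2 * ‖h1Grad η x‖ ^ 2) := by field_simp
  rw [this, mul_assoc]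
  exact mul_le_mul_of_nonneg_left (by linarith) (by positivity)

/-- The case `ζ = 1`, with `η` itself as test function. -/
theorem IsAdjointSolution.energy_le {m : Plane → Fin 2 → ℂ} {M ε : ℝ} (hε : 0 < ε)
    (hm : IsCoefficient Ω m M ε) {F : Lp CPlane 2 (volume.restrict Ω)} {η : H1 Ω ℂ}
    {f : Lp ℂ 2 (arc (frontier Ω))} (h : IsAdjointSolution Ω D m F η f) :
    ∫⁻ x in Ω, ‖h1Grad η x‖ₑ ^ 2 ≤ ENNReal.ofReal (2 / ε * (4 * M ^ 2 / ε + 1 / ε + 1)) *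
        ∫⁻ x in Ω, ‖F x‖ₑ ^ 2 := by
  have hA := (Lp.memLp (h1Grad η)).integrable_norm_pow (p := 2) two_ne_zero
  have hB := (Lp.memLp F).integrable_norm_pow (p := 2) two_ne_zero
  have := h.integral_le hε hm h.trace h.zero (ζ := fun _ => 1) (v := fun _ => 0) (Z := fun _ => 0)
    (ae_of_all _ fun x => by simp) (by simpa using hA) (by simpa using hB)
  simpa [ENNReal.ofReal_pow] using this

/-- The test function is `ζ²(η - c)`. It vanishes on `D` because `η` does and, at each point of `D`,
either the cut-off or the constant is zero. -/
theorem IsAdjointSolution.caccioppoli {m : Plane → Fin 2 → ℂ} {M ε : ℝ} (hε : 0 < ε)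
    (hm : IsCoefficient Ω m M ε) {F : Lp CPlane 2 (volume.restrict Ω)} {η : H1 Ω ℂ}
    {f : Lp ℂ 2 (arc (frontier Ω))} (h : IsAdjointSolution Ω D m F η f) (hΩ : IsPolygonalDomain Ω)
    (hD : IsDirichletPart Ω D)
    {ζ : Plane → ℝ} (hζ : ContDiff ℝ ∞ ζ) (hζc : HasCompactSupport ζ) {c : ℂ}
    (hc : ∀ x ∈ D, ζ x = 0 ∨ c = 0) :
    ∫⁻ x in Ω, ENNReal.ofReal (ζ x ^ 2 * ‖h1Grad η x‖ ^ 2)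
      ≤ ENNReal.ofReal (2 / ε * (4 * M ^ 2 / ε + 1 / ε + 1)) *
        ∫⁻ x in Ω, ENNReal.ofReal (‖h1Fn η x - c‖ ^ 2 * ‖gradC ζ x‖ ^ 2
          + ζ x ^ 2 * ‖F x‖ ^ 2) := by
  have := isFiniteMeasure_restrict hΩ
  have := isFiniteMeasure_arc hΩ
  have hmt := measTriple_h1 η f
  set χ : Plane → ℝ := fun x => ζ x ^ 2 with hχ
  have hχs : ContDiff ℝ ∞ χ := hζ.pow 2
  have hχc : HasCompactSupport χ := by
    refine hζc.mono fun x hx => ?_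
    contrapose! hx
    have : ζ x = 0 := by simpa using hx
    simp [hχ, this]
  obtain ⟨N, hN⟩ := exists_bound_gradC hχs hχc
  obtain ⟨N', hN'⟩ := exists_bound_gradC hζ hζc
  have hχC : Continuous fun x => (χ x : ℂ) := Complex.continuous_ofReal.comp hχs.continuous
  have hgC := continuous_gradC hχs
  have hnχ : ∀ x, ‖(χ x : ℂ)‖ ≤ N := fun x => by rw [Complex.norm_real]; exact (hN x).1
  have hs1 := ((isTrace_iff_smoothLimit.1 h.trace).add (smoothLimit_const Ω (-c)) hmt.fn
    aestronglyMeasurable_const hmt.grad aestronglyMeasurable_const hmt.trace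
    aestronglyMeasurable_const)
  have hs2 := hs1.mul hχs hχc (hmt.fn.add aestronglyMeasurable_const)
    (hmt.grad.add aestronglyMeasurable_const)
  have ha : MemLp (fun x => h1Fn η x + -c) 2 (volume.restrict Ω) :=
    (Lp.memLp (h1Fn η)).add (memLp_const _)
  have hG : MemLp (fun x => h1Grad η x + (0 : CPlane)) 2 (volume.restrict Ω) := by
    simpa using Lp.memLp (h1Grad η)
  have hf' : MemLp (fun x => f x + -c) 2 (arc (frontier Ω)) :=
    (Lp.memLp f).add (memLp_const _)
  have m1 : MemLp (fun x => (χ x : ℂ) * (h1Fn η x + -c)) 2 (volume.restrict Ω) := by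
    refine ha.of_le_mul (c := N) (hχC.aestronglyMeasurable.mul ha.1) (ae_of_all _ fun x => ?_)
    rw [norm_mul]
    exact mul_le_mul_of_nonneg_right (hnχ x) (norm_nonneg _)
  have m2 : MemLp (fun x => (χ x : ℂ) • (h1Grad η x + 0) + (h1Fn η x + -c) • gradC χ x) 2
      (volume.restrict Ω) := by
    refine MemLp.add (f := fun x => (χ x : ℂ) • (h1Grad η x + 0))
      (g := fun x => (h1Fn η x + -c) • gradC χ x) ?_ ?_
    · refine hG.of_le_mul (c := N) (hχC.aestronglyMeasurable.smul hG.1) (ae_of_all _ fun x => ?_)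
      rw [norm_smul]
      exact mul_le_mul_of_nonneg_right (hnχ x) (norm_nonneg _)
    · refine ha.of_le_mul (c := N) (ha.1.smul hgC.aestronglyMeasurable) (ae_of_all _ fun x => ?_)
      rw [norm_smul, mul_comm]
      exact mul_le_mul_of_nonneg_right (hN x).2 (norm_nonneg _)
  have m3 : MemLp (fun x => (χ x : ℂ) * (f x + -c)) 2 (arc (frontier Ω)) := by
    refine hf'.of_le_mul (c := N) (hχC.aestronglyMeasurable.mul hf'.1) (ae_of_all _ fun x => ?_)
    rw [norm_mul]
    exact mul_le_mul_of_nonneg_right (hnχ x) (norm_nonneg _)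
  obtain ⟨ψ, -, hψ2, hψ3⟩ := hs2.exists_h1 m1 m2 m3
  have hψ0 : m3.toLp _ =ᵐ[arc D] 0 := by
    filter_upwards [ae_mono (arc_le_frontier hD.subset) m3.coeFn_toLp, h.zero,
      ae_restrict_mem hD.isClosed.measurableSet] with x h1 h2 h3
    rw [h1, h2]
    rcases hc x h3 with h | h <;> simp [hχ, h]
  refine h.integral_le hε hm hψ3 hψ0 ?_ ?_ ?_
  · filter_upwards [hψ2] with x hx
    rw [hx, gradC_sq hζ, add_zero, ← sub_eq_add_neg]
  · have hA := (Lp.memLp (h1Grad η)).integrable_norm_pow (p := 2) two_ne_zero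
    refine hA.bdd_mul (c := N) hχs.continuous.aestronglyMeasurable (ae_of_all _ fun x => (hN x).1)
  · refine Integrable.add ?_ ?_
    · have hA : Integrable (fun x => ‖h1Fn η x - c‖ ^ 2) (volume.restrict Ω) := by
        simpa [sub_eq_add_neg] using ha.integrable_norm_pow (p := 2) two_ne_zero
      refine hA.mul_bdd (c := N' ^ 2) ((continuous_gradC hζ).norm.pow 2).aestronglyMeasurable
        (ae_of_all _ fun x => ?_)
      rw [norm_pow, norm_norm]
      exact pow_le_pow_left₀ (norm_nonneg _) (hN' x).2 2
    · have hA := (Lp.memLp F).integrable_norm_pow (p := 2) two_ne_zero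
      refine hA.bdd_mul (c := N) hχs.continuous.aestronglyMeasurable
        (ae_of_all _ fun x => (hN x).1)

end RhombiSlits

/-! ### Reverse Hölder inequality for adjoint solutions and the Meyers estimate. -/

namespace RhombiSlits

variable {Ω D : Set Plane}

/-- The Caccioppoli inequality bounds `∫|∇η|²` by `r⁻²∫|η - c|²` and `∫|F|²`; the local Poincaré
inequality bounds `∫|η - c|²` by `(∫|∇η|)²`. The latter gives `c = 0` exactly when the larger ball
meets `D`, which is when the former needs it. -/
theorem IsAdjointSolution.reverse_holder (hΩ : IsPolygonalDomain Ω) (hD : IsDirichletPart Ω D)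
    {M ε : ℝ} (hε : 0 < ε) : ∃ A k r₀ : ℝ, 1 ≤ A ∧ 1 ≤ k ∧ 0 < r₀ ∧
      ∀ {m : Plane → Fin 2 → ℂ}, IsCoefficient Ω m M ε →
      ∀ {F : Lp CPlane 2 (volume.restrict Ω)} {η : H1 Ω ℂ} {f : Lp ℂ 2 (arc (frontier Ω))},
      IsAdjointSolution Ω D m F η f → ∀ x ∈ Ω, ∀ r, 0 < r → r < r₀ →
        ∫⁻ y in Ω ∩ Metric.closedBall x r, ‖h1Grad η y‖ₑ ^ 2 ≤ ENNReal.ofReal A *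
          ((volume (Metric.closedBall x r))⁻¹ *
              (∫⁻ y in Ω ∩ Metric.closedBall x (k * r), ‖h1Grad η y‖ₑ) ^ 2
            + ∫⁻ y in Ω ∩ Metric.closedBall x (k * r), ‖F y‖ₑ ^ 2) := by
  obtain ⟨K, R, C, hK, hR, hP⟩ := SmoothLimit.local_poincare hΩ hD
  obtain ⟨L, hL, hcut⟩ := exists_cutoff
  set B : ℝ := 2 / ε * (4 * M ^ 2 / ε + 1 / ε + 1) with hB
  have hB0 : 0 < B := by positivity
  have hπ := Real.pi_pos
  set A : ℝ := max 1 (B * max (L ^ 2 * Real.pi * (2 * C ^ 2)) 1) with hA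
  refine ⟨A, 3 * K, R / 3, le_max_left _ _, by linarith, by positivity,
    fun {m} hm {F η f} h x hx r hr hrR => ?_⟩
  obtain ⟨ζ, hζ, hζc, hζ01, hζ1, hζ0, hζg⟩ := hcut x r hr
  have hball : Ω ∩ Metric.ball x (3 * r) ⊆ Ω ∩ Metric.closedBall x (3 * K * r) := by
    refine Set.inter_subset_inter_right _ (Metric.ball_subset_closedBall.trans
      (Metric.closedBall_subset_closedBall ?_))
    nlinarith
  have hballK : Ω ∩ Metric.ball x (K * (3 * r)) ⊆ Ω ∩ Metric.closedBall x (3 * K * r) := by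
    refine Set.inter_subset_inter_right _ (Metric.ball_subset_closedBall.trans
      (Metric.closedBall_subset_closedBall ?_))
    nlinarith
  set IG := ∫⁻ y in Ω ∩ Metric.closedBall x (3 * K * r), ‖h1Grad η y‖ₑ with hIG
  set IF := ∫⁻ y in Ω ∩ Metric.closedBall x (3 * K * r), ‖F y‖ₑ ^ 2 with hIF
  -- In the plane `r⁻²` is a multiple of the inverse area of the ball, the normalisation in
  -- `gehring`.
  have hvol : ENNReal.ofReal ((L / r) ^ 2)
      = ENNReal.ofReal (L ^ 2 * Real.pi) * (volume (Metric.closedBall x r))⁻¹ := by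
    rw [EuclideanSpace.volume_closedBall_fin_two,
      ← ENNReal.ofReal_pow hr.le, ← ENNReal.ofReal_mul (by positivity),
      ← ENNReal.ofReal_inv_of_pos (by positivity), ← ENNReal.ofReal_mul (by positivity)]
    congr 1
    field_simp
  set V := (volume (Metric.closedBall x r))⁻¹ with hV
  have hVt : V ≠ ⊤ := by
    rw [hV]
    exact ENNReal.inv_ne_top.2 (Metric.measure_closedBall_pos _ _ hr).ne'
  -- Removes the error of the local Poincaré inequality. That error is taken to be `√δ` because it
  -- will be squared.
  refine le_of_forall_eps (K := ENNReal.ofReal B * (ENNReal.ofReal (L ^ 2 * Real.pi) * V * 2))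
    (by finiteness) fun δ hδ => ?_
  obtain ⟨c, hcD, hc⟩ := hP (measTriple_h1 η f) (isTrace_iff_smoothLimit.1 h.trace) h.zero x
    (subset_closure hx) (3 * r) (by positivity) (by linarith) (NNReal.sqrt δ)
    (by simpa using hδ)
  have hcac := h.caccioppoli hε hm hΩ hD hζ hζc (c := c) (fun y hy => by
    by_cases hy3 : y ∈ Metric.closedBall x (3 * r)
    · exact Or.inr (hcD ⟨y, hy, hy3⟩)
    · exact Or.inl (hζ0 y fun h => hy3 (Metric.ball_subset_closedBall h)).1)
  have hlow : ∫⁻ y in Ω ∩ Metric.closedBall x r, ‖h1Grad η y‖ₑ ^ 2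
      ≤ ∫⁻ y in Ω, ENNReal.ofReal (ζ y ^ 2 * ‖h1Grad η y‖ ^ 2) := by
    rw [Set.inter_comm, ← Measure.restrict_restrict Metric.isClosed_closedBall.measurableSet]
    refine le_trans (setLIntegral_mono' Metric.isClosed_closedBall.measurableSet fun y hy => ?_)
      (setLIntegral_le_lintegral (Metric.closedBall x r) _)
    rw [hζ1 y hy, one_pow, one_mul, ENNReal.ofReal_pow (norm_nonneg _), ofReal_norm]
  have hPsq : ∫⁻ y in Ω ∩ Metric.ball x (3 * r), ‖h1Fn η y - c‖ₑ ^ 2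
      ≤ 2 * (C ^ 2 * IG ^ 2) + 2 * δ := by
    rw [← eLpNorm_two_sq]
    calc _ ≤ ((C : ENNReal) * IG + NNReal.sqrt δ) ^ 2 := by
          gcongr 1
          refine hc.trans (add_le_add (mul_le_mul_right ?_ _) le_rfl)
          rw [eLpNorm_one_eq_lintegral_enorm]
          exact lintegral_mono_set hballK
      _ ≤ 2 * ((C : ENNReal) * IG) ^ 2 + 2 * (NNReal.sqrt δ : ENNReal) ^ 2 := ennreal_add_sq_le _ _
      _ = _ := by rw [← ENNReal.coe_pow, NNReal.sq_sqrt, mul_pow]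
  have hup : ∫⁻ y in Ω, ENNReal.ofReal (‖h1Fn η y - c‖ ^ 2 * ‖gradC ζ y‖ ^ 2
      + ζ y ^ 2 * ‖F y‖ ^ 2) ≤ ENNReal.ofReal ((L / r) ^ 2) *
        (∫⁻ y in Ω ∩ Metric.ball x (3 * r), ‖h1Fn η y - c‖ₑ ^ 2) + IF := by
    calc _ ≤ ∫⁻ y in Ω, (Metric.ball x (3 * r)).indicator (fun y => ENNReal.ofReal ((L / r) ^ 2) *
          ‖h1Fn η y - c‖ₑ ^ 2 + ‖F y‖ₑ ^ 2) y := by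
          refine lintegral_mono fun y => ?_
          by_cases hy : y ∈ Metric.ball x (3 * r)
          · rw [Set.indicator_of_mem hy, ← ofReal_norm, ← ofReal_norm,
              ← ENNReal.ofReal_pow (norm_nonneg _), ← ENNReal.ofReal_pow (norm_nonneg _),
              ← ENNReal.ofReal_mul (by positivity), ← ENNReal.ofReal_add (by positivity)
                (by positivity)]
            refine ENNReal.ofReal_le_ofReal (add_le_add ?_ ?_)
            · rw [mul_comm]
              gcongr
              exact hζg y
            · refine mul_le_of_le_one_left (by positivity) ?_
              exact pow_le_one₀ (hζ01 y).1 (hζ01 y).2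
          · rw [Set.indicator_of_notMem hy, (hζ0 y hy).1, (hζ0 y hy).2]
            simp
      _ = ∫⁻ y in Ω ∩ Metric.ball x (3 * r), (ENNReal.ofReal ((L / r) ^ 2) *
          ‖h1Fn η y - c‖ₑ ^ 2 + ‖F y‖ₑ ^ 2) := by
          rw [lintegral_indicator Metric.isOpen_ball.measurableSet,
            Measure.restrict_restrict Metric.isOpen_ball.measurableSet, Set.inter_comm]
      _ = ENNReal.ofReal ((L / r) ^ 2) * (∫⁻ y in Ω ∩ Metric.ball x (3 * r), ‖h1Fn η y - c‖ₑ ^ 2)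
          + ∫⁻ y in Ω ∩ Metric.ball x (3 * r), ‖F y‖ₑ ^ 2 := by
          rw [lintegral_add_right _ ((Lp.stronglyMeasurable F).enorm.pow_const 2),
            lintegral_const_mul' _ _ ENNReal.ofReal_ne_top]
      _ ≤ _ := add_le_add le_rfl (lintegral_mono_set hball)
  have hA1 : ENNReal.ofReal B * (ENNReal.ofReal (L ^ 2 * Real.pi) * (2 * (C : ENNReal) ^ 2))
      ≤ ENNReal.ofReal A := by
    have : (2 * (C : ENNReal) ^ 2) = ENNReal.ofReal (2 * (C : ℝ) ^ 2) := by
      rw [ENNReal.ofReal_mul (by norm_num), ENNReal.ofReal_pow C.coe_nonneg,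
        ENNReal.ofReal_coe_nnreal]
      simp
    rw [this, ← ENNReal.ofReal_mul (by positivity), ← ENNReal.ofReal_mul (by positivity)]
    refine ENNReal.ofReal_le_ofReal ((mul_le_mul_of_nonneg_left (le_max_left _ _) hB0.le).trans
      (le_max_right _ _))
  have hA2 : ENNReal.ofReal B ≤ ENNReal.ofReal A := by
    refine ENNReal.ofReal_le_ofReal (le_trans ?_ (le_max_right _ _))
    exact le_mul_of_one_le_right hB0.le (le_max_right _ _)
  calc _ ≤ ENNReal.ofReal B * (ENNReal.ofReal (L ^ 2 * Real.pi) * V *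
        (2 * (C ^ 2 * IG ^ 2) + 2 * δ) + IF) := by
        refine hlow.trans (hcac.trans (mul_le_mul_right (hup.trans ?_) _))
        rw [hvol]
        exact add_le_add (mul_le_mul_right hPsq _) le_rfl
    _ = ENNReal.ofReal B * (ENNReal.ofReal (L ^ 2 * Real.pi) * (2 * (C : ENNReal) ^ 2))
          * (V * IG ^ 2) + ENNReal.ofReal B * IF
          + ENNReal.ofReal B * (ENNReal.ofReal (L ^ 2 * Real.pi) * V * 2) * δ := by ring
    _ ≤ ENNReal.ofReal A * (V * IG ^ 2) + ENNReal.ofReal A * IF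
          + ENNReal.ofReal B * (ENNReal.ofReal (L ^ 2 * Real.pi) * V * 2) * δ := by
        refine add_le_add (add_le_add ?_ ?_) le_rfl
        · exact mul_le_mul_left hA1 _
        · exact mul_le_mul_left hA2 _
    _ = _ := by ring

theorem eLpNorm_rpow_eq {X E : Type*} [MeasurableSpace X] {μ : Measure X} [NormedAddCommGroup E]
    {p : ℝ} (hp : 0 < p) (f : X → E) :
    eLpNorm f (ENNReal.ofReal p) μ ^ p = ∫⁻ x, ‖f x‖ₑ ^ p ∂μ := by
  rw [eLpNorm_eq_lintegral_rpow_enorm_toReal (by simpa using hp) ENNReal.ofReal_ne_top,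
    ENNReal.toReal_ofReal hp.le, ← ENNReal.rpow_mul, one_div_mul_cancel hp.ne', ENNReal.rpow_one]

/-- The Meyers higher integrability estimate. -/
theorem IsAdjointSolution.meyers (hΩ : IsPolygonalDomain Ω) (hD : IsDirichletPart Ω D)
    {M ε : ℝ} (hε : 0 < ε) : ∃ Q₀ : ℝ, 0 < Q₀ ∧ ∀ Q : ℝ, 0 < Q → Q ≤ Q₀ → ∃ C : NNReal,
      ∀ {m : Plane → Fin 2 → ℂ}, IsCoefficient Ω m M ε →
      ∀ {F : Lp CPlane 2 (volume.restrict Ω)} {η : H1 Ω ℂ} {f : Lp ℂ 2 (arc (frontier Ω))},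
      IsAdjointSolution Ω D m F η f →
        eLpNorm (h1Grad η) (ENNReal.ofReal (2 + Q)) (volume.restrict Ω)
          ≤ C * eLpNorm F (ENNReal.ofReal (2 + Q)) (volume.restrict Ω) := by
  obtain ⟨A, k, r₀, hA, hk, hr₀, hrev⟩ := IsAdjointSolution.reverse_holder (M := M) hΩ hD hε
  obtain ⟨Q₀, hQ₀, hgeh⟩ := gehring hA hk hr₀
  have := isFiniteMeasure_restrict hΩ
  refine ⟨Q₀, hQ₀, fun Q hQ hQQ => ?_⟩
  obtain ⟨C, hC, hge⟩ := hgeh Q hQ hQQ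
  have hp : 0 < 2 + Q := by linarith
  set B := ENNReal.ofReal (2 / ε * (4 * M ^ 2 / ε + 1 / ε + 1)) with hB
  set W := (volume.restrict Ω Set.univ)
    ^ (1 / (2 : ENNReal).toReal - 1 / (ENNReal.ofReal (2 + Q)).toReal) with hW
  have hWt : W ≠ ⊤ := by
    refine ENNReal.rpow_ne_top_of_nonneg ?_ (measure_ne_top _ _)
    rw [ENNReal.toReal_ofReal hp.le, ENNReal.toReal_ofNat, sub_nonneg]
    exact one_div_le_one_div_of_le (by norm_num) (by linarith)
  set T := ENNReal.ofReal C * (B ^ (1 + Q / 2) * W ^ (2 + Q) + 1) with hT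
  have hTt : T ≠ ⊤ := by
    refine ENNReal.mul_ne_top ENNReal.ofReal_ne_top (ENNReal.add_ne_top.2 ⟨ENNReal.mul_ne_top
      (ENNReal.rpow_ne_top_of_nonneg (by positivity) ENNReal.ofReal_ne_top)
      (ENNReal.rpow_ne_top_of_nonneg (by positivity) hWt), by simp⟩)
  have hTt' : T ^ (1 / (2 + Q)) ≠ ⊤ := ENNReal.rpow_ne_top_of_nonneg (by positivity) hTt
  refine ⟨(T ^ (1 / (2 + Q))).toNNReal, fun {m} hm {F η f} h => ?_⟩
  rw [ENNReal.coe_toNNReal hTt']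
  -- Extension by zero turns the estimates up to the boundary into the setting of `gehring` on the
  -- whole plane, with `E = Ω`.
  set g : Plane → ℝ := Ω.indicator fun y => ‖h1Grad η y‖ with hg
  set hh : Plane → ℝ := Ω.indicator fun y => ‖F y‖ with hhh
  have hΩm := hΩ.isOpen.measurableSet
  have ind : ∀ (G : Plane → CPlane) (φ : ℝ → ENNReal), φ 0 = 0 → ∀ S : Set Plane,
      MeasurableSet S → ∫⁻ y in S, φ (Ω.indicator (fun y => ‖G y‖) y)
        = ∫⁻ y in Ω ∩ S, φ ‖G y‖ := by
    intro G φ hφ S hS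
    rw [← Measure.restrict_restrict hΩm, ← lintegral_indicator hΩm]
    refine lintegral_congr fun y => ?_
    by_cases hy : y ∈ Ω
    · simp [hy]
    · simp [hy, hφ]
  have indu : ∀ (G : Plane → CPlane) (φ : ℝ → ENNReal), φ 0 = 0 →
      ∫⁻ y, φ (Ω.indicator (fun y => ‖G y‖) y) = ∫⁻ y in Ω, φ ‖G y‖ := by
    intro G φ hφ
    have := ind G φ hφ Set.univ MeasurableSet.univ
    rwa [Measure.restrict_univ, Set.inter_univ] at this
  have hpow : ∀ y : ℝ, 0 ≤ y → ENNReal.ofReal (y ^ (2 + Q)) = ENNReal.ofReal y ^ (2 + Q) :=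
    fun y hy => (ENNReal.ofReal_rpow_of_nonneg hy hp.le).symm
  have i1 : ∀ G : Plane → CPlane, ∫⁻ y, ENNReal.ofReal (Ω.indicator (fun y => ‖G y‖) y) ^ 2
      = ∫⁻ y in Ω, ‖G y‖ₑ ^ 2 := fun G => by
    rw [indu G (fun t => ENNReal.ofReal t ^ 2) (by simp)]
    simp only [ofReal_norm]
  have i2 : ∀ G : Plane → CPlane,
      ∫⁻ y, ENNReal.ofReal (Ω.indicator (fun y => ‖G y‖) y ^ (2 + Q))
      = eLpNorm G (ENNReal.ofReal (2 + Q)) (volume.restrict Ω) ^ (2 + Q) := fun G => by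
    rw [indu G (fun t => ENNReal.ofReal (t ^ (2 + Q))) (by simp [Real.zero_rpow hp.ne']),
      eLpNorm_rpow_eq hp]
    refine lintegral_congr fun y => ?_
    rw [hpow _ (norm_nonneg _), ofReal_norm]
  have hmain := hge Ω g hh ((Lp.stronglyMeasurable (h1Grad η)).norm.measurable.indicator hΩm)
    ((Lp.stronglyMeasurable F).norm.measurable.indicator hΩm)
    (fun x => Set.indicator_nonneg (fun _ _ => norm_nonneg _) x)
    (fun x => Set.indicator_nonneg (fun _ _ => norm_nonneg _) x)
    (fun x hx => Set.indicator_of_notMem hx _) (by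
      rw [i1, ← eLpNorm_two_sq]
      exact ENNReal.pow_ne_top (Lp.memLp (h1Grad η)).2.ne) (by
      intro x hx r hr hrr
      have hS := fun r => (Metric.isClosed_closedBall (x := x) (ε := r)).measurableSet
      rw [ind _ (fun t => ENNReal.ofReal t ^ 2) (by simp) _ (hS _),
        ind _ (fun t => ENNReal.ofReal t) (by simp) _ (hS _),
        ind _ (fun t => ENNReal.ofReal t ^ 2) (by simp) _ (hS _)]
      simp only [ofReal_norm]
      exact hrev hm h x hx r hr hrr)
  rw [i1, i2, i2] at hmain
  set N := eLpNorm F (ENNReal.ofReal (2 + Q)) (volume.restrict Ω) with hN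
  have hF2 : eLpNorm F 2 (volume.restrict Ω) ≤ N * W :=
    eLpNorm_le_eLpNorm_mul_rpow_measure_univ (by
      rw [← ENNReal.ofReal_ofNat]; exact ENNReal.ofReal_le_ofReal (by linarith))
      (Lp.aestronglyMeasurable F)
  -- The lower-order term left by `gehring` is controlled by the data: the energy estimate, then
  -- Hölder's inequality on the bounded domain.
  have hen : (∫⁻ y in Ω, ‖h1Grad η y‖ₑ ^ 2) ^ (1 + Q / 2)
      ≤ B ^ (1 + Q / 2) * W ^ (2 + Q) * N ^ (2 + Q) := by
    have h1 := h.energy_le hε hm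
    rw [← eLpNorm_two_sq (F : Plane → CPlane)] at h1
    have h2 : ∫⁻ y in Ω, ‖h1Grad η y‖ₑ ^ 2 ≤ B * (N * W) ^ 2 :=
      h1.trans (mul_le_mul_right (pow_le_pow_left₀ zero_le hF2 2) _)
    refine (ENNReal.rpow_le_rpow h2 (by positivity)).trans_eq ?_
    rw [ENNReal.mul_rpow_of_nonneg _ _ (by positivity), ← ENNReal.rpow_natCast,
      ← ENNReal.rpow_mul, mul_assoc, ← ENNReal.mul_rpow_of_nonneg _ _ hp.le, mul_comm W N]
    congr 2
    push_cast
    ring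
  have hfin : eLpNorm (h1Grad η) (ENNReal.ofReal (2 + Q)) (volume.restrict Ω) ^ (2 + Q)
      ≤ T * N ^ (2 + Q) := by
    refine hmain.trans ((mul_le_mul_right (add_le_add hen le_rfl) _).trans_eq ?_)
    rw [hT]; ring
  have := ENNReal.rpow_le_rpow hfin (show (0 : ℝ) ≤ 1 / (2 + Q) by positivity)
  rwa [ENNReal.mul_rpow_of_nonneg _ _ (by positivity), ← ENNReal.rpow_mul, ← ENNReal.rpow_mul,
    mul_one_div_cancel hp.ne', ENNReal.rpow_one, ENNReal.rpow_one] at this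

end RhombiSlits

namespace RhombiSlits

/-! ### The coefficients -/

/-- The quotient `(sin t + a cos t) / (cos t + b sin t)`. -/
noncomputable def trigQuotient (a b t : ℝ) : ℝ :=
  (Real.sin t + a * Real.cos t) / (Real.cos t + b * Real.sin t)

theorem Gamma12_eq (α β t : ℝ) : Gamma12 α β t = trigQuotient α β t := by
  have h : HasDerivAt (mu1 α) (-Real.sin t - α * Real.cos t) t :=
    (Real.hasDerivAt_cos t).sub ((Real.hasDerivAt_sin t).const_mul α)
  rw [Gamma12, h.deriv, mu2, trigQuotient, ← neg_div]
  congr 1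
  ring

/-- Swapping `(α, β)` for `(-β, -α)` preserves the sign conditions, so one analysis of the quotient
covers both diagonal entries. -/
theorem Gamma21_eq (α β t : ℝ) : Gamma21 α β t = -trigQuotient (-β) (-α) t := by
  have h : HasDerivAt (mu2 β) (-Real.sin t + β * Real.cos t) t :=
    (Real.hasDerivAt_cos t).add ((Real.hasDerivAt_sin t).const_mul β)
  rw [Gamma21, h.deriv, mu1, trigQuotient, ← neg_div]
  congr 1 <;> ring

/-- Clamping is 1-Lipschitz, so the Lipschitz bound is needed only on `[ξm, ξp]`. -/
theorem cutoff_eq_clamp {ξm ξp : ℝ} (h : ξm ≤ ξp) (Γ : ℝ → ℝ) (t : ℝ) :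
    cutoff ξm ξp Γ t = Γ (max ξm (min ξp t)) := by
  rw [cutoff]
  split_ifs with h1 h2
  · rw [min_eq_left h1, max_eq_right h]
  · rw [min_eq_right (not_le.1 h1).le, max_eq_left h2]
  · rw [min_eq_right (not_le.1 h1).le, max_eq_right (not_le.1 h2).le]

/-- A bounded quotient has no pole, hence is Lipschitz. -/
theorem exists_lipschitz_trigQuotient {a b ξm ξp M : ℝ} (ha : a ≤ 0) (hb : 0 ≤ b) (hm : ξm ≤ 0)
    (hp : 0 ≤ ξp) (hM : ∀ t ∈ Set.Icc ξm ξp, |trigQuotient a b t| ≤ M) :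
    ∃ L : ℝ, 0 < L ∧ ∀ s ∈ Set.Icc ξm ξp, ∀ t ∈ Set.Icc ξm ξp,
      |trigQuotient a b s - trigQuotient a b t| ≤ L * |s - t| := by
  set N : ℝ → ℝ := fun t => Real.sin t + a * Real.cos t with hN
  set E : ℝ → ℝ := fun t => Real.cos t + b * Real.sin t with hE
  have hNc : Continuous N := by fun_prop
  have hEc : Continuous E := by fun_prop
  have hab : 1 ≤ 1 - a * b := by nlinarith
  -- At a zero of `E` the quotient has the default value `0`, so boundedness at that point says
  -- nothing. Since `N` and `E` have no common zero, the open sets `{E ≠ 0}` and `{M|E| < |N|}`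
  -- cover the interval. By connectedness they meet if the second is nonempty, and a common point
  -- violates the bound.
  have hne : ∀ t ∈ Set.Icc ξm ξp, E t ≠ 0 := by
    by_contra! hcon
    obtain ⟨t₀, ht₀, hE₀⟩ := hcon
    have hcase : ∀ t, E t = 0 → N t ≠ 0 := by
      intro t h1 h2
      simp only [hN, hE] at h1 h2
      have h3 : (1 - a * b) * Real.cos t = 0 := by linear_combination h1 - b * h2
      have h4 : Real.cos t = 0 := by
        rcases mul_eq_zero.1 h3 with h | h
        · linarith
        · exact h
      have h5 : Real.sin t = 0 := by rw [h4] at h2; linarith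
      have := Real.sin_sq_add_cos_sq t
      rw [h4, h5] at this
      norm_num at this
    obtain ⟨x, hx, hx1, hx2⟩ := isPreconnected_Icc (a := ξm) (b := ξp) {t | E t ≠ 0}
      {t | M * |E t| < |N t|} (isOpen_ne_fun hEc continuous_const)
      (isOpen_lt (by fun_prop) (by fun_prop)) (fun t _ => by
        by_cases h : E t = 0
        · right
          simp only [Set.mem_ofPred_eq, h, abs_zero, mul_zero]
          exact abs_pos.2 (hcase t h)
        · exact Or.inl h)
      ⟨0, ⟨hm, hp⟩, by simp [hE]⟩ ⟨t₀, ht₀, by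
        simp only [Set.mem_ofPred_eq, hE₀, abs_zero, mul_zero]
        exact abs_pos.2 (hcase t₀ hE₀)⟩
    have h1 := hM x hx
    rw [trigQuotient, abs_div, div_le_iff₀ (abs_pos.2 hx1)] at h1
    exact absurd hx2 (not_lt.2 h1)
  obtain ⟨z, hz, hzmin⟩ := isCompact_Icc.exists_isMinOn ⟨0, ⟨hm, hp⟩⟩ (hEc.abs.continuousOn)
  set d := |E z| with hd
  have hd0 : 0 < d := abs_pos.2 (hne z hz)
  refine ⟨(1 - a * b) / d ^ 2, by positivity, fun s hs t ht => ?_⟩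
  -- By the addition formula the numerators combine to `(1 - ab) sin(s - t)`; the denominators are
  -- bounded below by the minimum of `|E|`.
  have e : trigQuotient a b s - trigQuotient a b t
      = (1 - a * b) * Real.sin (s - t) / (E s * E t) := by
    rw [trigQuotient, trigQuotient, div_sub_div _ _ (hne s hs) (hne t ht), Real.sin_sub]
    congr 1
    ring
  rw [e, abs_div, abs_mul, abs_mul, abs_of_pos (by linarith : 0 < 1 - a * b), div_mul_eq_mul_div]
  have h1 : d ^ 2 ≤ |E s| * |E t| := by
    rw [sq]
    exact mul_le_mul (hzmin hs) (hzmin ht) hd0.le (abs_nonneg _)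
  have h2 : |Real.sin (s - t)| ≤ |s - t| := Real.abs_sin_le_abs
  gcongr

theorem exists_lipschitz_Bhat {α β ξm ξp M : ℝ} (hα : α ≤ 0) (hβ : 0 ≤ β) (hm : ξm ≤ 0)
    (hp : 0 ≤ ξp) (hM : ∀ (t : ℝ) (i j : Fin 2), |Bhat α β ξm ξp t i j| ≤ M) :
    ∃ L : ℝ, 0 < L ∧ ∀ (i : Fin 2) (s t : ℝ),
      |Bhat α β ξm ξp s i i - Bhat α β ξm ξp t i i| ≤ L * |s - t| := by
  have hmp : ξm ≤ ξp := hm.trans hp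
  have hclamp : ∀ t ∈ Set.Icc ξm ξp, max ξm (min ξp t) = t := fun t ht => by
    rw [min_eq_right ht.2, max_eq_right ht.1]
  have hmem : ∀ t, max ξm (min ξp t) ∈ Set.Icc ξm ξp := fun t =>
    ⟨le_max_left _ _, max_le hmp (min_le_left _ _)⟩
  have h00 : ∀ t, Bhat α β ξm ξp t 0 0 = trigQuotient (-β) (-α) (max ξm (min ξp t)) := fun t => by
    simp [Bhat, cutoff_eq_clamp hmp, Gamma21_eq]
  have h11 : ∀ t, Bhat α β ξm ξp t 1 1 = trigQuotient α β (max ξm (min ξp t)) := fun t => by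
    simp [Bhat, cutoff_eq_clamp hmp, Gamma12_eq]
  obtain ⟨L₁, hL₁, h₁⟩ := exists_lipschitz_trigQuotient (a := -β) (b := -α) (by linarith)
    (by linarith) hm hp (M := M) fun t ht => by
      have := hM t 0 0
      rwa [h00, hclamp t ht] at this
  obtain ⟨L₂, hL₂, h₂⟩ := exists_lipschitz_trigQuotient hα hβ hm hp (M := M) fun t ht => by
      have := hM t 1 1
      rwa [h11, hclamp t ht] at this
  have hlip : ∀ s t, |max ξm (min ξp s) - max ξm (min ξp t)| ≤ |s - t| := fun s t => by
    rw [max_comm ξm, max_comm ξm, min_comm ξp s, min_comm ξp t]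
    exact (abs_max_sub_max_le_abs _ _ _).trans ((abs_min_sub_min_le_max _ _ _ _).trans (by simp))
  refine ⟨L₁ + L₂, by positivity, fun i s t => ?_⟩
  have hb := hlip s t
  have hn := abs_nonneg (s - t)
  match i with
  | 0 =>
    rw [h00, h00]
    refine (h₁ _ (hmem s) _ (hmem t)).trans ?_
    nlinarith
  | 1 =>
    rw [h11, h11]
    refine (h₂ _ (hmem s) _ (hmem t)).trans ?_
    nlinarith

/-- The diagonal of `B̂(t) + i ε I`. -/
noncomputable def coef (α β ξm ξp ε t : ℝ) (i : Fin 2) : ℂ :=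
  (Bhat α β ξm ξp t i i : ℂ) + Complex.I * ε

theorem aForm_eq {Ω : Set Plane} (α β ξm ξp ε : ℝ) (ξ : Plane → ℝ) (ζ η : H1 Ω ℂ) :
    aForm α β ξm ξp ε ξ ζ η
      = ∫ x in Ω, diagForm (coef α β ξm ξp ε (ξ x)) (h1Grad ζ x) (h1Grad η x) := by
  rw [aForm]
  congr 1
  ext x
  simp [diagForm, coef, Matrix.mulVec, dotProduct, Fin.sum_univ_two, Matrix.one_apply, Bhat]

theorem isCoefficient_coef {Ω : Set Plane} {α β ξm ξp ε M L : ℝ}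
    (hM : ∀ (t : ℝ) (i j : Fin 2), |Bhat α β ξm ξp t i j| ≤ M) (hL : 0 < L)
    (hlip : ∀ (i : Fin 2) (s t : ℝ),
      |Bhat α β ξm ξp s i i - Bhat α β ξm ξp t i i| ≤ L * |s - t|) {u : Plane → ℝ}
    (hu : AEStronglyMeasurable u (volume.restrict Ω)) :
    IsCoefficient Ω (fun x => coef α β ξm ξp ε (u x)) (M + |ε|) ε where
  meas i := by
    have hc : Continuous fun t => Bhat α β ξm ξp t i i :=
      (LipschitzWith.of_dist_le_mul (K := ⟨L, hL.le⟩) fun s t => by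
        rw [Real.dist_eq, Real.dist_eq]; exact hlip i s t).continuous
    have hc' : Continuous fun t => coef α β ξm ξp ε t i :=
      (Complex.continuous_ofReal.comp hc).add continuous_const
    exact hc'.comp_aestronglyMeasurable hu
  le x i := by
    refine (norm_add_le _ _).trans (add_le_add ?_ ?_)
    · rw [Complex.norm_real]; exact hM _ i i
    · simp
  im x i := by simp [coef]

end RhombiSlits

namespace RhombiSlits

variable {Ω D : Set Plane}

/-! ### Linear problems -/

theorem lintegral_enorm_mul_le {μ : Measure Plane} {E F : Type*} [NormedAddCommGroup E]
    [NormedAddCommGroup F] {p q : ENNReal} [p.HolderTriple q 1] {f : Plane → E} {g : Plane → F}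
    (hf : AEStronglyMeasurable f μ) (hg : AEStronglyMeasurable g μ) :
    ∫⁻ x, ‖f x‖ₑ * ‖g x‖ₑ ∂μ ≤ eLpNorm f p μ * eLpNorm g q μ := by
  have := eLpNorm_smul_le_mul_eLpNorm (p := p) (q := q) (r := 1) hg.norm hf.norm
  rw [eLpNorm_norm, eLpNorm_norm] at this
  refine le_trans (le_of_eq ?_) this
  rw [eLpNorm_one_eq_lintegral_enorm]
  refine lintegral_congr fun x => ?_
  simp

/-- The integrated form `∫_Ω ∑ᵢ mᵢ ∂ᵢu conj ∂ᵢv`. -/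
noncomputable def bform (m : Plane → Fin 2 → ℂ) (u v : H1 Ω ℂ) : ℂ :=
  ∫ x in Ω, diagForm (m x) (h1Grad u x) (h1Grad v x)

theorem diagForm_add_right (m : Fin 2 → ℂ) (a b b' : CPlane) :
    diagForm m a (b + b') = diagForm m a b + diagForm m a b' := by
  simp only [diagForm, Fin.sum_univ_two, PiLp.add_apply, star_add]; ring

theorem diagForm_smul_right (m : Fin 2 → ℂ) (c : ℂ) (a b : CPlane) :
    diagForm m a (c • b) = starRingEnd ℂ c * diagForm m a b := by
  simp only [diagForm, Fin.sum_univ_two, PiLp.smul_apply, smul_eq_mul,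
    ← starRingEnd_apply, map_mul]
  ring

variable {m : Plane → Fin 2 → ℂ} {M ε : ℝ}

theorem IsCoefficient.integrable (hm : IsCoefficient Ω m M ε) (u v : H1 Ω ℂ) :
    Integrable (fun x => diagForm (m x) (h1Grad u x) (h1Grad v x)) (volume.restrict Ω) :=
  integrable_diagForm hm.meas hm.le (Lp.memLp _) (Lp.memLp _)

theorem IsCoefficient.bform_add_left (hm : IsCoefficient Ω m M ε) (u u' v : H1 Ω ℂ) :
    bform m (u + u') v = bform m u v + bform m u' v := by
  rw [bform, bform, bform, ← integral_add (hm.integrable u v) (hm.integrable u' v)]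
  refine integral_congr_ae ?_
  filter_upwards [h1Grad_add u u'] with x hx
  rw [hx, diagForm_add_left]

theorem IsCoefficient.bform_add_right (hm : IsCoefficient Ω m M ε) (u v v' : H1 Ω ℂ) :
    bform m u (v + v') = bform m u v + bform m u v' := by
  rw [bform, bform, bform, ← integral_add (hm.integrable u v) (hm.integrable u v')]
  refine integral_congr_ae ?_
  filter_upwards [h1Grad_add v v'] with x hx
  rw [hx, diagForm_add_right]

theorem bform_smul_left (c : ℂ) (u v : H1 Ω ℂ) : bform m (c • u) v = c * bform m u v := by
  rw [bform, bform, ← integral_const_mul]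
  refine integral_congr_ae ?_
  filter_upwards [h1Grad_smul c u] with x hx
  rw [hx, diagForm_smul_left]

theorem bform_smul_right (c : ℂ) (u v : H1 Ω ℂ) :
    bform m u (c • v) = starRingEnd ℂ c * bform m u v := by
  rw [bform, bform, ← integral_const_mul]
  refine integral_congr_ae ?_
  filter_upwards [h1Grad_smul c v] with x hx
  rw [hx, diagForm_smul_right]

theorem IsCoefficient.norm_integral_diagForm_le (hm : IsCoefficient Ω m M ε) (hM : 0 ≤ M)
    (G H : Lp CPlane 2 (volume.restrict Ω)) :
    ‖∫ x in Ω, diagForm (m x) (G x) (H x)‖ ≤ M * ‖G‖ * ‖H‖ := by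
  have h1 : ‖∫ x in Ω, diagForm (m x) (G x) (H x)‖ₑ ≤ ENNReal.ofReal M * (‖G‖ₑ * ‖H‖ₑ) := by
    refine (enorm_integral_le_lintegral_enorm _).trans ?_
    calc _ ≤ ∫⁻ x in Ω, ENNReal.ofReal M * (‖G x‖ₑ * ‖H x‖ₑ) := by
          refine lintegral_mono fun x => ?_
          rw [← ofReal_norm, ← ofReal_norm, ← ofReal_norm, ← ENNReal.ofReal_mul (norm_nonneg _),
            ← ENNReal.ofReal_mul hM, ← mul_assoc]
          exact ENNReal.ofReal_le_ofReal (norm_diagForm_le (hm.le x) _ _)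
      _ ≤ _ := by
          rw [lintegral_const_mul' _ _ ENNReal.ofReal_ne_top, Lp.enorm_def, Lp.enorm_def]
          exact mul_le_mul_right (lintegral_enorm_mul_le (p := 2) (q := 2)
            (Lp.aestronglyMeasurable G) (Lp.aestronglyMeasurable H)) _
  rw [← ofReal_norm, ← ofReal_norm, ← ofReal_norm, ← ENNReal.ofReal_mul (norm_nonneg _),
    ← ENNReal.ofReal_mul hM, ENNReal.ofReal_le_ofReal_iff (by positivity), ← mul_assoc] at h1
  exact h1

theorem IsCoefficient.im_bform_self (hm : IsCoefficient Ω m M ε) (u : H1 Ω ℂ) : (bform m u u).im = ε * ‖h1Grad u‖ ^ 2 := by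
  have h1 : (bform m u u).im = ∫ x in Ω, (diagForm (m x) (h1Grad u x) (h1Grad u x)).im :=
    (integral_im (hm.integrable u u)).symm
  have h2 : ‖h1Grad u‖ ^ 2 = ∫ x in Ω, ‖h1Grad u x‖ ^ 2 := by
    rw [← inner_self_eq_norm_sq (𝕜 := ℂ), L2.inner_def, ← integral_re]
    · refine integral_congr_ae (ae_of_all _ fun x => ?_)
      simp only [inner_self_eq_norm_sq]
    · exact L2.integrable_inner _ _
  rw [h1, h2, ← integral_const_mul]
  exact integral_congr_ae (ae_of_all _ fun x => im_diagForm_self (hm.im x) _)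

/-- The Friedrichs inequality on `V₀`. -/
theorem exists_norm_le_grad (hΩ : IsPolygonalDomain Ω) (hD : IsDirichletPart Ω D) :
    ∃ C : ℝ, 0 < C ∧ ∀ {u : H1 Ω ℂ} {f : Lp ℂ 2 (arc (frontier Ω))}, IsTrace u f →
      f =ᵐ[arc D] 0 → ‖u‖ ≤ C * ‖h1Grad u‖ := by
  obtain ⟨C, hC⟩ := SmoothLimit.friedrichs hΩ hD
  have := isFiniteMeasure_restrict hΩ
  obtain ⟨K, hK⟩ := exists_eLpNorm_le_two (volume.restrict Ω) (p := 1) (by norm_num) le_rfl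
  refine ⟨C * K + 1, by positivity, fun {u f} hf h0 => ?_⟩
  have h1 := (hC (measTriple_h1 u f) (isTrace_iff_smoothLimit.1 hf) h0).trans
    (mul_le_mul_right (hK (Lp.aestronglyMeasurable (h1Grad u))) _)
  rw [← Lp.enorm_def, ← Lp.enorm_def, ← ofReal_norm, ← ofReal_norm, ← ENNReal.ofReal_coe_nnreal,
    ← ENNReal.ofReal_coe_nnreal (p := K), ← ENNReal.ofReal_mul K.coe_nonneg,
    ← ENNReal.ofReal_mul C.coe_nonneg, ENNReal.ofReal_le_ofReal_iff (by positivity)] at h1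
  refine (norm_h1_le u).trans ?_
  linarith

/-- The Lax–Milgram theorem for a sesquilinear form and for its adjoint. -/
theorem lax_milgram {V : Type*} [NormedAddCommGroup V] [InnerProductSpace ℂ V] [CompleteSpace V]
    (b : V → V → ℂ) {c M : ℝ} (hc : 0 < c) (hM : ∀ x y, ‖b x y‖ ≤ M * ‖x‖ * ‖y‖)
    (hal : ∀ x x' y, b (x + x') y = b x y + b x' y)
    (hsl : ∀ (k : ℂ) x y, b (k • x) y = k * b x y)
    (har : ∀ x y y', b x (y + y') = b x y + b x y')
    (hsr : ∀ (k : ℂ) x y, b x (k • y) = starRingEnd ℂ k * b x y)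
    (h : ∀ x, c * ‖x‖ ^ 2 ≤ ‖b x x‖) (ℓ : V →L[ℂ] ℂ) :
    (∃ x, ∀ y, b y x = ℓ y) ∧ ∃ x, ∀ y, b x y = starRingEnd ℂ (ℓ y) := by
  -- The arguments are swapped so that `B` is conjugate-linear in the first. The operator `A` with
  -- `⟨Ax, y⟩ = b(y, x)` is invertible by coercivity and solves one problem; its adjoint solves the
  -- other.
  set B : V →L⋆[ℂ] V →L[ℂ] ℂ :=
    LinearMap.mkContinuous₂ (LinearMap.mk₂'ₛₗ (starRingEnd ℂ) (RingHom.id ℂ) (fun x y => b y x)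
      (fun x x' y => har _ _ _) (fun c x y => hsr _ _ _) (fun x y y' => hal _ _ _)
      (fun c x y => hsl _ _ _)) M (fun x y => (hM y x).trans_eq (by ring)) with hB
  have hBa : ∀ x y, B x y = b y x := fun x y => rfl
  simp only [← hBa] at h ⊢
  set A := InnerProductSpace.continuousLinearMapOfBilin B with hA
  have hA' : ∀ x y, inner ℂ (A x) y = B x y :=
    InnerProductSpace.continuousLinearMapOfBilin_apply B
  have hu : IsUnit A := by
    refine ContinuousLinearMap.isUnit_of_forall_le_norm_inner_map A (c := ⟨c, hc.le⟩) hc fun x => ?_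
    rw [hA', mul_comm]
    exact h x
  have hu' : IsUnit (ContinuousLinearMap.adjoint A) := by
    rw [← ContinuousLinearMap.star_eq_adjoint]
    exact hu.star
  set z := (InnerProductSpace.toDual ℂ V).symm ℓ with hz
  have hz' : ∀ y, inner ℂ z y = ℓ y := fun y => InnerProductSpace.toDual_symm_apply
  constructor
  · obtain ⟨x, hx⟩ := (ContinuousLinearMap.isUnit_iff_bijective.1 hu).2 z
    exact ⟨x, fun y => by rw [← hA', hx, hz']⟩
  · obtain ⟨x, hx⟩ := (ContinuousLinearMap.isUnit_iff_bijective.1 hu').2 z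
    refine ⟨x, fun y => ?_⟩
    rw [← hA', ← ContinuousLinearMap.adjoint_inner_right, hx, ← hz', inner_conj_symm]

/-- The Lax–Milgram theorem on a subspace. -/
theorem lax_milgram_submodule {E : Type*} [NormedAddCommGroup E] [InnerProductSpace ℂ E]
    (P : Submodule ℂ E) (V : Submodule ℂ P) [CompleteSpace V]
    (b : P → P → ℂ) {c M : ℝ} (hc : 0 < c) (hM : ∀ x y, ‖b x y‖ ≤ M * ‖x‖ * ‖y‖)
    (hal : ∀ x x' y, b (x + x') y = b x y + b x' y)
    (hsl : ∀ (k : ℂ) x y, b (k • x) y = k * b x y)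
    (har : ∀ x y y', b x (y + y') = b x y + b x y')
    (hsr : ∀ (k : ℂ) x y, b x (k • y) = starRingEnd ℂ k * b x y)
    (h : ∀ x ∈ V, c * ‖x‖ ^ 2 ≤ ‖b x x‖) (ℓ : P → ℂ)
    (hℓa : ∀ x ∈ V, ∀ y ∈ V, ℓ (x + y) = ℓ x + ℓ y) (hℓs : ∀ (k : ℂ), ∀ x ∈ V, ℓ (k • x) = k * ℓ x)
    {K : ℝ} (hℓ : ∀ x ∈ V, ‖ℓ x‖ ≤ K * ‖x‖) :
    (∃ x ∈ V, ∀ y ∈ V, b y x = ℓ y) ∧ ∃ x ∈ V, ∀ y ∈ V, b x y = starRingEnd ℂ (ℓ y) := by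
  obtain ⟨⟨x, hx⟩, ⟨y, hy⟩⟩ := lax_milgram (V := V) (fun x y => b x y) hc (fun x y => hM x y)
    (fun x x' y => hal x x' y) (fun k x y => hsl k x y) (fun x y y' => har x y y')
    (fun k x y => hsr k x y) (fun x => h x x.2)
    (LinearMap.mkContinuous (⟨⟨fun x => ℓ x, fun x y => hℓa x x.2 y y.2⟩,
      fun k x => hℓs k x x.2⟩ : V →ₗ[ℂ] ℂ) K fun x => hℓ x x.2)
  exact ⟨⟨x, x.2, fun z hz => hx ⟨z, hz⟩⟩, ⟨y, y.2, fun z hz => hy ⟨z, hz⟩⟩⟩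

/-- Coercivity on `V₀`. -/
theorem exists_coercive (hΩ : IsPolygonalDomain Ω) (hD : IsDirichletPart Ω D) (hε : 0 < ε) :
    ∃ c : ℝ, 0 < c ∧ ∀ {m : Plane → Fin 2 → ℂ}, IsCoefficient Ω m M ε → ∀ {u : H1 Ω ℂ}
      {f : Lp ℂ 2 (arc (frontier Ω))}, IsTrace u f → f =ᵐ[arc D] 0 →
      c * ‖u‖ ^ 2 ≤ ‖bform m u u‖ := by
  obtain ⟨C, hC, hF⟩ := exists_norm_le_grad hΩ hD
  refine ⟨ε / C ^ 2, by positivity, fun {m} hm {u f} hf h0 => ?_⟩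
  have h2 : ‖u‖ ^ 2 ≤ C ^ 2 * ‖h1Grad u‖ ^ 2 := by
    rw [← mul_pow]
    exact pow_le_pow_left₀ (norm_nonneg _) (hF hf h0) 2
  calc ε / C ^ 2 * ‖u‖ ^ 2 ≤ ε / C ^ 2 * (C ^ 2 * ‖h1Grad u‖ ^ 2) := by gcongr
    _ = (bform m u u).im := by rw [hm.im_bform_self]; field_simp
    _ ≤ _ := (le_abs_self _).trans (Complex.abs_im_le_norm _)

theorem IsCoefficient.norm_bform_le (hm : IsCoefficient Ω m M ε) (hM : 0 ≤ M) (u v : H1 Ω ℂ) :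
    ‖bform m u v‖ ≤ M * ‖u‖ * ‖v‖ := by
  refine (hm.norm_integral_diagForm_le hM _ _).trans ?_
  have h1 := norm_h1Grad_le u
  have h2 := norm_h1Grad_le v
  gcongr

/-- Solvability, in `V₀`, of the linear problem and of its adjoint. -/
theorem exists_solution_V0 (hΩ : IsPolygonalDomain Ω) (hD : IsDirichletPart Ω D)
    (hM : 0 ≤ M) (hε : 0 < ε) (hm : IsCoefficient Ω m M ε) (ℓ : H1 Ω ℂ → ℂ)
    (hℓa : ∀ x ∈ V0 Ω D hD.subset, ∀ y ∈ V0 Ω D hD.subset, ℓ (x + y) = ℓ x + ℓ y)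
    (hℓs : ∀ (k : ℂ), ∀ x ∈ V0 Ω D hD.subset, ℓ (k • x) = k * ℓ x) {K : ℝ}
    (hℓ : ∀ x ∈ V0 Ω D hD.subset, ‖ℓ x‖ ≤ K * ‖x‖) :
    (∃ x ∈ V0 Ω D hD.subset, ∀ y ∈ V0 Ω D hD.subset, bform m y x = ℓ y) ∧
      ∃ x ∈ V0 Ω D hD.subset, ∀ y ∈ V0 Ω D hD.subset, bform m x y = starRingEnd ℂ (ℓ y) := by
  have := completeSpace_V0 hΩ hD.subset
  obtain ⟨c, hc, hco⟩ := exists_coercive (M := M) hΩ hD hε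
  exact lax_milgram_submodule (H1 Ω ℂ) (V0 Ω D hD.subset) (bform m) hc (hm.norm_bform_le hM)
    hm.bform_add_left bform_smul_left hm.bform_add_right bform_smul_right
    (fun x hx => hco hm hx.choose_spec.1 hx.choose_spec.2) ℓ hℓa hℓs hℓ

end RhombiSlits

namespace RhombiSlits

variable {Ω D : Set Plane} {m : Plane → Fin 2 → ℂ} {M ε : ℝ}

/-! ### The linear problem with boundary data -/

/-- The weak form of the linear equation with coefficients `m`. -/
def IsLinearSolution (D : Set Plane) (m : Plane → Fin 2 → ℂ)
    (g : Lp ℝ 2 (arc (frontier Ω \ D))) (S : H1 Ω ℂ) : Prop :=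
  ∀ (η : H1 Ω ℂ) (f : Lp ℂ 2 (arc (frontier Ω))), IsTrace η f → f =ᵐ[arc D] 0 →
    bform m S η = lForm D g f

/-- The trace inequality applied to `u - u = 0`. It makes the boundary functional well defined on
`V₀`. -/
theorem IsTrace.unique (hΩ : IsPolygonalDomain Ω) {u : H1 Ω ℂ}
    {f f' : Lp ℂ 2 (arc (frontier Ω))} (h : IsTrace u f) (h' : IsTrace u f') : f = f' := by
  obtain ⟨C, hC⟩ := exists_norm_trace_le hΩ
  have := hC (h.sub h')
  rw [sub_self, norm_zero, mul_zero, norm_le_zero_iff, sub_eq_zero] at this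
  exact this

theorem arc_diff_le (Ω D : Set Plane) : arc (frontier Ω \ D) ≤ arc (frontier Ω) :=
  Measure.restrict_mono Set.sdiff_subset le_rfl

theorem memLp_arc_diff (f : Lp ℂ 2 (arc (frontier Ω))) : MemLp f 2 (arc (frontier Ω \ D)) :=
  (Lp.memLp f).mono_measure (arc_diff_le Ω D)

theorem integrable_lForm (g : Lp ℝ 2 (arc (frontier Ω \ D))) (f : Lp ℂ 2 (arc (frontier Ω))) :
    Integrable (fun x => (g x : ℂ) * star (f x)) (arc (frontier Ω \ D)) := by
  have hf : MemLp (fun x => star (f x)) 2 (arc (frontier Ω \ D)) := (memLp_arc_diff f).star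
  exact MemLp.integrable_mul (Lp.memLp g).ofReal hf

theorem lForm_add (g : Lp ℝ 2 (arc (frontier Ω \ D))) (f f' : Lp ℂ 2 (arc (frontier Ω))) :
    lForm D g (f + f') = lForm D g f + lForm D g f' := by
  rw [lForm, lForm, lForm, ← integral_add (integrable_lForm g f) (integrable_lForm g f')]
  refine integral_congr_ae ?_
  filter_upwards [ae_mono (arc_diff_le Ω D) (Lp.coeFn_add f f')] with x hx
  rw [hx, Pi.add_apply, star_add, mul_add]

theorem lForm_smul (g : Lp ℝ 2 (arc (frontier Ω \ D))) (k : ℂ) (f : Lp ℂ 2 (arc (frontier Ω))) :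
    lForm D g (k • f) = starRingEnd ℂ k * lForm D g f := by
  rw [lForm, lForm, ← integral_const_mul]
  refine integral_congr_ae ?_
  filter_upwards [ae_mono (arc_diff_le Ω D) (Lp.coeFn_smul k f)] with x hx
  rw [hx, Pi.smul_apply, smul_eq_mul, star_mul', starRingEnd_apply]
  ring

theorem norm_lForm_le (g : Lp ℝ 2 (arc (frontier Ω \ D))) (f : Lp ℂ 2 (arc (frontier Ω))) :
    ‖lForm D g f‖ ≤ ‖g‖ * ‖f‖ := by
  have h1 : ‖lForm D g f‖ₑ ≤ ‖g‖ₑ * ‖f‖ₑ := by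
    refine (enorm_integral_le_lintegral_enorm _).trans ?_
    calc _ = ∫⁻ x, ‖g x‖ₑ * ‖f x‖ₑ ∂(arc (frontier Ω \ D)) := by
          refine lintegral_congr fun x => ?_
          rw [enorm_mul, ← ofReal_norm, ← ofReal_norm, Complex.norm_real, norm_star, ofReal_norm,
            ofReal_norm]
      _ ≤ eLpNorm g 2 (arc (frontier Ω \ D)) * eLpNorm f 2 (arc (frontier Ω \ D)) :=
          lintegral_enorm_mul_le (Lp.aestronglyMeasurable g) (memLp_arc_diff f).1
      _ ≤ _ := by
          rw [Lp.enorm_def, Lp.enorm_def]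
          exact mul_le_mul_right (eLpNorm_mono_measure _ (arc_diff_le Ω D)) _
  rwa [← ofReal_norm, ← ofReal_norm, ← ofReal_norm, ← ENNReal.ofReal_mul (norm_nonneg _),
    ENNReal.ofReal_le_ofReal_iff (by positivity)] at h1

theorem bform_neg_left (u v : H1 Ω ℂ) : bform m (-u) v = -bform m u v := by
  rw [← neg_one_smul ℂ u, bform_smul_left, neg_one_mul]

theorem IsCoefficient.bform_sub_left (hm : IsCoefficient Ω m M ε) (u u' v : H1 Ω ℂ) :
    bform m (u - u') v = bform m u v - bform m u' v := by
  rw [sub_eq_add_neg, hm.bform_add_left, bform_neg_left, sub_eq_add_neg]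

/-- Existence for the linear problem. -/
theorem exists_isLinearSolution (hΩ : IsPolygonalDomain Ω) (hD : IsDirichletPart Ω D)
    (hM : 0 ≤ M) (hε : 0 < ε) (hm : IsCoefficient Ω m M ε) (g : Lp ℝ 2 (arc (frontier Ω \ D)))
    {ξD : Lp ℝ 2 (arc D)} {U : H1 Ω ℂ} (hU : U ∈ VD Ω D ξD) :
    ∃ S ∈ VD Ω D ξD, IsLinearSolution D m g S := by
  obtain ⟨C, hC⟩ := exists_norm_trace_le hΩ
  choose! τ hτ using fun (u : H1 Ω ℂ) (hu : u ∈ V0 Ω D hD.subset) => hu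
  have hτe : ∀ {u f}, IsTrace u f → f =ᵐ[arc D] 0 → τ u = f := fun {u f} hf h0 =>
    (hτ u ⟨f, hf, h0⟩).1.unique hΩ hf
  -- The solution is sought as `w + U` with `w ∈ V₀`. The data are conjugate-linear in the test
  -- function, so their conjugate is passed as the linear functional and is conjugated back by the
  -- second half of `exists_solution_V0`.
  obtain ⟨w, ⟨fw, hfw, hfw0⟩, hw⟩ := (exists_solution_V0 hΩ hD hM hε hm
    (fun v => starRingEnd ℂ (lForm D g (τ v) - bform m U v)) (fun x hx y hy => by
      have : τ (x + y) = τ x + τ y := ((hτ _ (add_mem hx hy)).1).unique hΩ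
        ((hτ x hx).1.add (hτ y hy).1)
      rw [this, lForm_add, hm.bform_add_right, ← map_add]
      congr 1; ring) (fun k x hx => by
      have : τ (k • x) = k • τ x := ((hτ _ (Submodule.smul_mem _ k hx)).1).unique hΩ
        ((hτ x hx).1.smul k)
      rw [this, lForm_smul, bform_smul_right, ← mul_sub, map_mul, Complex.conj_conj])
    (K := ‖g‖ * C + M * ‖U‖) (fun x hx => by
      rw [RCLike.norm_conj]
      have h1 := norm_lForm_le g (τ x)
      have h2 := hm.norm_bform_le hM U x
      have h3 := hC (hτ x hx).1
      calc _ ≤ ‖lForm D g (τ x)‖ + ‖bform m U x‖ := norm_sub_le _ _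
        _ ≤ ‖g‖ * (C * ‖x‖) + M * ‖U‖ * ‖x‖ := by
            refine add_le_add (h1.trans ?_) h2
            exact mul_le_mul_of_nonneg_left h3 (norm_nonneg _)
        _ = _ := by ring)).2
  obtain ⟨F, hF, hFD⟩ := hU
  refine ⟨w + U, ⟨fw + F, hfw.add hF, ?_⟩, fun η f hf h0 => ?_⟩
  · filter_upwards [hfw0, hFD, ae_mono (arc_le_frontier hD.subset) (Lp.coeFn_add fw F)]
      with x h1 h2 h3
    rw [h3, Pi.add_apply, h1, h2]
    simp
  · rw [hm.bform_add_left, hw η ⟨f, hf, h0⟩, Complex.conj_conj, hτe hf h0]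
    ring

/-- The energy estimate for the linear problem. -/
theorem exists_norm_grad_le (hΩ : IsPolygonalDomain Ω) (hD : IsDirichletPart Ω D)
    (hM : 0 ≤ M) (hε : 0 < ε) : ∃ C : ℝ, 0 < C ∧ ∀ {m : Plane → Fin 2 → ℂ},
      IsCoefficient Ω m M ε → ∀ {g : Lp ℝ 2 (arc (frontier Ω \ D))} {ξD : Lp ℝ 2 (arc D)}
      {U S : H1 Ω ℂ} {δ : ℝ}, U ∈ VD Ω D ξD → S ∈ VD Ω D ξD → IsLinearSolution D m g S →
      ‖U‖ ≤ 2 * δ → ‖g‖ ≤ δ → ‖h1Grad S‖ ≤ C * δ := by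
  obtain ⟨C₁, hC₁⟩ := exists_norm_trace_le hΩ
  obtain ⟨C₂, hC₂, hF⟩ := exists_norm_le_grad hΩ hD
  refine ⟨(C₁ * C₂ + 2 * M) / ε + 2, by positivity,
    fun {m} hm {g ξD U S δ} hU hS hlin hUδ hgδ => ?_⟩
  have hδ : 0 ≤ δ := (norm_nonneg _).trans hgδ
  obtain ⟨FU, hFU, hFU0⟩ := hU
  obtain ⟨FS, hFS, hFS0⟩ := hS
  set w := S - U with hw
  have htr := hFS.sub hFU
  have h0 : (FS - FU : Lp ℂ 2 (arc (frontier Ω))) =ᵐ[arc D] 0 := by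
    filter_upwards [hFU0, hFS0, ae_mono (arc_le_frontier hD.subset) (Lp.coeFn_sub FS FU)]
      with x h1 h2 h3
    rw [h3, Pi.sub_apply, h1, h2]
    simp
  have e1 : bform m w w = lForm D g (FS - FU) - bform m U w := by
    have := hlin w _ htr h0
    rw [hw] at this ⊢
    rw [hm.bform_sub_left, this]
  have hwg : ‖w‖ ≤ C₂ * ‖h1Grad w‖ := hF htr h0
  -- The equation for `w = S - U` tested with `w`: the boundary term costs the trace and Friedrichs
  -- constants, the lifting `U` costs `M · 2δ`.
  have e2 : ε * ‖h1Grad w‖ ^ 2 ≤ (C₁ * C₂ + 2 * M) * δ * ‖h1Grad w‖ := by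
    rw [← hm.im_bform_self w, e1]
    refine ((le_abs_self _).trans (Complex.abs_im_le_norm _)).trans ?_
    refine (norm_sub_le _ _).trans ?_
    have h1 : ‖lForm D g (FS - FU)‖ ≤ δ * (C₁ * (C₂ * ‖h1Grad w‖)) := by
      refine (norm_lForm_le _ _).trans (mul_le_mul hgδ ((hC₁ htr).trans ?_) (norm_nonneg _) hδ)
      exact mul_le_mul_of_nonneg_left hwg C₁.coe_nonneg
    have h2 : ‖bform m U w‖ ≤ M * (2 * δ) * ‖h1Grad w‖ := by
      refine (hm.norm_integral_diagForm_le hM _ _).trans ?_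
      refine mul_le_mul_of_nonneg_right (mul_le_mul_of_nonneg_left ?_ hM) (norm_nonneg _)
      exact (norm_h1Grad_le U).trans hUδ
    linarith
  have e3 : ‖h1Grad w‖ ≤ (C₁ * C₂ + 2 * M) / ε * δ := by
    rcases (norm_nonneg (h1Grad w)).eq_or_lt with h | h
    · rw [← h]; positivity
    · rw [div_mul_eq_mul_div, le_div_iff₀ hε]
      refine le_of_mul_le_mul_right ?_ h
      linarith
  have e4 : h1Grad S = h1Grad w + h1Grad U := by
    have : S = w + U := by rw [hw, sub_add_cancel]
    rw [this]; rfl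
  rw [e4]
  refine (norm_add_le _ _).trans ?_
  have := (norm_h1Grad_le U).trans hUδ
  linarith

end RhombiSlits

namespace RhombiSlits

variable {Ω D : Set Plane} {m : Plane → Fin 2 → ℂ} {M ε : ℝ}

/-! ### The contraction estimate -/

/-- The dual field `|v|^(q-2) v`. -/
noncomputable def dualField (q : ℝ) (v : CPlane) : CPlane := ((‖v‖ ^ (q - 2) : ℝ) : ℂ) • v

theorem norm_dualField {q : ℝ} (hq : 1 < q) (v : CPlane) : ‖dualField q v‖ = ‖v‖ ^ (q - 1) := by
  rw [dualField, norm_smul, Complex.norm_real, Real.norm_of_nonneg (by positivity)]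
  rcases (norm_nonneg v).eq_or_lt with h | h
  · rw [← h, mul_zero, Real.zero_rpow (by linarith)]
  · rw [← Real.rpow_add_one h.ne']
    congr 1; ring

/-- This field gives equality in Hölder's inequality: pairing a gradient with it recovers the `q`-th
power of its norm. -/
theorem diagForm_dualField {q : ℝ} (hq : 1 < q) (v : CPlane) :
    diagForm 1 v (dualField q v) = ((‖v‖ ^ q : ℝ) : ℂ) := by
  have h1 : diagForm 1 v v = ((‖v‖ ^ 2 : ℝ) : ℂ) := by
    rw [EuclideanSpace.norm_sq_eq, Complex.ofReal_sum, diagForm]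
    refine Finset.sum_congr rfl fun i _ => ?_
    rw [Pi.one_apply, one_mul, Complex.star_def, Complex.mul_conj, Complex.normSq_eq_norm_sq]
  rw [dualField, diagForm_smul_right, Complex.conj_ofReal, h1, ← Complex.ofReal_mul]
  congr 1
  rcases (norm_nonneg v).eq_or_lt with h | h
  · rw [← h, Real.zero_rpow (by linarith : q ≠ 0)]
    simp
  · rw [← Real.rpow_natCast, ← Real.rpow_add h]
    congr 1; push_cast; ring

/-- Since `0 < q - 1 ≤ 1`, the norm `‖G‖^{q-1}` is at most `1 + ‖G‖`; hence the field is an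
admissible right-hand side for the adjoint problem. -/
theorem memLp_dualField (hΩ : IsPolygonalDomain Ω) {q : ℝ} (hq : 1 < q) (hq2 : q ≤ 2)
    (G : Lp CPlane 2 (volume.restrict Ω)) :
    MemLp (fun x => dualField q (G x)) 2 (volume.restrict Ω) := by
  have := isFiniteMeasure_restrict hΩ
  have h1 : MemLp (fun x => (1 : ℝ) + ‖G x‖) 2 (volume.restrict Ω) :=
    (memLp_const (1 : ℝ)).add (Lp.memLp G).norm
  refine h1.mono ?_ (ae_of_all _ fun x => ?_)
  · have hm : Measurable fun x => ((‖G x‖ ^ (q - 2) : ℝ) : ℂ) :=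
      Complex.measurable_ofReal.comp
        ((Lp.stronglyMeasurable G).norm.measurable.pow_const (q - 2))
    exact hm.aestronglyMeasurable.smul (Lp.aestronglyMeasurable G)
  · rw [norm_dualField hq, Real.norm_of_nonneg (by positivity)]
    rcases le_total ‖G x‖ 1 with h | h
    · exact (Real.rpow_le_one (norm_nonneg _) h (by linarith)).trans (by simp)
    · refine (Real.rpow_le_rpow_of_exponent_le h (by linarith : q - 1 ≤ 1)).trans ?_
      rw [Real.rpow_one]; linarith

theorem exists_adjointSolution (hΩ : IsPolygonalDomain Ω) (hD : IsDirichletPart Ω D)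
    (hM : 0 ≤ M) (hε : 0 < ε) (hm : IsCoefficient Ω m M ε) (F : Lp CPlane 2 (volume.restrict Ω)) :
    ∃ η f, IsAdjointSolution Ω D m F η f := by
  have hone : IsCoefficient Ω (fun _ => 1) 1 0 :=
    ⟨fun _ => aestronglyMeasurable_const, by simp, by simp⟩
  have hint : ∀ u : H1 Ω ℂ, Integrable (fun x => diagForm 1 (h1Grad u x) (F x))
      (volume.restrict Ω) := fun u =>
    integrable_diagForm hone.meas hone.le (Lp.memLp _) (Lp.memLp _)
  obtain ⟨η, ⟨f, hf, h0⟩, hη⟩ := (exists_solution_V0 hΩ hD hM hε hm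
    (fun u => ∫ x in Ω, diagForm 1 (h1Grad u x) (F x)) (fun x _ y _ => by
      rw [← integral_add (hint x) (hint y)]
      refine integral_congr_ae ?_
      filter_upwards [h1Grad_add x y] with z hz
      rw [hz, diagForm_add_left]) (fun k x _ => by
      rw [← integral_const_mul]
      refine integral_congr_ae ?_
      filter_upwards [h1Grad_smul k x] with z hz
      rw [hz, diagForm_smul_left]) (K := ‖F‖) (fun x _ => by
      have h1 := hone.norm_integral_diagForm_le zero_le_one (h1Grad x) F
      have h2 := norm_h1Grad_le x
      refine h1.trans ?_
      rw [one_mul, mul_comm]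
      exact mul_le_mul_of_nonneg_left h2 (norm_nonneg _))).1
  exact ⟨η, f, hf, h0, fun ψ fψ hψ hψ0 => hη ψ ⟨fψ, hψ, hψ0⟩⟩

/-- The exponents `p = 4k / (2k - 1)` and `q = 4k / (2k + 1)`. -/
structure IsExponentPair (k : ℕ) (p q : ℝ) : Prop where
  pos : 0 < k
  p_eq : p = 4 * k / (2 * k - 1)
  q_eq : q = 4 * k / (2 * k + 1)

theorem IsExponentPair.one_le {k : ℕ} {p q : ℝ} (h : IsExponentPair k p q) : (1 : ℝ) ≤ k := by
  exact_mod_cast h.pos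

theorem IsExponentPair.two_lt {k : ℕ} {p q : ℝ} (h : IsExponentPair k p q) : 2 < p := by
  have := h.one_le
  rw [h.p_eq, lt_div_iff₀ (by linarith)]; linarith

theorem IsExponentPair.lt_two {k : ℕ} {p q : ℝ} (h : IsExponentPair k p q) : q < 2 := by
  have := h.one_le
  rw [h.q_eq, div_lt_iff₀ (by linarith)]; linarith

theorem IsExponentPair.one_lt {k : ℕ} {p q : ℝ} (h : IsExponentPair k p q) : 1 < q := by
  have := h.one_le
  rw [h.q_eq, lt_div_iff₀ (by linarith)]; linarith

theorem IsExponentPair.holderConjugate {k : ℕ} {p q : ℝ} (h : IsExponentPair k p q) :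
    p.HolderConjugate q := by
  have := h.one_le
  rw [Real.holderConjugate_iff]
  refine ⟨by linarith [h.two_lt], ?_⟩
  rw [h.p_eq, h.q_eq, inv_div, inv_div, ← add_div, div_eq_one_iff_eq (by positivity)]
  ring

theorem IsExponentPair.holderTriple {k : ℕ} {p q : ℝ} (h : IsExponentPair k p q) :
    ENNReal.HolderTriple ((4 * k : ℕ) : ENNReal) 2 (ENNReal.ofReal q) := by
  have := h.one_le
  have hq := h.one_lt
  have e1 : ((4 * k : ℕ) : ENNReal) = ENNReal.ofReal (4 * k) := by
    rw [← ENNReal.ofReal_natCast]; push_cast; rfl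
  have e2 : (2 : ENNReal) = ENNReal.ofReal 2 := by simp
  constructor
  rw [e1, e2, ← ENNReal.ofReal_inv_of_pos (by linarith), ← ENNReal.ofReal_inv_of_pos (by norm_num),
    ← ENNReal.ofReal_inv_of_pos (by linarith), ← ENNReal.ofReal_add (by positivity) (by norm_num),
    h.q_eq, inv_div]
  congr 1
  field_simp
  ring

theorem IsExponentPair.holderTriple_one {k : ℕ} {p q : ℝ} (h : IsExponentPair k p q) :
    ENNReal.HolderTriple (ENNReal.ofReal q) (ENNReal.ofReal p) 1 := by
  have h1 := h.one_lt
  have h2 := h.two_lt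
  constructor
  rw [← ENNReal.ofReal_inv_of_pos (by linarith), ← ENNReal.ofReal_inv_of_pos (by linarith),
    ← ENNReal.ofReal_add (by positivity) (by positivity), add_comm,
    h.holderConjugate.inv_add_inv_eq_one]
  simp

/-- The Sobolev inequality on `V₀`. -/
theorem exists_sobolev_V0 (hΩ : IsPolygonalDomain Ω) (hD : IsDirichletPart Ω D) {k : ℕ} {p q : ℝ}
    (h : IsExponentPair k p q) : ∃ C : NNReal, ∀ {u : H1 Ω ℂ} {f : Lp ℂ 2 (arc (frontier Ω))},
      IsTrace u f → f =ᵐ[arc D] 0 → eLpNorm (h1Fn u) (4 * k : ℕ) (volume.restrict Ω)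
        ≤ C * eLpNorm (h1Grad u) (ENNReal.ofReal q) (volume.restrict Ω) := by
  obtain ⟨C₁, hC₁⟩ := SmoothLimit.sobolev hΩ h.pos h.p_eq h.holderConjugate h.lt_two.le
  obtain ⟨C₂, hC₂⟩ := SmoothLimit.friedrichs hΩ hD
  have := isFiniteMeasure_restrict hΩ
  have hq1 : 1 ≤ ENNReal.ofReal q := by
    rw [← ENNReal.ofReal_one]; exact ENNReal.ofReal_le_ofReal h.one_lt.le
  have hq2 : ENNReal.ofReal q ≤ 2 := by
    rw [← ENNReal.ofReal_ofNat]; exact ENNReal.ofReal_le_ofReal h.lt_two.le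
  obtain ⟨K, hK⟩ := exists_eLpNorm_le_two (volume.restrict Ω) hq2 hq1
  set W := (volume.restrict Ω Set.univ)
    ^ (1 / (1 : ENNReal).toReal - 1 / (ENNReal.ofReal q).toReal) with hW
  have hWt : W ≠ ⊤ := by
    refine ENNReal.rpow_ne_top_of_nonneg ?_ (measure_ne_top _ _)
    rw [ENNReal.toReal_ofReal (by linarith [h.one_lt]), ENNReal.toReal_one, sub_nonneg]
    exact one_div_le_one_div_of_le (by norm_num) h.one_lt.le
  refine ⟨C₁ * (1 + K * (C₂ * W.toNNReal)), fun {u f} hf h0 => ?_⟩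
  have hs := isTrace_iff_smoothLimit.1 hf
  set N := eLpNorm (h1Grad u) (ENNReal.ofReal q) (volume.restrict Ω) with hN
  have h1 : eLpNorm (h1Grad u) 1 (volume.restrict Ω) ≤ N * W :=
    eLpNorm_le_eLpNorm_mul_rpow_measure_univ hq1 (Lp.aestronglyMeasurable _)
  have h2 := hC₂ (measTriple_h1 u f) hs h0
  have h3 := hK (Lp.aestronglyMeasurable (h1Fn u))
  refine (hC₁ (measTriple_h1 u f) hs).trans ?_
  push_cast
  rw [ENNReal.coe_toNNReal hWt]
  -- The lower-order term is removed by the Friedrichs inequality, which needs only the `L¹` norm of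
  -- the gradient and hence is available for `q < 2`.
  calc _ ≤ (C₁ : ENNReal) * (N + K * (C₂ * (N * W))) :=
        mul_le_mul_right (add_le_add le_rfl (h3.trans (mul_le_mul_right
          (h2.trans (mul_le_mul_right h1 _)) _))) _
    _ = _ := by ring

theorem eLpNorm_dualField {q p : ℝ} (hpq : p.HolderConjugate q) (G : Plane → CPlane)
    (μ : Measure Plane) : eLpNorm (fun x => dualField q (G x)) (ENNReal.ofReal p) μ
      = eLpNorm G (ENNReal.ofReal q) μ ^ (q - 1) := by
  have hp := hpq.pos
  have hq := hpq.symm.pos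
  have hq1 := hpq.symm.lt
  have h1 : eLpNorm (fun x => dualField q (G x)) (ENNReal.ofReal p) μ ^ p
      = (eLpNorm G (ENNReal.ofReal q) μ ^ (q - 1)) ^ p := by
    rw [eLpNorm_rpow_eq hp, ← ENNReal.rpow_mul, hpq.symm.sub_one_mul_conj, eLpNorm_rpow_eq hq]
    refine lintegral_congr fun x => ?_
    rw [← ofReal_norm, norm_dualField hq1, ← ENNReal.ofReal_rpow_of_nonneg (norm_nonneg _)
      (by linarith), ofReal_norm, ← ENNReal.rpow_mul, hpq.symm.sub_one_mul_conj]
  exact ENNReal.rpow_left_injective hp.ne' h1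

/-- The pairing of a gradient with its dual field is a power of its norm. -/
theorem enorm_integral_dualField {q : ℝ} (hq1 : 1 < q) {G F : Lp CPlane 2 (volume.restrict Ω)}
    (hF : F =ᵐ[volume.restrict Ω] fun x => dualField q (G x)) :
    ‖∫ x in Ω, diagForm 1 (G x) (F x)‖ₑ
      = eLpNorm G (ENNReal.ofReal q) (volume.restrict Ω) ^ q := by
  have e1 : ∫ x in Ω, diagForm 1 (G x) (F x) = ((∫ x in Ω, ‖G x‖ ^ q : ℝ) : ℂ) := by
    rw [← integral_complex_ofReal]
    refine integral_congr_ae ?_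
    filter_upwards [hF] with x hx
    rw [hx, diagForm_dualField hq1]
  have hint : Integrable (fun x => ‖G x‖ ^ q) (volume.restrict Ω) := by
    have h1 := integrable_diagForm (μ := volume.restrict Ω) (m := fun _ => 1) (M := 1)
      (fun _ => aestronglyMeasurable_const) (by simp) (Lp.memLp G) (Lp.memLp F)
    refine h1.re.congr ?_
    filter_upwards [hF] with x hx
    rw [hx, diagForm_dualField hq1]
    rfl
  rw [e1, ← ofReal_norm, Complex.norm_real, Real.norm_of_nonneg
    (integral_nonneg fun x => by positivity), ofReal_integral_eq_lintegral_ofReal hint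
    (ae_of_all _ fun x => by positivity), eLpNorm_rpow_eq (by linarith)]
  refine lintegral_congr fun x => ?_
  rw [← ENNReal.ofReal_rpow_of_nonneg (norm_nonneg _) (by linarith), ofReal_norm]

/-- The Hölder inequality for a form with coefficients bounded by `L |u|`. -/
theorem enorm_integral_diagForm_le {k : ℕ} {p q : ℝ} (h : IsExponentPair k p q) {L : ℝ}
    (hL : 0 ≤ L) {n : Plane → Fin 2 → ℂ} {u : Plane → ℝ} (hn : ∀ x i, ‖n x i‖ ≤ L * |u x|)
    (hu : AEStronglyMeasurable u (volume.restrict Ω)) (G H : Lp CPlane 2 (volume.restrict Ω)) :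
    ‖∫ x in Ω, diagForm (n x) (G x) (H x)‖ₑ ≤ L.toNNReal *
      (eLpNorm u (4 * k : ℕ) (volume.restrict Ω) * ‖G‖ₑ
        * eLpNorm H (ENNReal.ofReal p) (volume.restrict Ω)) := by
  have ht := h.holderTriple
  have ht1 := h.holderTriple_one
  refine (enorm_integral_le_lintegral_enorm _).trans ?_
  set v : Plane → CPlane := fun x => (u x : ℂ) • G x with hv
  have huC : AEStronglyMeasurable (fun x => (u x : ℂ)) (volume.restrict Ω) :=
    Complex.continuous_ofReal.comp_aestronglyMeasurable hu
  have hvm : AEStronglyMeasurable v (volume.restrict Ω) := huC.smul (Lp.aestronglyMeasurable _)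
  have hvn : eLpNorm v (ENNReal.ofReal q) (volume.restrict Ω)
      ≤ eLpNorm u (4 * k : ℕ) (volume.restrict Ω) * ‖G‖ₑ := by
    rw [Lp.enorm_def]
    have h1 := eLpNorm_smul_le_mul_eLpNorm (p := (4 * k : ℕ)) (q := 2) (r := ENNReal.ofReal q)
      (Lp.aestronglyMeasurable G) huC
    refine h1.trans_eq ?_
    congr 1
    refine eLpNorm_congr_norm_ae (ae_of_all _ fun x => ?_)
    rw [Complex.norm_real]
  calc _ ≤ ∫⁻ x in Ω, (L.toNNReal : ENNReal) * (‖v x‖ₑ * ‖H x‖ₑ) := by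
        refine lintegral_mono fun x => ?_
        have h1 := norm_diagForm_le (hn x) (G x) (H x)
        have h2 : ‖v x‖ = |u x| * ‖G x‖ := by
          rw [hv, norm_smul, Complex.norm_real, Real.norm_eq_abs]
        rw [← ofReal_norm, ← ofReal_norm, ← ofReal_norm, ← ENNReal.ofReal_mul (norm_nonneg _),
          ← ENNReal.ofReal_coe_nnreal, Real.coe_toNNReal _ hL, ← ENNReal.ofReal_mul hL]
        refine ENNReal.ofReal_le_ofReal (h1.trans_eq ?_)
        rw [h2]; ring
    _ ≤ L.toNNReal * (eLpNorm v (ENNReal.ofReal q) (volume.restrict Ω)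
        * eLpNorm H (ENNReal.ofReal p) (volume.restrict Ω)) := by
        rw [lintegral_const_mul' _ _ ENNReal.coe_ne_top]
        exact mul_le_mul_right (lintegral_enorm_mul_le hvm (Lp.aestronglyMeasurable _)) _
    _ ≤ _ := mul_le_mul_right (mul_le_mul' hvn le_rfl) _

theorem ennreal_le_of_rpow_le {N K : ENNReal} {q : ℝ} (hq : 1 < q) (hN : N ≠ ⊤)
    (h : N ^ q ≤ K * N ^ (q - 1)) : N ≤ K := by
  rcases eq_or_ne N 0 with hN0 | hN0
  · rw [hN0]; exact zero_le
  · have h2 : N ^ q = N * N ^ (q - 1) := by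
      nth_rewrite 2 [← ENNReal.rpow_one N]
      rw [← ENNReal.rpow_add _ _ hN0 hN]
      congr 1; ring
    rw [h2] at h
    have h3 : N ^ (q - 1) ≠ 0 := by
      rw [Ne, ENNReal.rpow_eq_zero_iff]
      push Not
      exact ⟨fun h => absurd h hN0, fun h => absurd h hN⟩
    exact (ENNReal.mul_le_mul_iff_left h3
      (ENNReal.rpow_ne_top_of_nonneg (by linarith) hN)).1 h

/-- The boundary data cancel. The difference solves a problem with coefficient `m₁`, driven by the
difference of the coefficients acting on `∇S₂`. -/
theorem IsLinearSolution.bform_sub {m₁ m₂ : Plane → Fin 2 → ℂ} (hm₁ : IsCoefficient Ω m₁ M ε)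
    (hm₂ : IsCoefficient Ω m₂ M ε) {g : Lp ℝ 2 (arc (frontier Ω \ D))} {S₁ S₂ : H1 Ω ℂ}
    (hS₁ : IsLinearSolution D m₁ g S₁) (hS₂ : IsLinearSolution D m₂ g S₂) {η : H1 Ω ℂ}
    {f : Lp ℂ 2 (arc (frontier Ω))} (hη : IsTrace η f) (h0 : f =ᵐ[arc D] 0) :
    bform m₁ (S₁ - S₂) η
      = ∫ x in Ω, diagForm (fun i => m₂ x i - m₁ x i) (h1Grad S₂ x) (h1Grad η x) := by
  rw [hm₁.bform_sub_left, hS₁ η f hη h0, ← hS₂ η f hη h0,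
    bform, bform, ← integral_sub (hm₂.integrable _ _) (hm₁.integrable _ _)]
  refine integral_congr_ae (ae_of_all _ fun x => ?_)
  simp only [diagForm, Fin.sum_univ_two]
  ring

/-- The gradient estimate for the difference of the solutions of two linear problems with the same
data. -/
theorem eLpNorm_grad_sub_le (hΩ : IsPolygonalDomain Ω) (hD : IsDirichletPart Ω D) (hM : 0 ≤ M)
    (hε : 0 < ε) {L : ℝ} (hL : 0 ≤ L) {k : ℕ} {p q : ℝ} (h : IsExponentPair k p q) {C : NNReal}
    {m₁ m₂ : Plane → Fin 2 → ℂ} {u₁ u₂ : Plane → ℝ} (hm₁ : IsCoefficient Ω m₁ M ε)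
    (hC : ∀ {F : Lp CPlane 2 (volume.restrict Ω)} {η : H1 Ω ℂ} {f : Lp ℂ 2 (arc (frontier Ω))},
      IsAdjointSolution Ω D m₁ F η f →
        eLpNorm (h1Grad η) (ENNReal.ofReal p) (volume.restrict Ω)
          ≤ C * eLpNorm F (ENNReal.ofReal p) (volume.restrict Ω))
    (hm₂ : IsCoefficient Ω m₂ M ε) (hlip : ∀ x i, ‖m₂ x i - m₁ x i‖ ≤ L * |u₁ x - u₂ x|)
    (hu₁ : AEStronglyMeasurable u₁ (volume.restrict Ω))
    (hu₂ : AEStronglyMeasurable u₂ (volume.restrict Ω))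
    {g : Lp ℝ 2 (arc (frontier Ω \ D))} {S₁ S₂ : H1 Ω ℂ} {f : Lp ℂ 2 (arc (frontier Ω))}
    (hS₁ : IsLinearSolution D m₁ g S₁) (hS₂ : IsLinearSolution D m₂ g S₂)
    (hf : IsTrace (S₁ - S₂) f) (h0 : f =ᵐ[arc D] 0) :
    eLpNorm (h1Grad (S₁ - S₂)) (ENNReal.ofReal q) (volume.restrict Ω)
      ≤ L.toNNReal * C * ‖h1Grad S₂‖ₑ *
          eLpNorm (fun x => u₁ x - u₂ x) (4 * k : ℕ) (volume.restrict Ω) := by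
  have := isFiniteMeasure_restrict hΩ
  have hq1 := h.one_lt
  have hq2 := h.lt_two
  have hFae := (memLp_dualField hΩ hq1 hq2.le (h1Grad (S₁ - S₂))).coeFn_toLp
  -- Duality: with the dual field of `∇(S₁ - S₂)` as right-hand side, testing the adjoint equation
  -- with `S₁ - S₂` gives `‖∇(S₁ - S₂)‖_q^q`. The assumed estimate bounds `‖∇η‖_p` by `‖∇(S₁ -
  -- S₂)‖_q^{q-1}`.
  obtain ⟨η, fη, hη⟩ := exists_adjointSolution hΩ hD hM hε hm₁
    (memLp_dualField hΩ hq1 hq2.le (h1Grad (S₁ - S₂))).toLp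
  have hηp := hC hη
  rw [eLpNorm_congr_ae hFae, eLpNorm_dualField h.holderConjugate] at hηp
  have e2 := enorm_integral_dualField hq1 hFae
  rw [← hη.eq _ f hf h0] at e2
  have e3 := IsLinearSolution.bform_sub hm₁ hm₂ hS₁ hS₂ hη.trace hη.zero
  have e4 := enorm_integral_diagForm_le h hL hlip (hu₁.sub hu₂) (h1Grad S₂) (h1Grad η)
  rw [← e3, bform, e2] at e4
  -- The power `q - 1` is cancelled; the norm is finite because the gradient is in `L²` and `q < 2`
  -- on a bounded domain.
  refine ennreal_le_of_rpow_le hq1 ?_ (e4.trans ?_)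
  · refine ((Lp.memLp (h1Grad (S₁ - S₂))).mono_exponent ?_).2.ne
    rw [← ENNReal.ofReal_ofNat]; exact ENNReal.ofReal_le_ofReal hq2.le
  · refine (mul_le_mul_right (mul_le_mul_right hηp _) _).trans_eq ?_
    ring

/-- The Meyers estimate for an exponent of the form `4k / (2k - 1)`. -/
theorem exists_exponentPair_meyers (hΩ : IsPolygonalDomain Ω) (hD : IsDirichletPart Ω D)
    (M : ℝ) (hε : 0 < ε) : ∃ (k : ℕ) (p q : ℝ) (C : NNReal), IsExponentPair k p q ∧
      ∀ {m : Plane → Fin 2 → ℂ}, IsCoefficient Ω m M ε →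
      ∀ {F : Lp CPlane 2 (volume.restrict Ω)} {η : H1 Ω ℂ} {f : Lp ℂ 2 (arc (frontier Ω))},
      IsAdjointSolution Ω D m F η f →
        eLpNorm (h1Grad η) (ENNReal.ofReal p) (volume.restrict Ω)
          ≤ C * eLpNorm F (ENNReal.ofReal p) (volume.restrict Ω) := by
  obtain ⟨Q₀, hQ₀, hmey⟩ := IsAdjointSolution.meyers (M := M) hΩ hD hε
  -- Since `p = 2 + 2/(2k - 1)`, a large `k` brings `p - 2` below the gain `Q₀`.
  obtain ⟨k, hk⟩ := exists_nat_gt (2 / Q₀ + 1)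
  have hk1 : (1 : ℝ) < k := lt_trans (by simpa using (by positivity : 0 < 2 / Q₀)) hk
  have h : IsExponentPair k (4 * k / (2 * k - 1)) (4 * k / (2 * k + 1)) :=
    ⟨by exact_mod_cast (zero_lt_one.trans hk1), rfl, rfl⟩
  have hpQ : (4 * k / (2 * k - 1) : ℝ) = 2 + 2 / (2 * k - 1) := by
    have : (2 * (k : ℝ) - 1) ≠ 0 := by linarith
    rw [div_eq_iff this, add_mul, div_mul_cancel₀ _ this]
    ring
  obtain ⟨C₁, hC₁⟩ := hmey (2 / (2 * k - 1)) (div_pos two_pos (by linarith)) (by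
    rw [div_le_iff₀ (by linarith)]
    have : 2 < Q₀ * k := by
      have h1 : 2 / Q₀ < k := by linarith
      rwa [div_lt_iff₀ hQ₀, mul_comm] at h1
    nlinarith)
  rw [← hpQ] at hC₁
  exact ⟨k, _, _, C₁, h, hC₁⟩

/-- The contraction estimate: the difference of the solutions of two linear problems with the same
data is controlled by the difference of the coefficients. -/
theorem exists_contraction (hΩ : IsPolygonalDomain Ω) (hD : IsDirichletPart Ω D) (hM : 0 ≤ M)
    (hε : 0 < ε) {L : ℝ} (hL : 0 ≤ L) : ∃ (k : ℕ) (p q : ℝ) (C : NNReal), IsExponentPair k p q ∧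
      ∀ {m₁ m₂ : Plane → Fin 2 → ℂ} {u₁ u₂ : Plane → ℝ}, IsCoefficient Ω m₁ M ε →
      IsCoefficient Ω m₂ M ε → (∀ x i, ‖m₂ x i - m₁ x i‖ ≤ L * |u₁ x - u₂ x|) →
      AEStronglyMeasurable u₁ (volume.restrict Ω) → AEStronglyMeasurable u₂ (volume.restrict Ω) →
      ∀ {g : Lp ℝ 2 (arc (frontier Ω \ D))} {S₁ S₂ : H1 Ω ℂ} {f : Lp ℂ 2 (arc (frontier Ω))},
      IsLinearSolution D m₁ g S₁ → IsLinearSolution D m₂ g S₂ → IsTrace (S₁ - S₂) f →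
      f =ᵐ[arc D] 0 →
      eLpNorm (h1Fn (S₁ - S₂)) (4 * k : ℕ) (volume.restrict Ω) ≤ C * ‖h1Grad S₂‖ₑ *
          eLpNorm (fun x => u₁ x - u₂ x) (4 * k : ℕ) (volume.restrict Ω) ∧
      eLpNorm (h1Grad (S₁ - S₂)) (ENNReal.ofReal q) (volume.restrict Ω) ≤ C * ‖h1Grad S₂‖ₑ *
          eLpNorm (fun x => u₁ x - u₂ x) (4 * k : ℕ) (volume.restrict Ω) := by
  obtain ⟨k, p, q, C₁, h, hC₁⟩ := exists_exponentPair_meyers hΩ hD M hε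
  obtain ⟨C₂, hC₂⟩ := exists_sobolev_V0 hΩ hD h
  refine ⟨k, _, _, (C₂ + 1) * (L.toNNReal * C₁), h, fun {m₁ m₂ u₁ u₂} hm₁ hm₂ hlip hu₁ hu₂
    {g S₁ S₂ f} hS₁ hS₂ hf h0 => ?_⟩
  have e5 := eLpNorm_grad_sub_le hΩ hD hM hε hL h hm₁ (hC₁ hm₁) hm₂ hlip hu₁ hu₂ hS₁ hS₂ hf h0
  set d := eLpNorm (fun x => u₁ x - u₂ x) (4 * k : ℕ) (volume.restrict Ω)
  rw [ENNReal.coe_mul, ENNReal.coe_mul, ENNReal.coe_add, ENNReal.coe_one]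
  constructor
  · refine ((hC₂ hf h0).trans (mul_le_mul' le_self_add e5)).trans_eq (b := ((C₂ : ENNReal) + 1) * _) ?_
    ring
  · refine (e5.trans (le_mul_of_one_le_left zero_le le_add_self)).trans_eq (b := ((C₂ : ENNReal) + 1) * _) ?_
    ring

end RhombiSlits

namespace RhombiSlits

variable {Ω D : Set Plane} {α β ξm ξp ε : ℝ}

/-! ### The nonlinear problem -/

/-- A nonlinear solution is a linear solution whose coefficient is frozen at its own real part,
which makes existence a fixed point question. -/
theorem isSolution_iff {ξD : Lp ℝ 2 (arc D)} {g : Lp ℝ 2 (arc (frontier Ω \ D))} {ξ : H1 Ω ℂ} :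
    IsSolution D α β ξm ξp ε ξD g ξ ↔ ξ ∈ VD Ω D ξD ∧
      IsLinearSolution D (fun x => coef α β ξm ξp ε (h1Fn ξ x).re) g ξ := by
  refine and_congr_right fun _ => ?_
  simp only [IsLinearSolution, aForm_eq, bform]

theorem IsLinearSolution.congr {u v : Plane → ℝ} {g : Lp ℝ 2 (arc (frontier Ω \ D))}
    {S : H1 Ω ℂ} (h : IsLinearSolution D (fun x => coef α β ξm ξp ε (u x)) g S)
    (huv : u =ᵐ[volume.restrict Ω] v) :
    IsLinearSolution D (fun x => coef α β ξm ξp ε (v x)) g S := by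
  intro η f hf h0
  rw [← h η f hf h0, bform, bform]
  refine integral_congr_ae ?_
  filter_upwards [huv] with x hx
  rw [hx]

/-- Functions with the same data on `D` differ by an element of `V₀`. -/
theorem exists_trace_sub (hD : D ⊆ frontier Ω) {ξD : Lp ℝ 2 (arc D)} {S₁ S₂ : H1 Ω ℂ}
    (h₁ : S₁ ∈ VD Ω D ξD) (h₂ : S₂ ∈ VD Ω D ξD) :
    ∃ f : Lp ℂ 2 (arc (frontier Ω)), IsTrace (S₁ - S₂) f ∧ f =ᵐ[arc D] 0 := by
  obtain ⟨f₁, hf₁, e₁⟩ := h₁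
  obtain ⟨f₂, hf₂, e₂⟩ := h₂
  refine ⟨f₁ - f₂, hf₁.sub hf₂, ?_⟩
  filter_upwards [e₁, e₂, ae_mono (arc_le_frontier hD) (Lp.coeFn_sub f₁ f₂)] with x h1 h2 h3
  rw [h3, Pi.sub_apply, h1, h2]
  simp

theorem h1Fn_sub (u v : H1 Ω ℂ) :
    h1Fn (u - v) =ᵐ[volume.restrict Ω] fun x => h1Fn u x - h1Fn v x :=
  Lp.coeFn_sub (h1Fn u) (h1Fn v)

theorem memLp_re_h1Fn (hΩ : IsPolygonalDomain Ω) {k : ℕ} {p q : ℝ} (h : IsExponentPair k p q)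
    {ξD : Lp ℝ 2 (arc D)} {S : H1 Ω ℂ} (hS : S ∈ VD Ω D ξD) :
    MemLp (fun x => (h1Fn S x).re) (4 * k : ℕ) (volume.restrict Ω) := by
  obtain ⟨C, hC⟩ := SmoothLimit.sobolev hΩ h.pos h.p_eq h.holderConjugate h.lt_two.le
  obtain ⟨f, hf, -⟩ := hS
  have := isFiniteMeasure_restrict hΩ
  have hq2 : ENNReal.ofReal q ≤ 2 := by
    rw [← ENNReal.ofReal_ofNat]; exact ENNReal.ofReal_le_ofReal h.lt_two.le
  have h1 := hC (measTriple_h1 S f) (isTrace_iff_smoothLimit.1 hf)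
  have h2 : MemLp (h1Fn S) (4 * k : ℕ) (volume.restrict Ω) :=
    ⟨Lp.aestronglyMeasurable _, h1.trans_lt (ENNReal.mul_lt_top ENNReal.coe_lt_top
      (ENNReal.add_lt_top.2 ⟨((Lp.memLp (h1Grad S)).mono_exponent hq2).2,
        ((Lp.memLp (h1Fn S)).mono_exponent hq2).2⟩))⟩
  exact h2.re

theorem aestronglyMeasurable_re (S : H1 Ω ℂ) :
    AEStronglyMeasurable (fun x => (h1Fn S x).re) (volume.restrict Ω) :=
  Complex.continuous_re.comp_aestronglyMeasurable (Lp.aestronglyMeasurable _)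

theorem eLpNorm_re_sub_le (S₁ S₂ : H1 Ω ℂ) (s : ENNReal) :
    eLpNorm (fun x => (h1Fn S₁ x).re - (h1Fn S₂ x).re) s (volume.restrict Ω)
      ≤ eLpNorm (h1Fn (S₁ - S₂)) s (volume.restrict Ω) := by
  refine eLpNorm_mono_ae ?_
  filter_upwards [h1Fn_sub S₁ S₂] with x hx
  rw [hx, ← Complex.sub_re]
  exact Complex.abs_re_le_norm _

/-- The quotient norm is an infimum, so an extension of norm below `2δ` is taken instead of a
minimiser. -/
theorem exists_extension {ξD : Lp ℝ 2 (arc D)} (hD : D ⊆ frontier Ω) (hξ : ξD ∈ HHalf Ω D)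
    {δ : ℝ} (hδ : 0 < δ) (hn : hHalfNorm Ω D ξD ≤ δ) : ∃ U ∈ VD Ω D ξD, ‖U‖ ≤ 2 * δ := by
  obtain ⟨u₀, hu₀⟩ := hξ
  obtain ⟨t, ⟨u, ⟨f, hf, hfD⟩, rfl⟩, ht⟩ := exists_lt_of_csInf_lt
    (s := {t | ∃ u : H1 Ω ℝ, HasTraceOn D u ξD ∧ t = ‖u‖}) ⟨_, u₀, hu₀, rfl⟩
    (show hHalfNorm Ω D ξD < 2 * δ by linarith)
  obtain ⟨U, F, hUF, hUn, hF⟩ := exists_complexification hf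
  refine ⟨U, ⟨F, hUF, ?_⟩, by rw [hUn]; exact ht.le⟩
  filter_upwards [hfD, ae_mono (arc_le_frontier hD) hF] with x h1 h2
  rw [h2, h1]

/-- A map of `L^s` into itself that halves distances has a fixed point. -/
theorem exists_fixed_point {μ : Measure Plane} {s : ENNReal} [Fact (1 ≤ s)]
    (Φ : Lp ℝ s μ → Lp ℝ s μ) (h : ∀ u v, ‖Φ u - Φ v‖ₑ ≤ (1 / 2 : NNReal) * ‖u - v‖ₑ) :
    ∃ u, Φ u = u := by
  have hc : ContractingWith (1 / 2) Φ := by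
    refine ⟨by rw [← NNReal.coe_lt_coe]; norm_num, fun u v => ?_⟩
    rw [edist_eq_enorm_sub, edist_eq_enorm_sub]
    exact h u v
  have : Nonempty (Lp ℝ s μ) := ⟨0⟩
  exact ⟨_, hc.fixedPoint_isFixedPt⟩

theorem ennreal_eq_zero_of_le_half {d : ENNReal} (hd : d ≠ ⊤) (h : d ≤ (1 / 2 : NNReal) * d) :
    d = 0 := by
  lift d to NNReal using hd
  rw [← ENNReal.coe_mul, ENNReal.coe_le_coe, ← NNReal.coe_le_coe] at h
  push_cast at h
  have h2 : (d : ℝ) = 0 := le_antisymm (by linarith) d.coe_nonneg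
  exact_mod_cast h2

theorem eq_of_eLpNorm_sub_eq_zero {S T : H1 Ω ℂ} {s q : ENNReal} (hs : s ≠ 0) (hq : q ≠ 0)
    (h1 : eLpNorm (h1Fn (S - T)) s (volume.restrict Ω) = 0)
    (h2 : eLpNorm (h1Grad (S - T)) q (volume.restrict Ω) = 0) : S = T := by
  have z1 : h1Fn (S - T) = 0 := Lp.ext
    (((eLpNorm_eq_zero_iff (Lp.aestronglyMeasurable _) hs).1 h1).trans
      (Lp.coeFn_zero _ _ _).symm)
  have z2 : h1Grad (S - T) = 0 := Lp.ext
    (((eLpNorm_eq_zero_iff (Lp.aestronglyMeasurable _) hq).1 h2).trans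
      (Lp.coeFn_zero _ _ _).symm)
  have z3 := norm_h1_le (S - T)
  rw [z1, z2, norm_zero, norm_zero, add_zero] at z3
  exact sub_eq_zero.1 (norm_le_zero_iff.1 z3)

theorem exists_unique_solution (hΩ : IsPolygonalDomain Ω) (hD : IsDirichletPart Ω D) {M L : ℝ}
    (hL : 0 < L) (hM : ∀ (t : ℝ) (i j : Fin 2), |Bhat α β ξm ξp t i j| ≤ M)
    (hlip : ∀ (i : Fin 2) (s t : ℝ),
      |Bhat α β ξm ξp s i i - Bhat α β ξm ξp t i i| ≤ L * |s - t|) (hε : 0 < ε) :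
    ∃ δ₀ : ℝ, 0 < δ₀ ∧ ∀ δ : ℝ, 0 < δ → δ ≤ δ₀ → ∀ ξD ∈ HHalf Ω D,
      ∀ g : Lp ℝ 2 (arc (frontier Ω \ D)), hHalfNorm Ω D ξD ≤ δ → ‖g‖ ≤ δ →
        ∃! ξ : H1 Ω ℂ, IsSolution D α β ξm ξp ε ξD g ξ := by
  have hM0 : 0 ≤ M + |ε| := add_nonneg ((abs_nonneg _).trans (hM 0 0 0)) (abs_nonneg _)
  obtain ⟨C₁, hC₁, hgrad⟩ := exists_norm_grad_le (M := M + |ε|) hΩ hD hM0 hε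
  obtain ⟨k, p, q, C₂, hk, hcon⟩ := exists_contraction (M := M + |ε|) hΩ hD hM0 hε hL.le
  have hcoef : ∀ {u : Plane → ℝ}, AEStronglyMeasurable u (volume.restrict Ω) →
      IsCoefficient Ω (fun x => coef α β ξm ξp ε (u x)) (M + |ε|) ε :=
    fun hu => isCoefficient_coef hM hL hlip hu
  have hdiff : ∀ (u₁ u₂ : Plane → ℝ) (x : Plane) (i : Fin 2),
      ‖coef α β ξm ξp ε (u₂ x) i - coef α β ξm ξp ε (u₁ x) i‖ ≤ L * |u₁ x - u₂ x| := by
    intro u₁ u₂ x i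
    rw [coef, coef, add_sub_add_right_eq_sub, ← Complex.ofReal_sub, Complex.norm_real,
      Real.norm_eq_abs, abs_sub_comm (u₁ x)]
    exact hlip i _ _
  -- With `‖∇S‖₂ ≤ C₁δ` this makes the contraction factor `C₂‖∇S‖₂` at most `1/2`; `C₂ + 1` avoids
  -- dividing by zero.
  refine ⟨1 / (2 * (C₂ + 1) * C₁), by positivity, fun δ hδ hδ₀ ξD hξD g hξ hg => ?_⟩
  obtain ⟨U, hU, hUδ⟩ := exists_extension hD.subset hξD hδ hξ
  have hsmall : ∀ {u : Plane → ℝ} {S : H1 Ω ℂ}, AEStronglyMeasurable u (volume.restrict Ω) →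
      S ∈ VD Ω D ξD → IsLinearSolution D (fun x => coef α β ξm ξp ε (u x)) g S →
      C₂ * ‖h1Grad S‖ₑ ≤ (1 / 2 : NNReal) := by
    intro u S hu hS hlin
    have h1 := hgrad (hcoef hu) hU hS hlin hUδ hg
    have h2 : C₂ * ‖h1Grad S‖ ≤ 1 / 2 := by
      calc C₂ * ‖h1Grad S‖ ≤ (C₂ + 1) * (C₁ * (1 / (2 * (C₂ + 1) * C₁))) := by
            gcongr
            · linarith
            · exact h1.trans (by gcongr)
        _ = 1 / 2 := by field_simp
    rw [enorm_eq_nnnorm, ← ENNReal.coe_mul, ENNReal.coe_le_coe]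
    rw [← NNReal.coe_le_coe]
    push_cast
    exact h2
  have hest : ∀ {u₁ u₂ : Plane → ℝ} {S₁ S₂ : H1 Ω ℂ},
      AEStronglyMeasurable u₁ (volume.restrict Ω) → AEStronglyMeasurable u₂ (volume.restrict Ω) →
      S₁ ∈ VD Ω D ξD → S₂ ∈ VD Ω D ξD →
      IsLinearSolution D (fun x => coef α β ξm ξp ε (u₁ x)) g S₁ →
      IsLinearSolution D (fun x => coef α β ξm ξp ε (u₂ x)) g S₂ →
      eLpNorm (h1Fn (S₁ - S₂)) (4 * k : ℕ) (volume.restrict Ω) ≤ (1 / 2 : NNReal) *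
          eLpNorm (fun x => u₁ x - u₂ x) (4 * k : ℕ) (volume.restrict Ω) ∧
      eLpNorm (h1Grad (S₁ - S₂)) (ENNReal.ofReal q) (volume.restrict Ω) ≤ (1 / 2 : NNReal) *
          eLpNorm (fun x => u₁ x - u₂ x) (4 * k : ℕ) (volume.restrict Ω) := by
    intro u₁ u₂ S₁ S₂ hu₁ hu₂ h₁ h₂ hS₁ hS₂
    obtain ⟨f, hf, h0⟩ := exists_trace_sub hD.subset h₁ h₂
    have := hcon (hcoef hu₁) (hcoef hu₂) (hdiff u₁ u₂) hu₁ hu₂ hS₁ hS₂ hf h0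
    have hs := hsmall hu₂ h₂ hS₂
    exact ⟨this.1.trans (mul_le_mul' hs le_rfl), this.2.trans (mul_le_mul' hs le_rfl)⟩
  have hfact : Fact (1 ≤ ((4 * k : ℕ) : ENNReal)) := ⟨by
    have := hk.pos
    exact_mod_cast (by omega : 1 ≤ 4 * k)⟩
  have hex : ∀ u : Lp ℝ (4 * k : ℕ) (volume.restrict Ω), ∃ S ∈ VD Ω D ξD,
      IsLinearSolution D (fun x => coef α β ξm ξp ε (u x)) g S := fun u =>
    exists_isLinearSolution hΩ hD hM0 hε (hcoef (Lp.aestronglyMeasurable u)) g hU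
  choose Sol hSol hlin using hex
  have hmem : ∀ u, MemLp (fun x => (h1Fn (Sol u) x).re) (4 * k : ℕ) (volume.restrict Ω) :=
    fun u => memLp_re_h1Fn hΩ hk (hSol u)
  -- The map is `u ↦ Re S(u)` on `L^{4k}(Ω)`. That it takes values there is the Sobolev embedding.
  obtain ⟨u, hu⟩ := exists_fixed_point (fun u => (hmem u).toLp) fun u v => by
    rw [← MemLp.toLp_sub, Lp.enorm_toLp, Lp.enorm_def]
    refine (eLpNorm_re_sub_le _ _ _).trans ((hest (Lp.aestronglyMeasurable u)
      (Lp.aestronglyMeasurable v) (hSol u) (hSol v) (hlin u) (hlin v)).1.trans_eq ?_)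
    rw [eLpNorm_congr_ae (Lp.coeFn_sub u v)]
    rfl
  refine ⟨Sol u, isSolution_iff.2 ⟨hSol u, (hlin u).congr ?_⟩, fun ξ hξs => ?_⟩
  · have := (hmem u).coeFn_toLp
    rw [hu] at this
    exact this
  -- Uniqueness: both solutions are frozen at their own real parts, so the distance `d` of these in
  -- `L^{4k}` satisfies `d ≤ d/2`. It is finite, hence zero, and the same estimates then annihilate
  -- the difference and its gradient.
  · obtain ⟨hξD', hξlin⟩ := isSolution_iff.1 hξs
    have hfix : u =ᵐ[volume.restrict Ω] fun x => (h1Fn (Sol u) x).re := by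
      have := (hmem u).coeFn_toLp
      rw [hu] at this
      exact this
    have hm := aestronglyMeasurable_re ξ
    have hm' := aestronglyMeasurable_re (Sol u)
    have he := hest hm hm' hξD' (hSol u) hξlin ((hlin u).congr hfix)
    set d := eLpNorm (fun x => (h1Fn ξ x).re - (h1Fn (Sol u) x).re) (4 * k : ℕ)
      (volume.restrict Ω) with hd
    have hdt : d ≠ ⊤ := ((memLp_re_h1Fn hΩ hk hξD').sub (hmem u)).2.ne
    have hd0 : d = 0 := by
      have h1 : d ≤ (1 / 2 : NNReal) * d := (eLpNorm_re_sub_le _ _ _).trans he.1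
      exact ennreal_eq_zero_of_le_half hdt h1
    rw [hd0, mul_zero, nonpos_iff_eq_zero, nonpos_iff_eq_zero] at he
    have hq : ENNReal.ofReal q ≠ 0 := by
      have := hk.one_lt
      simp only [ne_eq, ENNReal.ofReal_eq_zero, not_le]
      linarith
    have hk0 : ((4 * k : ℕ) : ENNReal) ≠ 0 := by
      have := hk.pos
      rw [Nat.cast_ne_zero]; omega
    exact eq_of_eLpNorm_sub_eq_zero hk0 hq he.1 he.2

end RhombiSlits

theorem mainTheorem4
    (Ω D : Set RhombiSlits.Plane)
    (hΩ : RhombiSlits.IsPolygonalDomain Ω) (hD : RhombiSlits.IsDirichletPart Ω D)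
    (α β ξm ξp : ℝ) (hα : α ≤ 0) (hβ : 0 ≤ β)
    (hξm : ξm ∈ Set.Icc (-(Real.pi / 2)) 0) (hξp : ξp ∈ Set.Icc 0 (Real.pi / 2))
    (hB : ∃ M : ℝ, 0 < M ∧ ∀ (t : ℝ) (i j : Fin 2), |RhombiSlits.Bhat α β ξm ξp t i j| ≤ M)
    (ε : ℝ) (hε : 0 < ε) :
    ∃ δ₀ : ℝ, 0 < δ₀ ∧ ∀ δ : ℝ, 0 < δ → δ ≤ δ₀ →
      ∀ ξD ∈ RhombiSlits.HHalf Ω D, ∀ g : MeasureTheory.Lp ℝ 2 (RhombiSlits.arc (frontier Ω \ D)),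
        RhombiSlits.hHalfNorm Ω D ξD ≤ δ → ‖g‖ ≤ δ →
          ∃! ξ : RhombiSlits.H1 Ω ℂ, RhombiSlits.IsSolution D α β ξm ξp ε ξD g ξ := by
  obtain ⟨M, -, hM⟩ := hB
  obtain ⟨L, hL, hlip⟩ := RhombiSlits.exists_lipschitz_Bhat hα hβ hξm.2 hξp.1 hM
  exact RhombiSlits.exists_unique_solution hΩ hD hL hM hlip hε
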